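/- Let $K$ be a field of characteristic $0$ (for instance $\mathbb C$), let $t=(t_1=x,t_2,t_3,\dots)$, and let "function" mean an element of $K[[t_1,t_2,\dots]]$; put $\partial=\partial_x$, $\xi(t,\lambda)=\sum_{n\ge1}t_n\lambda^n$ and $[\lambda^{-1}]=(\lambda^{-1},\tfrac12\lambda^{-2},\tfrac13\lambda^{-3},\dots)$. Fix integers $r\ge 1$ and $m\ge 0$. Let $W=1+\sum_{n\ge1}w_n(t)D^{-n}$ be the dressing operator of a solution of the KP hierarchy, i.e. a pseudo-differential operator in $D=\partial$ with $\partial W/\partial t_n=-(L^{n/r})_-W$ for all $n\ge1$, where $L=WD^rW^{-1}$ and $L^{n/r}=WD^nW^{-1}$; the subscripts $+$ and $-$ denote the parts with non-negative and with negative powers of $D$. Let $\psi(t,\lambda)=W(e^{\xi})=w(t,\lambda)e^{\xi(t,\lambda)}$ and $\psi^*(t,\lambda)=(W^*)^{-1}(e^{-\xi})$ be the Baker-Akhiezer functions, and let $$\mathcal W=\mathrm{span}_K\{\partial_x^kF(t,\lambda)|_{t=0}:k=0,1,2,\dots\}\subset K((\lambda^{-1})),\qquad F=\psi,$$ be the point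 of the Sato Grassmannian with generating function $\psi$. An eigenfunction is a function $\Phi$ with $\partial\Phi/\partial t_n=(L^{n/r})_+(\Phi)$ for all $n$; an adjoint eigenfunction is a function $\Psi$ with $\partial\Psi/\partial t_n=-\big((L^{n/r})_+\big)^{*}(\Psi)$ for all $n$. A squared eigenfunction potential (SEP) of such a pair is a function $S$ with $\partial S/\partial t_n=\mathrm{Res}\big(D^{-1}\Psi (L^{n/r})_+\Phi D^{-1}\big)$ for all $n\ge1$; it is unique up to an additive constant. Let $\widehat\Delta_\lambda f(t)=f(t-[\lambda^{-1}])-f(t)$, expanded in powers of $\lambda^{-1}$. For functions $S_1,\dots,S_m$ the constraint $$\Big[\lambda^r+\sum_{a=1}^m\widehat\Delta_\lambda S_a(t)\Big]\mathcal W\subset\mathcal W\qquad(*)$$ means that the generating function $F'(t,\lambda)=\big[\lambda^r+\sum_a\widehat\Delta_\lambda S_a(t)\big]\psi(t,\lambda)$ satisfies $\mathcal W'=\mathrm{span}_K\{\partial_x^kF'(t,\lambda)|_{t=0}:k\ge0\}\subset\mathcal W$. (1) Let $\Phi_a$ be eigenfunctions and $\Psi_a$ adjoint eigenfunctions, $a=1,\dots,m$.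 Then for each $a$ a SEP of $\Phi_a,\Psi_a$ is given by $$S(\Phi_a,\Psi_a)(t)=-\int\!\!\int d\lambda\,d\mu\,\varphi_a^*(\lambda)\varphi_a(\mu)\,\lambda^{-1}\psi^*(t,\lambda)\,\psi(t+[\lambda^{-1}],\mu),$$ where $\int d\lambda$ takes the coefficient of $\lambda^{-1}$ (the integral over $\mu$ is taken first), $\varphi_a(\mu)=\mu^{-1}\psi^*(0,\mu)\Phi_a([\mu^{-1}])$ and $\varphi^*_a(\lambda)=\lambda^{-1}\psi(0,\lambda)\Psi_a(-[\lambda^{-1}])$. Moreover, for any SEPs $S_a$ of $\Phi_a,\Psi_a$, the Lax operator has the $\mathsf{cKP}_{r,m}$ form $$L=D^r+\sum_{l=0}^{r-2}u_lD^l+\sum_{a=1}^m\Phi_aD^{-1}\Psi_a\qquad(**)$$ for some functions $u_l$ if and only if $(*)$ holds. (2) Consequently, $L$ belongs to the $\mathsf{cKP}_{r,m}$ hierarchy, i.e. it has the form $(**)$ for some functions $u_l,\Phi_a,\Psi_a$, if and only if there are eigenfunctions $\Phi_a$ and adjoint eigenfunctions $\Psi_a$, $a=1,\dots,m$, such that $(*)$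 holds with $S_a=S(\Phi_a,\Psi_a)$ given by the formula in (1). For $m=0$ the constraint is the condition $\lambda^r\mathcal W\subset\mathcal W$ of the $r$-KdV reduction. -/

import Mathlib

/-!  # Formal KP hierarchy, its constrained reductions, and points of the Sato Grassmannian

Functions of the multi-time `t = (t₁ = x, t₂, t₃, …)` are formal power series over a field `K`.
A function of the form `g(t, λ) e^{ξ(t, λ)}`, with `ξ(t, λ) = ∑ₙ tₙ λⁿ` and `g` a formal Laurent
series in `λ⁻¹`, is represented by its coefficient `g`. Laurent series are taken in the variable
`λ⁻¹`: `HahnSeries.single n 1` is `λ⁻ⁿ`, and `g.coeff n` is the coefficient of `λ⁻ⁿ`. -/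

noncomputable section

namespace KP

open MvPowerSeries (pderiv constantCoeff)

/-- Functions of the multi-time `t = (t₁, t₂, …)`. -/
abbrev TimeSeries (K : Type*) [Field K] : Type _ := MvPowerSeries ℕ+ K

/-- `∂/∂tₙ`. -/
abbrev dt {K : Type*} [Field K] (n : ℕ+) :
    Derivation K (TimeSeries K) (TimeSeries K) := pderiv K n

/-- `∂ = ∂/∂x`, where `x = t₁`. -/
abbrev dx {K : Type*} [Field K] : Derivation K (TimeSeries K) (TimeSeries K) := dt 1

/-! ## Pseudo-differential operators -/

/-- Families `(aₙ)`, `n ∈ ℤ`, that vanish for all large `n`. -/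
def pdoSubgroup (K : Type*) [Field K] : AddSubgroup (ℤ → TimeSeries K) where
  carrier := {a | ∃ N : ℤ, ∀ n, N < n → a n = 0}
  zero_mem' := ⟨0, fun _ _ => rfl⟩
  add_mem' := by
    rintro a b ⟨M, hM⟩ ⟨N, hN⟩
    refine ⟨max M N, fun n hn => ?_⟩
    simp [hM n (lt_of_le_of_lt (le_max_left M N) hn), hN n (lt_of_le_of_lt (le_max_right M N) hn)]
  neg_mem' := by
    rintro a ⟨M, hM⟩
    exact ⟨M, fun n hn => by simp [hM n hn]⟩

/-- Formal pseudo-differential operators `∑ₙ aₙ Dⁿ`, where `n` is bounded above. -/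
def PDO (K : Type*) [Field K] : Type _ := pdoSubgroup K

namespace PDO

variable {K : Type*} [Field K]

instance : AddCommGroup (PDO K) := inferInstanceAs (AddCommGroup (pdoSubgroup K))

/-- The coefficient of `Dⁿ`, coefficients being written on the left. -/
def coeff (P : PDO K) (n : ℤ) : TimeSeries K := P.1 n

/-- `f Dⁿ`. -/
def monomial (f : TimeSeries K) (n : ℤ) : PDO K :=
  ⟨fun k => if k = n then f else 0, n, fun _ hk => if_neg hk.ne'⟩

/-- The operator of multiplication by `f`. -/
def const (f : TimeSeries K) : PDO K := monomial f 0

/-- `Dⁿ`, for any integer `n`. -/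
def D (n : ℤ) : PDO K := monomial 1 n

instance : One (PDO K) := ⟨const 1⟩

/-- The product given by the generalized Leibniz rule `Dⁱ f = ∑ₖ (i choose k) (∂ᵏ f) Dⁱ⁻ᵏ`;
the sum has finitely many non-zero terms. -/
instance : Mul (PDO K) where
  mul P Q :=
    ⟨fun n => ∑ᶠ p : ℤ × ℕ,
        (Ring.choose p.1 p.2 : ℤ) • (P.coeff p.1 * dx^[p.2] (Q.coeff (n - p.1 + p.2))), by
      obtain ⟨M, hM⟩ := P.2
      obtain ⟨N, hN⟩ := Q.2
      refine ⟨M + N, fun n hn => ?_⟩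
      have h0 : ∀ k : ℕ, (dx^[k] (0 : TimeSeries K)) = 0 := fun k => iterate_map_zero dx k
      rw [← finsum_zero (α := ℤ × ℕ)]
      refine finsum_congr fun p => ?_
      by_cases hp : M < p.1
      · have : P.coeff p.1 = 0 := hM _ hp
        rw [this, zero_mul, smul_zero]
      · have : Q.coeff (n - p.1 + p.2) = 0 := hN _ (by omega)
        rw [this, h0, mul_zero, smul_zero]⟩

/-- The purely differential part `P₊ = ∑_{n ≥ 0} aₙ Dⁿ`. -/
def pos (P : PDO K) : PDO K :=
  ⟨fun n => if 0 ≤ n then P.coeff n else 0, by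
    obtain ⟨M, hM⟩ := P.2
    refine ⟨M, fun n hn => ?_⟩
    have : P.coeff n = 0 := hM n hn
    simp [this]⟩

/-- The purely pseudo-differential part `P₋ = ∑_{n < 0} aₙ Dⁿ`. -/
def neg (P : PDO K) : PDO K := P - P.pos

/-- The residue, i.e. the coefficient of `D⁻¹`. -/
def res (P : PDO K) : TimeSeries K := P.coeff (-1)

/-- The formal adjoint `P* = ∑ₙ (-D)ⁿ aₙ`. -/
def adjoint (P : PDO K) : PDO K :=
  ⟨fun n => ∑ᶠ k : ℕ,
      (((n + k).negOnePow : ℤ) * Ring.choose (n + k) k) • dx^[k] (P.coeff (n + k)), by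
    obtain ⟨M, hM⟩ := P.2
    refine ⟨M, fun n hn => ?_⟩
    have h0 : ∀ k : ℕ, (dx^[k] (0 : TimeSeries K)) = 0 := fun k => iterate_map_zero dx k
    rw [← finsum_zero (α := ℕ)]
    refine finsum_congr fun k => ?_
    have : P.coeff (n + k) = 0 := hM _ (by omega)
    rw [this, h0, smul_zero]⟩

/-- The action `P(f) = ∑_{j ≥ 0} aⱼ ∂ʲ f` of a purely differential operator on a function. -/
def apply (P : PDO K) (f : TimeSeries K) : TimeSeries K :=
  ∑ᶠ j : ℕ, P.coeff j * dx^[j] f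

/-- The coefficientwise derivative `∂P/∂tₙ`. -/
def flow (n : ℕ+) (P : PDO K) : PDO K :=
  ⟨fun k => dt n (P.coeff k), by
    obtain ⟨M, hM⟩ := P.2
    refine ⟨M, fun k hk => ?_⟩
    have : P.coeff k = 0 := hM k hk
    show dt n (P.coeff k) = 0
    rw [this, map_zero]⟩

/-- The inverse of an operator `W = 1 + w₁ D⁻¹ + w₂ D⁻² + ⋯`, as the geometric series
`∑ₖ (1 - W)ᵏ`; since `(1 - W)ᵏ` has order at most `-k`, only `k ≤ -n` contribute to the
coefficient of `Dⁿ`. -/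
def dressInv (W : PDO K) : PDO K :=
  ⟨fun n => if n ≤ 0 then
      ∑ k ∈ Finset.range ((-n).toNat + 1), (npowRec k (1 - W)).coeff n else 0,
    0, fun _ hn => if_neg (not_le.mpr hn)⟩

end PDO

/-! ## The KP hierarchy -/

section Hierarchy

variable {K : Type*} [Field K]

open PDO

/-- `W Dⁿ W⁻¹`. With `n = r` this is the Lax operator `L` of order `r`, and `laxPow W n` is its
fractional power `L^{n/r}`. -/
def laxPow (W : PDO K) (n : ℕ) : PDO K := W * D n * W.dressInv

/-- `Bₙ = (L^{n/r})₊`. -/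
def flowOp (W : PDO K) (n : ℕ) : PDO K := (laxPow W n).pos

/-- `W = 1 + ∑_{n ≥ 1} wₙ D⁻ⁿ` is the dressing operator of a solution of the KP hierarchy: it
satisfies the Wilson-Sato equations `∂W/∂tₙ = -(L^{n/r})₋ W`. -/
structure IsKPDressing (W : PDO K) : Prop where
  coeff_pos : ∀ n : ℤ, 0 < n → W.coeff n = 0
  coeff_zero : W.coeff 0 = 1
  wilson_sato : ∀ n : ℕ+, W.flow n = -((laxPow W n).neg * W)

/-- `Φ` is an eigenfunction: `∂Φ/∂tₙ = Bₙ(Φ)`. -/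
def IsEigenfunction (W : PDO K) (Φ : TimeSeries K) : Prop :=
  ∀ n : ℕ+, dt n Φ = (flowOp W n).apply Φ

/-- `Ψ` is an adjoint eigenfunction: `∂Ψ/∂tₙ = -Bₙ*(Ψ)`. -/
def IsAdjointEigenfunction (W : PDO K) (Ψ : TimeSeries K) : Prop :=
  ∀ n : ℕ+, dt n Ψ = -((flowOp W n).adjoint.apply Ψ)

/-- `S` is a squared eigenfunction potential of `Φ, Ψ`:
`∂S/∂tₙ = Res (D⁻¹ Ψ Bₙ Φ D⁻¹)` for all `n`. -/
def IsSEP (W : PDO K) (Φ Ψ S : TimeSeries K) : Prop :=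
  ∀ n : ℕ+, dt n S = (D (-1) * const Ψ * flowOp W n * const Φ * D (-1)).res

/-- `L = D^r + ∑_{l=0}^{r-2} u_l D^l + ∑ₐ Φₐ D⁻¹ Ψₐ` for some functions `u_l`. -/
def HasCKPForm (r : ℕ) {m : ℕ} (L : PDO K) (Φ Ψ : Fin m → TimeSeries K) : Prop :=
  ∃ u : ℕ → TimeSeries K,
    L = D r + ∑ l ∈ Finset.range (r - 1), monomial (u l) l
      + ∑ a, const (Φ a) * D (-1) * const (Ψ a)

/-! ## Wave functions -/

/-- `w(t, λ) = ∑ᵢ wᵢ(t) λ⁻ⁱ`, where `ψ_BA(t, λ) = W(e^ξ) = w(t, λ) e^{ξ(t, λ)}`. -/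
def wave (W : PDO K) : LaurentSeries (TimeSeries K) :=
  HahnSeries.ofPowerSeries ℤ _ (PowerSeries.mk fun i => W.coeff (-(i : ℤ)))

/-- `w*(t, λ)`, where `ψ*_BA(t, λ) = (W*)⁻¹(e^{-ξ}) = w*(t, λ) e^{-ξ(t, λ)}`; here
`(W*)⁻¹ = (W⁻¹)*` and `D⁻ⁱ e^{-ξ} = (-λ)⁻ⁱ e^{-ξ}`. -/
def adjointWave (W : PDO K) : LaurentSeries (TimeSeries K) :=
  HahnSeries.ofPowerSeries ℤ _
    (PowerSeries.mk fun i => (-1) ^ i * W.dressInv.adjoint.coeff (-(i : ℤ)))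

/-- The Miwa shift `f(t + ε [λ⁻¹])`, where `[λ⁻¹] = (λ⁻¹, λ⁻²/2, λ⁻³/3, …)` and `ε = ±1`, expanded
in powers of `λ⁻¹`: the coefficient of `t^β λ⁻ⁿ` collects the terms `c_{α+β} t^{α+β}` of `f` with
`∑ l α_l = n`. -/
def miwaShift (ε : ℤ) (f : TimeSeries K) : LaurentSeries (TimeSeries K) :=
  HahnSeries.ofPowerSeries ℤ _ (PowerSeries.mk fun n => fun β : ℕ+ →₀ ℕ =>
    ∑ᶠ α : ℕ+ →₀ ℕ, if (α.sum fun l a => (l : ℕ) * a) = n then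
      (α.prod fun l a => (((a + β l).choose a : ℕ) : K) * ((ε : K) / ((l : ℕ) : K)) ^ a)
        * MvPowerSeries.coeff (α + β) f
    else 0)

/-- The shift-difference operator `Δ̂_λ f(t) = f(t - [λ⁻¹]) - f(t)`. -/
def shiftDiff (f : TimeSeries K) : LaurentSeries (TimeSeries K) :=
  miwaShift (-1) f - HahnSeries.C f

/-- The value at `t = 0`. -/
def evalZero (g : LaurentSeries (TimeSeries K)) : LaurentSeries K :=
  HahnSeries.map g (constantCoeff (σ := ℕ+) (R := K))

/-- A series in `λ⁻¹` that does not depend on `t`. -/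
def constInTime (φ : LaurentSeries K) : LaurentSeries (TimeSeries K) :=
  HahnSeries.map φ (MvPowerSeries.C (σ := ℕ+) (R := K))

/-! ## Spectral representation of the squared eigenfunction potential -/

/-- The coefficient of `λᵏ` in `e^{ε ξ(t, λ)}`, i.e. the Schur polynomial `pₖ(ε t)`. -/
def expCoeff (ε : ℤ) (k : ℕ) : TimeSeries K := fun α : ℕ+ →₀ ℕ =>
  if (α.sum fun l a => (l : ℕ) * a) = k then α.prod fun _ a => (ε : K) ^ a / (a.factorial : K)
  else 0

/-- `∫ dλ g(t, λ) e^{ε ξ(t, λ)}`, the coefficient of `λ⁻¹`; the sum of the series of coefficients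
of a given monomial in `t` is finite. -/
def spectralIntegral (ε : ℤ) (g : LaurentSeries (TimeSeries K)) : TimeSeries K :=
  fun β => ∑ᶠ k : ℕ, MvPowerSeries.coeff β (g.coeff (1 + k) * expCoeff ε k)

/-- The spectral density `φ(λ) = λ⁻¹ ψ*_BA(0, λ) Φ([λ⁻¹])` of an eigenfunction. -/
def density (W : PDO K) (Φ : TimeSeries K) : LaurentSeries K :=
  HahnSeries.single 1 1 * evalZero (adjointWave W) * evalZero (miwaShift 1 Φ)

/-- The spectral density `φ*(λ) = λ⁻¹ ψ_BA(0, λ) Ψ(-[λ⁻¹])` of an adjoint eigenfunction. -/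
def adjointDensity (W : PDO K) (Ψ : TimeSeries K) : LaurentSeries K :=
  HahnSeries.single 1 1 * evalZero (wave W) * evalZero (miwaShift (-1) Ψ)

/-- `S(t) = - ∫∫ dλ dμ φ*(λ) φ(μ) λ⁻¹ ψ*_BA(t, λ) ψ_BA(t + [λ⁻¹], μ)`, as an iterated integral:
`f(t) = ∫ dμ φ(μ) ψ_BA(t, μ)` first, then
`S(t) = - ∫ dλ φ*(λ) λ⁻¹ ψ*_BA(t, λ) f(t + [λ⁻¹])`. -/
def spectralSEP (W : PDO K) (Φ Ψ : TimeSeries K) : TimeSeries K :=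
  -spectralIntegral (-1)
    (constInTime (adjointDensity W Ψ) * HahnSeries.single 1 1 * adjointWave W
      * miwaShift 1 (spectralIntegral 1 (constInTime (density W Φ) * wave W)))

/-! ## Points of the Sato Grassmannian -/

/-- `∂ₓ` acting on `g(t, λ) e^{ξ(t, λ)}`: the coefficient `g` becomes `∂ₓ g + λ g`. -/
def waveDx (g : LaurentSeries (TimeSeries K)) : LaurentSeries (TimeSeries K) :=
  HahnSeries.map g (dx (K := K)) + HahnSeries.single (-1) 1 * g

/-- The span of the Laurent series `∂ₓᵏ F(t, λ)` at `t = 0`, `k = 0, 1, 2, …`, for the generating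
function `F(t, λ) = g(t, λ) e^{ξ(t, λ)}`. -/
def grassmannPoint (g : LaurentSeries (TimeSeries K)) : Submodule K (LaurentSeries K) :=
  Submodule.span K (Set.range fun k : ℕ => evalZero (waveDx^[k] g))

/-- The constraint `[λ^r + ∑ₐ Δ̂_λ Sₐ(t)] 𝒲 ⊂ 𝒲`. The multiplier depends on `t`, and acts on the
generating function `ψ_BA(t, λ)` of `𝒲`: the generating function
`F'(t, λ) = [λ^r + ∑ₐ Δ̂_λ Sₐ(t)] ψ_BA(t, λ)` has to define a subspace of `𝒲`. -/
def GrassmannConstraint (r : ℕ) {m : ℕ} (W : PDO K) (S : Fin m → TimeSeries K) : Prop :=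
  grassmannPoint ((HahnSeries.single (-(r : ℤ)) 1 + ∑ a, shiftDiff (S a)) * wave W)
    ≤ grassmannPoint (wave W)

end Hierarchy

end KP

end

noncomputable section

namespace KP

open MvPowerSeries (pderiv constantCoeff)

namespace PDO

variable {K : Type*} [Field K]

/-! ## Coefficients and order of pseudo-differential operators -/

/-! An operator `P` acts on the wave function ψ; the result `Pψ` is encoded by the left symbol of `P
* W` and determines `P`. The theorem rests on one identity, `multiplier_mul_wave`: (λ^r + ∑ₐ Δ̂_λ
Sₐ) ψ = Xψ with X = L - ∑ₐ Φₐ D⁻¹ Ψₐ. It combines Lψ = λ^r ψ with two Miwa-shift formulas: D⁻¹Ψ acts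
on ψ as multiplication by λ⁻¹ Ψ(t - [λ⁻¹]) (`IsAdjointEigenfunction.lsym_eq`), and S(t - [λ⁻¹]) -
S(t) = -λ⁻¹ Φ(t) Ψ(t - [λ⁻¹]) (`IsSEP.miwaCoeff_succ`).

Since L = D^r + O(D^{r-2}), the cKP form means exactly that X is a differential operator
(`hasCKPForm_iff`). The point 𝒲 consists of the values at t = 0 of Bψ with B differential, so the
constraint says that for every k the operator D^k X agrees at t = 0 with a differential operator.
Then all x-jets at 0 of the negative coefficients of X vanish (`jet_eq_zero_of_D_mul`). By the
equations for Φₐ and Ψₐ, ∂X/∂tₙ = [Bₙ, X] up to a differential operator, so X₋ obeys a linear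
homogeneous evolution and is zero as soon as it is zero on t₂ = t₃ = ⋯ = 0
(`isDiff_of_mem_timeIdeal`).

The Miwa formulas need no tau function. The series G(z) = W(t - [z]) (1 - zD) W⁻¹ has G(0) = 1 and z
∂G/∂z = -∑ zⁿ (∂G/∂tₙ + G Bₙ), so its coefficients are differential operators, and counting orders
leaves G = c(z) - zD (`minusSeries_eq`). At z = λ⁻¹ it kills ψ, because 1 - zD kills e^ξ. The same
argument for D⁻¹ Ψ(t - [z]) G(z) gives a first-order equation for Ψ(t - [z]), and the two together
give the first formula. The second compares two solutions of the same recursion in z. For t + [z]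
and adjoint wave functions the mirror image W (1 - zD) W⁻¹(t + [z]) is used.

For the spectral formula, the density of Φ is the right symbol of W⁻¹ Φ D⁻¹ at t = 0. Integrating it
against ψ gives an eigenfunction whose x-jet at 0 is that of Φ, by the residue pairing
`coeff_one_rsym_mul_lsym`, hence Φ itself. The integral S is then a functional of ψ* acted on by Φ
D⁻¹, and its time derivatives apply this functional to a differential operator, where it is a
residue (`isSEP_spectralSEP`).

In part (2) the functions in the cKP form need not be eigenfunctions. They are replaced by (adjoint)
eigenfunctions with the same x-jets at 0; this leaves X unchanged on t₂ = t₃ = ⋯ = 0, and uniqueness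
of the evolution applies again. -/

@[ext] theorem ext {P Q : PDO K} (h : ∀ n, P.coeff n = Q.coeff n) : P = Q :=
  Subtype.ext (funext h)

/-- The coefficient of `Dⁿ` as an additive map. -/
def coeffHom (n : ℤ) : PDO K →+ TimeSeries K where
  toFun P := P.coeff n
  map_zero' := rfl
  map_add' _ _ := rfl

@[simp] theorem zero_coeff (n : ℤ) : (0 : PDO K).coeff n = 0 := rfl

@[simp] theorem add_coeff (P Q : PDO K) (n : ℤ) : (P + Q).coeff n = P.coeff n + Q.coeff n := rfl

@[simp] theorem neg_coeff (P : PDO K) (n : ℤ) : (-P).coeff n = -P.coeff n := rfl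

@[simp] theorem sub_coeff (P Q : PDO K) (n : ℤ) : (P - Q).coeff n = P.coeff n - Q.coeff n :=
  map_sub (coeffHom n) P Q

@[simp] theorem nsmul_coeff (k : ℕ) (P : PDO K) (n : ℤ) : (k • P).coeff n = k • P.coeff n :=
  map_nsmul (coeffHom n) k P

@[simp] theorem sum_coeff {ι : Type*} (s : Finset ι) (f : ι → PDO K) (n : ℤ) :
    (∑ i ∈ s, f i).coeff n = ∑ i ∈ s, (f i).coeff n :=
  map_sum (coeffHom n) f s

theorem monomial_coeff (f : TimeSeries K) (i n : ℤ) :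
    (monomial f i).coeff n = if n = i then f else 0 := rfl

theorem const_coeff (f : TimeSeries K) (n : ℤ) :
    (const f).coeff n = if n = 0 then f else 0 := rfl

theorem D_coeff (i n : ℤ) : (D i : PDO K).coeff n = if n = i then 1 else 0 := rfl

theorem one_coeff (n : ℤ) : (1 : PDO K).coeff n = if n = 0 then 1 else 0 := rfl

theorem pos_coeff (P : PDO K) (n : ℤ) : P.pos.coeff n = if 0 ≤ n then P.coeff n else 0 := rfl

theorem neg_part_coeff (P : PDO K) (n : ℤ) : P.neg.coeff n = if 0 ≤ n then 0 else P.coeff n := by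
  rw [neg, sub_coeff, pos_coeff]
  split_ifs <;> simp

theorem flow_coeff (n : ℕ+) (P : PDO K) (k : ℤ) : (P.flow n).coeff k = dt n (P.coeff k) := rfl

theorem D_zero : (D 0 : PDO K) = 1 := rfl

theorem const_one : (const 1 : PDO K) = 1 := rfl

/-- The order of `P` is at most `N`. -/
def OrdLE (P : PDO K) (N : ℤ) : Prop := ∀ n, N < n → P.coeff n = 0

theorem exists_ordLE (P : PDO K) : ∃ N, OrdLE P N := P.2

theorem OrdLE.mono {P : PDO K} {M N : ℤ} (h : OrdLE P M) (hMN : M ≤ N) : OrdLE P N :=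
  fun n hn => h n (hMN.trans_lt hn)

theorem ordLE_monomial (f : TimeSeries K) (i : ℤ) : OrdLE (monomial f i) i :=
  fun _ hn => if_neg hn.ne'

theorem ordLE_const (f : TimeSeries K) : OrdLE (const f) 0 := ordLE_monomial f 0

theorem ordLE_one : OrdLE (1 : PDO K) 0 := ordLE_monomial 1 0

theorem ordLE_D (i : ℤ) : OrdLE (D i : PDO K) i := ordLE_monomial 1 i

theorem OrdLE.add {P Q : PDO K} {N : ℤ} (hP : OrdLE P N) (hQ : OrdLE Q N) : OrdLE (P + Q) N :=
  fun n hn => by rw [add_coeff, hP n hn, hQ n hn, add_zero]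

theorem OrdLE.neg {P : PDO K} {N : ℤ} (hP : OrdLE P N) : OrdLE (-P) N :=
  fun n hn => by rw [neg_coeff, hP n hn, neg_zero]

theorem OrdLE.sub {P Q : PDO K} {N : ℤ} (hP : OrdLE P N) (hQ : OrdLE Q N) : OrdLE (P - Q) N :=
  fun n hn => by rw [sub_coeff, hP n hn, hQ n hn, sub_zero]

theorem OrdLE.flow {P : PDO K} {N : ℤ} (hP : OrdLE P N) (n : ℕ+) : OrdLE (P.flow n) N :=
  fun k hk => by rw [flow_coeff, hP k hk, map_zero]

theorem ordLE_zero (N : ℤ) : OrdLE (0 : PDO K) N := fun _ _ => rfl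

theorem ordLE_sum {ι : Type*} {s : Finset ι} {f : ι → PDO K} {N : ℤ}
    (h : ∀ i ∈ s, OrdLE (f i) N) : OrdLE (∑ i ∈ s, f i) N := fun n hn => by
  rw [sum_coeff]
  exact Finset.sum_eq_zero fun i hi => h i hi n hn

theorem eq_zero_of_forall_ordLE {P : PDO K} (h : ∀ N, OrdLE P (-(N : ℕ))) : P = 0 := by
  ext n : 1
  exact h (n.natAbs + 1) n (by omega)

/-! ## The product -/

theorem iterate_dx_zero (k : ℕ) : dx^[k] (0 : TimeSeries K) = 0 := iterate_map_zero dx k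

theorem iterate_dx_one {k : ℕ} (hk : k ≠ 0) : dx^[k] (1 : TimeSeries K) = 0 := by
  obtain ⟨j, rfl⟩ := Nat.exists_eq_succ_of_ne_zero hk
  rw [Function.iterate_succ_apply, Derivation.map_one_eq_zero, iterate_dx_zero]

theorem choose_zero_of_ne {k : ℕ} (hk : k ≠ 0) : Ring.choose (0 : ℤ) k = 0 :=
  Ring.choose_zero_pos ℤ hk.bot_lt

theorem mul_coeff (P Q : PDO K) (n : ℤ) :
    (P * Q).coeff n = ∑ᶠ p : ℤ × ℕ,
      (Ring.choose p.1 p.2 : ℤ) • (P.coeff p.1 * dx^[p.2] (Q.coeff (n - p.1 + p.2))) := rfl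

theorem mul_coeff_eq_sum {P Q : PDO K} {M N n a b : ℤ} {κ : ℕ} (hP : OrdLE P M) (hQ : OrdLE Q N)
    (ha : a + N ≤ n) (hb : M ≤ b) (hκ : M + N - n < κ) :
    (P * Q).coeff n = ∑ i ∈ Finset.Icc a b, P.coeff i *
      ∑ k ∈ Finset.range κ, (Ring.choose i k : ℤ) • dx^[k] (Q.coeff (n - i + k)) := by
  rw [mul_coeff, finsum_eq_sum_of_support_subset (s := Finset.Icc a b ×ˢ Finset.range κ),
    Finset.sum_product]
  · refine Finset.sum_congr rfl fun i _ => ?_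
    rw [Finset.mul_sum]
    exact Finset.sum_congr rfl fun k _ => (mul_smul_comm _ _ _).symm
  · rintro ⟨i, k⟩ hik
    simp only [Function.mem_support] at hik
    have h1 : i ≤ M := by
      by_contra h
      exact hik (by rw [hP i (by omega), zero_mul, smul_zero])
    have h2 : n - i + k ≤ N := by
      by_contra h
      exact hik (by rw [hQ _ (by omega), iterate_dx_zero, mul_zero, smul_zero])
    simp only [Finset.coe_product, Finset.coe_Icc, Finset.coe_range, Set.mem_prod, Set.mem_Icc,
      Set.mem_Iio]
    omega

theorem mul_add' (P Q R : PDO K) : P * (Q + R) = P * Q + P * R := by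
  obtain ⟨M, hM⟩ := P.exists_ordLE
  obtain ⟨N₁, h₁⟩ := Q.exists_ordLE
  obtain ⟨N₂, h₂⟩ := R.exists_ordLE
  have hQ := h₁.mono (le_max_left N₁ N₂)
  have hR := h₂.mono (le_max_right N₁ N₂)
  set N := max N₁ N₂
  ext n : 1
  have hκ : M + N - n < (M + N - n + 1).toNat := by omega
  rw [add_coeff, mul_coeff_eq_sum (a := n - N) hM (hQ.add hR) (by omega) le_rfl hκ,
    mul_coeff_eq_sum (a := n - N) hM hQ (by omega) le_rfl hκ,
    mul_coeff_eq_sum (a := n - N) hM hR (by omega) le_rfl hκ, ← Finset.sum_add_distrib]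
  refine Finset.sum_congr rfl fun i _ => ?_
  rw [← mul_add, ← Finset.sum_add_distrib]
  congr 1
  refine Finset.sum_congr rfl fun k _ => ?_
  rw [add_coeff, iterate_map_add, smul_add]

theorem add_mul' (P Q R : PDO K) : (P + Q) * R = P * R + Q * R := by
  obtain ⟨M, hM⟩ := R.exists_ordLE
  obtain ⟨N₁, h₁⟩ := P.exists_ordLE
  obtain ⟨N₂, h₂⟩ := Q.exists_ordLE
  have hP := h₁.mono (le_max_left N₁ N₂)
  have hQ := h₂.mono (le_max_right N₁ N₂)
  set N := max N₁ N₂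
  ext n : 1
  have hκ : N + M - n < (N + M - n + 1).toNat := by omega
  rw [add_coeff, mul_coeff_eq_sum (a := n - M) (hP.add hQ) hM (by omega) le_rfl hκ,
    mul_coeff_eq_sum (a := n - M) hP hM (by omega) le_rfl hκ,
    mul_coeff_eq_sum (a := n - M) hQ hM (by omega) le_rfl hκ, ← Finset.sum_add_distrib]
  refine Finset.sum_congr rfl fun i _ => ?_
  rw [← add_mul, add_coeff]

theorem zero_mul' (P : PDO K) : 0 * P = 0 := by
  have h := add_mul' 0 0 P
  rw [add_zero] at h
  exact left_eq_add.mp h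

theorem mul_zero' (P : PDO K) : P * 0 = 0 := by
  have h := mul_add' P 0 0
  rw [add_zero] at h
  exact left_eq_add.mp h

theorem OrdLE.mul {P Q : PDO K} {M N : ℤ} (hP : OrdLE P M) (hQ : OrdLE Q N) :
    OrdLE (P * Q) (M + N) := fun n hn => by
  rw [mul_coeff_eq_sum (κ := 0) hP hQ (le_of_eq (sub_add_cancel n N)) le_rfl
    (by push_cast; omega)]
  simp

theorem monomial_mul_coeff (f : TimeSeries K) (j : ℤ) {Q : PDO K} {N n : ℤ} {κ : ℕ}
    (hQ : OrdLE Q N) (hκ : j + N - n < κ) :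
    (monomial f j * Q).coeff n =
      f * ∑ k ∈ Finset.range κ, (Ring.choose j k : ℤ) • dx^[k] (Q.coeff (n - j + k)) := by
  -- The lower end is taken at most `j`, so that the single index that survives lies in the
  -- interval.
  rw [mul_coeff_eq_sum (a := min j (n - N)) (b := j) (ordLE_monomial f j) hQ
    (by have := min_le_right j (n - N); omega) le_rfl hκ, Finset.sum_eq_single j]
  · rw [monomial_coeff, if_pos rfl]
  · intro i _ hi
    rw [monomial_coeff, if_neg hi, zero_mul]
  · intro h
    exact absurd (Finset.mem_Icc.mpr ⟨min_le_left _ _, le_rfl⟩) h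

theorem mul_coeff_eq_sum_D {P Q : PDO K} {M N n a b : ℤ} (hP : OrdLE P M) (hQ : OrdLE Q N)
    (ha : a + N ≤ n) (hb : M ≤ b) :
    (P * Q).coeff n = ∑ i ∈ Finset.Icc a b, P.coeff i * (D i * Q).coeff n := by
  have hκ : b + N - n < (b + N - n + 1).toNat := by omega
  rw [mul_coeff_eq_sum hP hQ ha hb ((by omega : M + N - n ≤ b + N - n).trans_lt hκ)]
  refine Finset.sum_congr rfl fun i hi => ?_
  rw [D, monomial_mul_coeff 1 i hQ (κ := (b + N - n + 1).toNat), one_mul]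
  have := (Finset.mem_Icc.mp hi).2
  omega

theorem const_mul_coeff (f : TimeSeries K) (Q : PDO K) (n : ℤ) :
    (const f * Q).coeff n = f * Q.coeff n := by
  obtain ⟨N, hN⟩ := Q.exists_ordLE
  rw [const, monomial_mul_coeff f 0 hN (κ := (N - n).toNat + 1) (by push_cast; omega),
    Finset.sum_range_succ', Finset.sum_eq_zero]
  · simp
  · intro k _
    rw [choose_zero_of_ne k.succ_ne_zero, zero_smul]

theorem D_one_mul_coeff (Q : PDO K) (n : ℤ) :
    (D 1 * Q).coeff n = dx (Q.coeff n) + Q.coeff (n - 1) := by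
  obtain ⟨N, hN⟩ := Q.exists_ordLE
  rw [D, monomial_mul_coeff 1 1 hN (κ := (N - n).toNat + 1 + 1) (by push_cast; omega),
    Finset.sum_range_succ', Finset.sum_range_succ', Finset.sum_eq_zero]
  · simp [add_comm]
  · intro k _
    have : Ring.choose (1 : ℤ) (k + 1 + 1) = 0 := by
      have := Ring.choose_natCast (R := ℤ) 1 (k + 1 + 1)
      rw [Nat.cast_one] at this
      rw [this, Nat.choose_eq_zero_of_lt (by omega), Nat.cast_zero]
    rw [this, zero_smul]

theorem mul_D_coeff (P : PDO K) (j n : ℤ) : (P * D j).coeff n = P.coeff (n - j) := by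
  obtain ⟨M, hM⟩ := P.exists_ordLE
  have hM' := hM.mono (le_max_left M (n - j))
  rw [mul_coeff_eq_sum (κ := (max M (n - j) + j - n).toNat + 1) (a := n - j) hM' (ordLE_D j)
    (by omega) le_rfl (by push_cast; omega), Finset.sum_eq_single (n - j)]
  · rw [Finset.sum_range_succ', Finset.sum_eq_zero]
    · simp [D_coeff]
    · intro k _
      rw [D_coeff, if_neg (by push_cast; omega), iterate_dx_zero, smul_zero]
  · intro i _ hi
    rw [Finset.sum_eq_zero, mul_zero]
    intro k _
    rw [D_coeff]
    split_ifs with h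
    · rw [iterate_dx_one (by omega), smul_zero]
    · rw [iterate_dx_zero, smul_zero]
  · intro h
    exact absurd (Finset.mem_Icc.mpr ⟨le_rfl, le_max_right _ _⟩) h

theorem one_mul' (P : PDO K) : 1 * P = P := by
  ext n : 1
  rw [← const_one, const_mul_coeff, one_mul]

theorem mul_one' (P : PDO K) : P * 1 = P := by
  ext n : 1
  rw [← D_zero, mul_D_coeff, sub_zero]

theorem D_mul_D (i j : ℤ) : (D i : PDO K) * D j = D (i + j) := by
  ext n : 1
  rw [mul_D_coeff, D_coeff, D_coeff]
  congr 1
  exact propext (by omega)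

theorem const_mul_D (f : TimeSeries K) (i : ℤ) : const f * D i = monomial f i := by
  ext n : 1
  rw [const_mul_coeff, D_coeff, monomial_coeff]
  split_ifs <;> simp

/-! ### Associativity of the product -/

/-- Operators that associate with all pairs of operators. -/
def AssocLeft (P : PDO K) : Prop := ∀ Q R : PDO K, P * Q * R = P * (Q * R)

theorem AssocLeft.mul {P P' : PDO K} (h : AssocLeft P) (h' : AssocLeft P') :
    AssocLeft (P * P') := fun Q R => by
  rw [h, h, h, h']

theorem AssocLeft.add {P P' : PDO K} (h : AssocLeft P) (h' : AssocLeft P') :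
    AssocLeft (P + P') := fun Q R => by
  rw [add_mul', add_mul', add_mul', h, h']

theorem assocLeft_const (f : TimeSeries K) : AssocLeft (const f) := fun Q R => by
  obtain ⟨M, hM⟩ := Q.exists_ordLE
  obtain ⟨N, hN⟩ := R.exists_ordLE
  have hM' : OrdLE (const f * Q) M := by simpa using (ordLE_const f).mul hM
  ext n : 1
  have hκ : M + N - n < (M + N - n + 1).toNat := by omega
  rw [const_mul_coeff, mul_coeff_eq_sum (a := n - N) hM' hN (by omega) le_rfl hκ,
    mul_coeff_eq_sum (a := n - N) hM hN (by omega) le_rfl hκ, Finset.mul_sum]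
  refine Finset.sum_congr rfl fun i _ => ?_
  rw [const_mul_coeff, mul_assoc]

/-- Pascal's rule for the binomials of an integer upper index. This avoids any direct binomial
convolution in the proof of associativity. -/
theorem D_succ_mul_coeff (i : ℤ) (R : PDO K) (n : ℤ) :
    (D (i + 1) * R).coeff n = dx ((D i * R).coeff n) + (D i * R).coeff (n - 1) := by
  obtain ⟨N, hN⟩ := R.exists_ordLE
  set κ := (i + 1 + N - n + 1).toNat
  have hD : ∀ j : ℤ, (D j : PDO K) = monomial 1 j := fun _ => rfl
  have e1 : ∀ k : ℕ, n - (i + 1) + ((k + 1 : ℕ) : ℤ) = n - i + k := fun k => by push_cast; ring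
  have e2 : ∀ k : ℕ, n - 1 - i + ((k + 1 : ℕ) : ℤ) = n - i + k := fun k => by push_cast; ring
  rw [hD, hD, monomial_mul_coeff 1 _ hN (κ := κ + 1) (by push_cast; omega),
    monomial_mul_coeff 1 _ hN (κ := κ) (by omega),
    monomial_mul_coeff 1 _ hN (κ := κ + 1) (by push_cast; omega), one_mul, one_mul, one_mul,
    Finset.sum_range_succ', Finset.sum_range_succ', map_sum, ← add_assoc,
    ← Finset.sum_add_distrib]
  congr 1
  · refine Finset.sum_congr rfl fun k _ => ?_
    rw [e1, e2, Ring.choose_succ_succ, add_smul, map_zsmul, ← Function.iterate_succ_apply' dx]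
  · simp only [Ring.choose_zero_right, Function.iterate_zero, id_eq, Nat.cast_zero, one_smul]
    congr 1
    ring

theorem assocLeft_D_one : AssocLeft (D 1 : PDO K) := fun Q R => by
  obtain ⟨M, hM⟩ := Q.exists_ordLE
  obtain ⟨N, hN⟩ := R.exists_ordLE
  have hM' : OrdLE (D 1 * Q) (1 + M) := (ordLE_D 1).mul hM
  ext n : 1
  -- The lower end `n - N - 1` serves the coefficient of Dⁿ⁻¹ as well as that of Dⁿ; the upper end
  -- `M + 1` is the order bound of D Q.
  rw [D_one_mul_coeff,
    mul_coeff_eq_sum_D (a := n - N - 1) (b := M + 1) hM' hN (by omega) (by omega),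
    mul_coeff_eq_sum_D (a := n - N - 1) (b := M + 1) hM hN (by omega) (by omega),
    mul_coeff_eq_sum_D (a := n - N - 1) (b := M) hM hN (by omega) (by omega)]
  simp only [D_one_mul_coeff, add_mul, map_sum, Derivation.leibniz, smul_eq_mul]
  have key : ∑ i ∈ Finset.Icc (n - N - 1) (M + 1), Q.coeff (i - 1) * (D i * R).coeff n =
      ∑ i ∈ Finset.Icc (n - N - 1) M, Q.coeff i * (D (i + 1) * R).coeff n := by
    symm
    refine Finset.sum_bij_ne_zero (fun i _ _ => i + 1) ?_ ?_ ?_ ?_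
    · intro i hi _
      rw [Finset.mem_Icc] at hi ⊢
      omega
    · intro i _ _ j _ _ h
      omega
    · intro i hi h
      refine ⟨i - 1, ?_, ?_, by ring⟩
      · rw [Finset.mem_Icc] at hi ⊢
        refine ⟨?_, by omega⟩
        by_contra hlt
        refine h ?_
        rw [(ordLE_D i).mul hN n (by omega), mul_zero]
      · rwa [sub_add_cancel]
    · intro i _ _
      rw [add_sub_cancel_right]
  have ext1 : ∀ F : ℤ → TimeSeries K, (∑ i ∈ Finset.Icc (n - N - 1) (M + 1), Q.coeff i * F i) =
      ∑ i ∈ Finset.Icc (n - N - 1) M, Q.coeff i * F i := fun F => by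
    symm
    refine Finset.sum_subset (Finset.Icc_subset_Icc_right (by omega)) fun i hi hi' => ?_
    rw [hM i, zero_mul]
    simp only [Finset.mem_Icc] at hi hi'
    omega
  rw [Finset.sum_add_distrib, key, Finset.sum_add_distrib]
  simp only [D_succ_mul_coeff, mul_add, Finset.sum_add_distrib]
  rw [ext1]
  have : ∑ i ∈ Finset.Icc (n - N - 1) (M + 1), dx (Q.coeff i) * (D i * R).coeff n =
      ∑ i ∈ Finset.Icc (n - N - 1) (M + 1), (D i * R).coeff n * dx (Q.coeff i) :=
    Finset.sum_congr rfl fun i _ => mul_comm _ _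
  rw [this]
  ring

/-- The top coefficient of P is also the top coefficient of D P, so the order bound can be lowered
indefinitely. -/
theorem eq_zero_of_D_one_mul {P : PDO K} (h : D 1 * P = 0) : P = 0 := by
  obtain ⟨N, hN⟩ := P.exists_ordLE
  have hd : ∀ n, dx (P.coeff n) + P.coeff (n - 1) = 0 := fun n => by
    rw [← D_one_mul_coeff, h, zero_coeff]
  have key : ∀ k : ℕ, OrdLE P (N - k) := by
    intro k
    induction k with
    | zero => simpa using hN
    | succ k ih =>
      intro n hn
      have h1 := hd (n + 1)
      rw [ih (n + 1) (by push_cast at hn; omega), map_zero, zero_add, add_sub_cancel_right] at h1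
      exact h1
  ext n : 1
  exact key (N - n + 1).toNat n (by omega)

theorem D_one_mul_cancel {P Q : PDO K} (h : D 1 * P = D 1 * Q) : P = Q := by
  have h1 : D 1 * (P - Q) = 0 := by
    have h2 := mul_add' (D 1) (P - Q) Q
    rw [sub_add_cancel, h] at h2
    exact right_eq_add.mp h2
  exact sub_eq_zero.mp (eq_zero_of_D_one_mul h1)

/-- Associativity for D⁻¹ follows from that for D: left multiplication by D is injective and undoes
D⁻¹. -/
theorem assocLeft_D_neg_one : AssocLeft (D (-1) : PDO K) := fun Q R => by
  have hc : ∀ X : PDO K, D 1 * (D (-1) * X) = X := fun X => by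
    rw [← assocLeft_D_one, D_mul_D, add_neg_cancel, D_zero, one_mul']
  apply D_one_mul_cancel
  rw [hc, ← assocLeft_D_one, hc]

theorem assocLeft_D (i : ℤ) : AssocLeft (D i : PDO K) := by
  induction i with
  | zero => exact fun Q R => by rw [D_zero, one_mul', one_mul']
  | succ i ih =>
    rw [add_comm, ← D_mul_D]
    exact assocLeft_D_one.mul ih
  | pred i ih =>
    rw [sub_eq_add_neg, add_comm, ← D_mul_D]
    exact assocLeft_D_neg_one.mul ih

theorem exists_assocLeft_sub_ordLE (P : PDO K) (N : ℤ) :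
    ∃ P' : PDO K, AssocLeft P' ∧ OrdLE (P - P') N := by
  obtain ⟨M, hM⟩ := P.exists_ordLE
  refine ⟨∑ i ∈ Finset.Icc (N + 1) M, monomial (P.coeff i) i, ?_, ?_⟩
  · refine Finset.sum_induction _ AssocLeft (fun _ _ => AssocLeft.add) ?_ ?_
    · exact fun Q R => by rw [zero_mul', zero_mul', zero_mul']
    · intro i _
      rw [← const_mul_D]
      exact (assocLeft_const _).mul (assocLeft_D i)
  · intro n hn
    rw [sub_coeff, sum_coeff]
    simp only [monomial_coeff, Finset.sum_ite_eq, Finset.mem_Icc]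
    split_ifs with h
    · exact sub_self _
    · rw [hM n (by omega), sub_zero]

/-- Finite sums of f Dⁱ associate on the left, being built from functions and D^{±1}. A given
coefficient of the triple product does not see the part of P of sufficiently low order, so P may be
replaced by such a sum. -/
theorem mul_assoc' (P Q R : PDO K) : P * Q * R = P * (Q * R) := by
  obtain ⟨M, hM⟩ := Q.exists_ordLE
  obtain ⟨N, hN⟩ := R.exists_ordLE
  ext n : 1
  obtain ⟨P', h', hP'⟩ := P.exists_assocLeft_sub_ordLE (n - 1 - M - N)
  have e : P = P' + (P - P') := (add_sub_cancel P' P).symm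
  rw [e, add_mul', add_mul', add_mul', h', add_coeff, add_coeff]
  congr 1
  rw [((hP'.mul hM).mul hN) n (by omega), (hP'.mul (hM.mul hN)) n (by omega)]

instance : Ring (PDO K) where
  __ := (inferInstance : AddCommGroup (PDO K))
  left_distrib := mul_add'
  right_distrib := add_mul'
  zero_mul := zero_mul'
  mul_zero := mul_zero'
  mul_assoc := mul_assoc'
  one_mul := one_mul'
  mul_one := mul_one'

/-! ## Multiplication operators, flows -/

theorem const_mul (f g : TimeSeries K) : const (f * g) = const f * const g := by
  ext n : 1
  rw [const_mul_coeff, const_coeff, const_coeff]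
  split_ifs <;> simp

/-- Multiplication operators as a ring homomorphism. -/
def constHom : TimeSeries K →+* PDO K where
  toFun := const
  map_one' := rfl
  map_mul' := const_mul
  map_zero' := ext fun n => by rw [const_coeff]; split_ifs <;> rfl
  map_add' f g := ext fun n => by
    rw [add_coeff, const_coeff, const_coeff, const_coeff]
    split_ifs <;> simp

theorem const_neg (f : TimeSeries K) : const (-f) = -const f := map_neg constHom f

theorem const_sub (f g : TimeSeries K) : const (f - g) = const f - const g := map_sub constHom f g

theorem D_one_mul_const (f : TimeSeries K) : D 1 * const f = const f * D 1 + const (dx f) := by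
  ext n : 1
  rw [D_one_mul_coeff, add_coeff, mul_D_coeff, const_coeff, const_coeff, const_coeff]
  rw [add_comm]
  split_ifs <;> simp

theorem D_mul_D_neg (n : ℤ) : (D n : PDO K) * D (-n) = 1 := by
  rw [D_mul_D, add_neg_cancel, D_zero]

theorem D_neg_mul_D (n : ℤ) : (D (-n) : PDO K) * D n = 1 := by
  rw [D_mul_D, neg_add_cancel, D_zero]

theorem coeff_dt (n : ℕ+) (f : TimeSeries K) (β : ℕ+ →₀ ℕ) :
    MvPowerSeries.coeff β (dt n f) =
      MvPowerSeries.coeff (β + Finsupp.single n 1) f * ((β n : K) + 1) :=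
  MvPowerSeries.coeff_pderiv f β

theorem dt_dx_comm (n : ℕ+) (f : TimeSeries K) : dt n (dx f) = dx (dt n f) := by
  refine MvPowerSeries.ext fun β => ?_
  rw [coeff_dt, coeff_dt, coeff_dt, coeff_dt]
  by_cases h : n = 1
  · subst h; rfl
  · rw [Finsupp.add_apply, Finsupp.add_apply, Finsupp.single_eq_of_ne (Ne.symm h),
      Finsupp.single_eq_of_ne h, add_right_comm]
    push_cast
    ring

theorem dt_iterate_dx (n : ℕ+) (k : ℕ) (f : TimeSeries K) :
    dt n (dx^[k] f) = dx^[k] (dt n f) :=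
  (Function.Commute.iterate_right (f := ⇑(dt (K := K) n)) (g := ⇑(dx (K := K)))
    (dt_dx_comm n) k) f

theorem flow_mul (n : ℕ+) (P Q : PDO K) : (P * Q).flow n = P.flow n * Q + P * Q.flow n := by
  obtain ⟨M, hM⟩ := P.exists_ordLE
  obtain ⟨N, hN⟩ := Q.exists_ordLE
  ext m : 1
  have hκ : M + N - m < (M + N - m + 1).toNat := by omega
  rw [flow_coeff, add_coeff, mul_coeff_eq_sum (a := m - N) hM hN (by omega) le_rfl hκ,
    mul_coeff_eq_sum (a := m - N) (hM.flow n) hN (by omega) le_rfl hκ,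
    mul_coeff_eq_sum (a := m - N) hM (hN.flow n) (by omega) le_rfl hκ, map_sum,
    ← Finset.sum_add_distrib]
  refine Finset.sum_congr rfl fun i _ => ?_
  rw [Derivation.leibniz, smul_eq_mul, smul_eq_mul, map_sum, flow_coeff, add_comm,
    mul_comm _ (dt n _)]
  congr 2
  refine Finset.sum_congr rfl fun k _ => ?_
  rw [map_zsmul, dt_iterate_dx, flow_coeff]

/-- `∂/∂tₙ` on operators, as an additive map. -/
def flowHom (n : ℕ+) : PDO K →+ PDO K where
  toFun := flow n
  map_zero' := ext fun _ => map_zero (dt n)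
  map_add' P Q := ext fun k => map_add (dt n) (P.coeff k) (Q.coeff k)

theorem flow_sub (n : ℕ+) (P Q : PDO K) : (P - Q).flow n = P.flow n - Q.flow n :=
  map_sub (flowHom n) P Q

theorem flow_sum {ι : Type*} (n : ℕ+) (s : Finset ι) (f : ι → PDO K) :
    (∑ i ∈ s, f i).flow n = ∑ i ∈ s, (f i).flow n :=
  map_sum (flowHom n) f s

theorem flow_const (n : ℕ+) (f : TimeSeries K) : (const f).flow n = const (dt n f) := by
  ext k : 1
  rw [flow_coeff, const_coeff, const_coeff]
  split_ifs <;> simp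

theorem flow_D (n : ℕ+) (i : ℤ) : (D i : PDO K).flow n = 0 := by
  ext k : 1
  rw [flow_coeff, D_coeff]
  split_ifs <;> simp

theorem flow_one (n : ℕ+) : (1 : PDO K).flow n = 0 := flow_D n 0

/-! ## Differential operators -/

/-- `P` is a purely differential operator. -/
def IsDiff (P : PDO K) : Prop := ∀ n < 0, P.coeff n = 0

theorem pos_add_neg (P : PDO K) : P.pos + P.neg = P := by rw [neg, add_sub_cancel]

theorem isDiff_pos (P : PDO K) : IsDiff P.pos := fun n hn => by
  rw [pos_coeff, if_neg (by omega)]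

theorem isDiff_zero : IsDiff (0 : PDO K) := fun _ _ => rfl

theorem isDiff_const (f : TimeSeries K) : IsDiff (const f) := fun _ hn => if_neg hn.ne

theorem isDiff_one : IsDiff (1 : PDO K) := isDiff_const 1

theorem isDiff_D (n : ℕ) : IsDiff (D n : PDO K) := fun k hk => if_neg (by omega)

theorem IsDiff.add {P Q : PDO K} (hP : IsDiff P) (hQ : IsDiff Q) : IsDiff (P + Q) :=
  fun n hn => by rw [add_coeff, hP n hn, hQ n hn, add_zero]

theorem IsDiff.sub {P Q : PDO K} (hP : IsDiff P) (hQ : IsDiff Q) : IsDiff (P - Q) :=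
  fun n hn => by rw [sub_coeff, hP n hn, hQ n hn, sub_zero]

theorem IsDiff.neg {P : PDO K} (hP : IsDiff P) : IsDiff (-P) :=
  fun n hn => by rw [neg_coeff, hP n hn, neg_zero]

theorem isDiff_sum {ι : Type*} {s : Finset ι} {f : ι → PDO K}
    (h : ∀ i ∈ s, IsDiff (f i)) : IsDiff (∑ i ∈ s, f i) := fun n hn => by
  rw [sum_coeff]
  exact Finset.sum_eq_zero fun i hi => h i hi n hn

theorem IsDiff.flow {P : PDO K} (hP : IsDiff P) (n : ℕ+) : IsDiff (P.flow n) :=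
  fun k hk => by rw [flow_coeff, hP k hk, map_zero]

theorem choose_eq_zero_of_lt {i : ℤ} {k : ℕ} (hi : 0 ≤ i) (hk : i < k) :
    Ring.choose i k = 0 := by
  lift i to ℕ using hi
  rw [← Int.cast_natCast, Int.cast_natCast, Ring.choose_natCast, Nat.choose_eq_zero_of_lt
    (by omega), Nat.cast_zero]

theorem IsDiff.mul {P Q : PDO K} (hP : IsDiff P) (hQ : IsDiff Q) : IsDiff (P * Q) := by
  intro n hn
  obtain ⟨M, hM⟩ := P.exists_ordLE
  obtain ⟨N, hN⟩ := Q.exists_ordLE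
  have hκ : M + N - n < (M + N - n + 1).toNat := by omega
  rw [mul_coeff_eq_sum (a := n - N) hM hN (by omega) le_rfl hκ]
  refine Finset.sum_eq_zero fun i _ => ?_
  rcases lt_or_ge i 0 with hi | hi
  · rw [hP i hi, zero_mul]
  · rw [Finset.sum_eq_zero, mul_zero]
    intro k _
    rcases lt_or_ge i k with hk | hk
    · rw [choose_eq_zero_of_lt hi hk, zero_smul]
    · rw [hQ _ (by omega), iterate_dx_zero, smul_zero]

theorem IsDiff.eq_const {P : PDO K} (hP : IsDiff P) (h : OrdLE P 0) : P = const (P.coeff 0) := by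
  ext n : 1
  rw [const_coeff]
  split_ifs with hn
  · rw [hn]
  · rcases lt_or_gt_of_ne hn with hn | hn
    · exact hP n hn
    · exact h n hn

theorem IsDiff.eq_sum {P : PDO K} (hP : IsDiff P) {N : ℕ} (hN : OrdLE P N) :
    P = ∑ j ∈ Finset.range (N + 1), const (P.coeff j) * D j := by
  ext n : 1
  rw [sum_coeff]
  simp only [const_mul_D, monomial_coeff]
  rcases lt_or_ge n 0 with hn | hn
  · rw [hP n hn, Finset.sum_eq_zero]
    intro j _
    rw [if_neg (by omega)]
  · lift n to ℕ using hn
    simp only [Nat.cast_inj, Finset.sum_ite_eq, Finset.mem_range]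
    split_ifs with h
    · rfl
    · exact hN _ (by omega)

theorem exists_ordLE_nat (P : PDO K) : ∃ N : ℕ, OrdLE P N := by
  obtain ⟨N, hN⟩ := P.exists_ordLE
  exact ⟨N.toNat, hN.mono (by omega)⟩

theorem D_succ (n : ℕ) : (D ((n + 1 : ℕ) : ℤ) : PDO K) = D 1 * D n := by
  rw [D_mul_D]
  congr 1
  push_cast
  ring

theorem D_succ' (n : ℕ) : (D ((n + 1 : ℕ) : ℤ) : PDO K) = D n * D 1 := by
  rw [D_mul_D]
  congr 1

theorem IsDiff.induction_left {p : PDO K → Prop} (zero : p 0) (one : p 1)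
    (add : ∀ P Q, IsDiff P → IsDiff Q → p P → p Q → p (P + Q))
    (const_mul : ∀ f P, IsDiff P → p P → p (const f * P))
    (D_mul : ∀ P, IsDiff P → p P → p (D 1 * P)) {P : PDO K} (hP : IsDiff P) : p P := by
  obtain ⟨N, hN⟩ := P.exists_ordLE_nat
  have hD : ∀ j : ℕ, p (D j) := fun j => by
    induction j with
    | zero => exact one
    | succ j ih =>
      rw [D_succ]
      exact D_mul _ (isDiff_D j) ih
  rw [hP.eq_sum hN]
  refine (Finset.sum_induction _ (fun P => IsDiff P ∧ p P) ?_ ⟨isDiff_zero, zero⟩ ?_).2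
  · exact fun P Q h h' => ⟨h.1.add h'.1, add _ _ h.1 h'.1 h.2 h'.2⟩
  · exact fun j _ => ⟨(isDiff_const _).mul (isDiff_D j), const_mul _ _ (isDiff_D j) (hD j)⟩

theorem IsDiff.induction_right {p : PDO K → Prop} (zero : p 0) (one : p 1)
    (add : ∀ P Q, IsDiff P → IsDiff Q → p P → p Q → p (P + Q))
    (mul_const : ∀ f P, IsDiff P → p P → p (P * const f))
    (mul_D : ∀ P, IsDiff P → p P → p (P * D 1)) {P : PDO K} (hP : IsDiff P) : p P := by
  obtain ⟨N, hN⟩ := P.exists_ordLE_nat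
  rw [hP.eq_sum hN]
  refine (Finset.sum_induction _ (fun P => IsDiff P ∧ p P) ?_ ⟨isDiff_zero, zero⟩ ?_).2
  · exact fun P Q h h' => ⟨h.1.add h'.1, add _ _ h.1 h'.1 h.2 h'.2⟩
  · intro j _
    refine ⟨(isDiff_const _).mul (isDiff_D j), ?_⟩
    induction j with
    | zero =>
      have h1 := mul_const (P.coeff (0 : ℕ)) 1 isDiff_one one
      rw [one_mul] at h1
      rwa [Nat.cast_zero, D_zero, mul_one]
    | succ i ih =>
      -- The outer induction hypothesis only concerns the coefficient of Dⁱ in P; the step needs an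
      -- arbitrary coefficient in front of Dʲ.
      have key : ∀ (f : TimeSeries K) (j : ℕ), p (const f * D j) := fun f j => by
        induction j with
        | zero =>
          have h1 := mul_const f 1 isDiff_one one
          rw [one_mul] at h1
          rwa [Nat.cast_zero, D_zero, mul_one]
        | succ j ih =>
          rw [D_succ', ← mul_assoc]
          exact mul_D _ ((isDiff_const f).mul (isDiff_D j)) ih
      exact key _ _

/-! ## Residues, adjoints and the action on functions -/

theorem D_mul_const_coeff (i n : ℤ) (f : TimeSeries K) (k : ℕ) (h : n + k = i) :
    (D i * const f).coeff n = (Ring.choose i k : ℤ) • dx^[k] f := by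
  rw [D, monomial_mul_coeff 1 i (ordLE_const f) (κ := k + 1) (by push_cast; omega), one_mul,
    Finset.sum_eq_single k]
  · rw [const_coeff, if_pos (by omega)]
  · intro l _ hl
    rw [const_coeff, if_neg (by omega), iterate_dx_zero, smul_zero]
  · intro hk
    exact absurd (Finset.self_mem_range_succ k) hk

/-- For i ≥ 0 the operator Dⁱ f has no negative powers, and for i < -1 it does not reach D⁻¹. So the
residue is linear over functions on the right as well, which makes residues usable as right-hand
coefficients. -/
theorem res_mul_const (P : PDO K) (f : TimeSeries K) :
    (P * const f).coeff (-1) = P.coeff (-1) * f := by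
  obtain ⟨M, hM⟩ := P.exists_ordLE
  rw [mul_coeff_eq_sum_D (a := -1) (b := max M (-1)) hM (ordLE_const f) (by omega)
    (le_max_left _ _), Finset.sum_eq_single (-1)]
  · rw [D_mul_const_coeff (-1) (-1) f 0 (by simp)]
    simp
  · intro i hi hi'
    have := (Finset.mem_Icc.mp hi).1
    rw [D_mul_const_coeff i (-1) f (i + 1).toNat (by omega),
      choose_eq_zero_of_lt (by omega) (by omega), zero_smul, mul_zero]
  · intro h
    exact absurd (Finset.mem_Icc.mpr ⟨le_rfl, le_max_right _ _⟩) h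

theorem apply_eq (P : PDO K) (f : TimeSeries K) : P.apply f = (P * const f).coeff 0 := by
  obtain ⟨M, hM⟩ := P.exists_ordLE_nat
  rw [mul_coeff_eq_sum_D (a := 0) (b := M) hM (ordLE_const f) (by omega) le_rfl, apply,
    finsum_eq_sum_of_support_subset (s := Finset.range (M + 1))]
  · refine Finset.sum_bij (fun j _ => (j : ℤ)) ?_ ?_ ?_ ?_
    · intro j hj
      simp only [Finset.mem_range, Finset.mem_Icc] at hj ⊢
      omega
    · intro i _ j _ h
      exact Nat.cast_injective h
    · intro i hi
      rw [Finset.mem_Icc] at hi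
      exact ⟨i.toNat, by rw [Finset.mem_range]; omega, by omega⟩
    · intro j _
      rw [D_mul_const_coeff j 0 f j (zero_add _)]
      have : Ring.choose (j : ℤ) j = 1 := by
        have := Ring.choose_natCast (R := ℤ) j j
        simpa using this
      rw [this, one_smul]
  · intro j hj
    simp only [Finset.coe_range, Set.mem_Iio]
    by_contra h
    exact hj (by simp only [hM j (by omega), zero_mul])

/-- Up to sign, the coefficients of P* are the coefficients of P written on the right of the powers
of D, and these are residues. The binomials match by negation of the upper index. -/
theorem adjoint_coeff (P : PDO K) (n : ℤ) :
    P.adjoint.coeff n = (n.negOnePow : ℤ) • (D (-n - 1) * P).coeff (-1) := by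
  obtain ⟨N, hN⟩ := P.exists_ordLE
  have e : P.adjoint.coeff n = ∑ᶠ k : ℕ,
      (((n + k).negOnePow : ℤ) * Ring.choose (n + k) k) • dx^[k] (P.coeff (n + k)) := rfl
  rw [e, D, monomial_mul_coeff 1 _ hN (κ := (N - n + 1).toNat) (by omega), one_mul,
    finsum_eq_sum_of_support_subset (s := Finset.range (N - n + 1).toNat), Finset.smul_sum]
  · refine Finset.sum_congr rfl fun k _ => ?_
    rw [smul_smul]
    have h1 : (-1 : ℤ) - (-n - 1) + k = n + k := by ring
    have h2 : -n - 1 = -(n + 1) := by ring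
    have h3 : n + 1 + k - 1 = n + k := by ring
    rw [h1, h2, Ring.choose_neg, h3, Int.negOnePow_add, Units.val_mul, Units.smul_def,
      smul_eq_mul, mul_assoc]
  · intro k hk
    simp only [Finset.coe_range, Set.mem_Iio]
    by_contra h
    exact hk (by simp only [hN (n + k) (by omega), iterate_dx_zero, smul_zero])

/-- Turns the action of the adjoint into a residue, so that no adjoint operator has to be handled
afterwards. -/
theorem adjoint_apply_eq (B : PDO K) (f : TimeSeries K) :
    B.adjoint.apply f = (D (-1) * const f * B).coeff (-1) := by
  obtain ⟨M, hM⟩ := B.exists_ordLE_nat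
  have hadj : OrdLE B.adjoint M := fun n hn => by
    rw [adjoint_coeff, ((ordLE_D _).mul hM) (-1) (by omega), smul_zero]
  rw [mul_coeff_eq_sum_D (a := -1 - M) (b := -1) ((ordLE_D (-1)).mul (ordLE_const f)) hM (by omega)
    (by omega), apply, finsum_eq_sum_of_support_subset (s := Finset.range (M + 1))]
  · refine Finset.sum_bij (fun j _ => -1 - (j : ℤ)) ?_ ?_ ?_ ?_
    · intro j hj
      simp only [Finset.mem_range, Finset.mem_Icc] at hj ⊢
      omega
    · intro i _ j _ h
      omega
    · intro i hi
      rw [Finset.mem_Icc] at hi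
      exact ⟨(-1 - i).toNat, by rw [Finset.mem_range]; omega, by omega⟩
    · intro j _
      have h1 : -(j : ℤ) - 1 = -1 - j := by ring
      have h2 : Ring.choose (-1 : ℤ) j = ((j : ℤ).negOnePow : ℤ) := by
        have h3 : Ring.choose (j : ℤ) j = 1 := by
          have := Ring.choose_natCast (R := ℤ) j j
          simpa using this
        rw [Ring.choose_neg, add_sub_cancel_left, h3, Units.smul_def, smul_eq_mul, mul_one]
      rw [adjoint_coeff, h1, D_mul_const_coeff (-1) (-1 - j) f j (by ring), h2, smul_mul_assoc,
        smul_mul_assoc, mul_comm]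
  · intro j hj
    simp only [Finset.coe_range, Set.mem_Iio]
    by_contra h
    exact hj (by simp only [hadj j (by omega), zero_mul])

/-! ## Inverses of dressing operators -/

theorem ordLE_dressInv (W : PDO K) : OrdLE W.dressInv 0 := fun _ hn => if_neg (not_le.mpr hn)

theorem OrdLE.pow {P : PDO K} (hP : OrdLE P (-1)) (k : ℕ) : OrdLE (P ^ k) (-k) := by
  induction k with
  | zero => simpa using ordLE_one
  | succ k ih =>
    rw [pow_succ]
    exact (ih.mul hP).mono (by push_cast; omega)

theorem dressInv_coeff (W : PDO K) (h : OrdLE (1 - W) (-1)) {n : ℤ} {N : ℕ} (hN : -n < N) :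
    W.dressInv.coeff n = (∑ k ∈ Finset.range N, (1 - W) ^ k).coeff n := by
  rw [sum_coeff]
  have e : W.dressInv.coeff n = if n ≤ 0 then
      ∑ k ∈ Finset.range ((-n).toNat + 1), ((1 - W) ^ k).coeff n else 0 := rfl
  rw [e]
  split_ifs with hn
  · refine Finset.sum_subset (Finset.range_mono (by omega)) fun k _ hk => ?_
    rw [Finset.mem_range] at hk
    exact h.pow k n (by omega)
  · exact (Finset.sum_eq_zero fun k _ => h.pow k n (by omega)).symm

theorem dressInv_sub (W : PDO K) (h : OrdLE (1 - W) (-1)) (N : ℕ) :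
    OrdLE (W.dressInv - ∑ k ∈ Finset.range N, (1 - W) ^ k) (-N) := fun n hn => by
  rw [sub_coeff, dressInv_coeff W h (N := N) (by omega), sub_self]

/-- Up to order -N the inverse is the partial geometric sum of length N, whose product with W is 1 -
(1 - W)ᴺ; both errors have order at most -N, for every N. -/
theorem mul_dressInv {W : PDO K} (h : OrdLE (1 - W) (-1)) : W * W.dressInv = 1 := by
  have hW : OrdLE W 0 := by
    have := ordLE_one.sub (h.mono (by decide : (-1 : ℤ) ≤ 0))
    rwa [sub_sub_cancel] at this
  refine sub_eq_zero.mp (eq_zero_of_forall_ordLE fun N => ?_)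
  have e : W * W.dressInv - 1 =
      W * (W.dressInv - ∑ k ∈ Finset.range N, (1 - W) ^ k) - (1 - W) ^ N := by
    have := mul_neg_geom_sum (1 - W) N
    rw [sub_sub_cancel] at this
    rw [mul_sub, this]
    abel
  rw [e]
  exact ((hW.mul (dressInv_sub W h N)).mono (by omega)).sub (h.pow N)

theorem dressInv_mul {W : PDO K} (h : OrdLE (1 - W) (-1)) : W.dressInv * W = 1 := by
  have hW : OrdLE W 0 := by
    have := ordLE_one.sub (h.mono (by decide : (-1 : ℤ) ≤ 0))
    rwa [sub_sub_cancel] at this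
  refine sub_eq_zero.mp (eq_zero_of_forall_ordLE fun N => ?_)
  have e : W.dressInv * W - 1 =
      (W.dressInv - ∑ k ∈ Finset.range N, (1 - W) ^ k) * W - (1 - W) ^ N := by
    have := geom_sum_mul_neg (1 - W) N
    rw [sub_sub_cancel] at this
    rw [sub_mul, this]
    abel
  rw [e]
  exact (((dressInv_sub W h N).mul hW).mono (by omega)).sub (h.pow N)

/-! ## Left and right symbols -/

/-- The left symbol `∑ₙ aₙ λⁿ` of `P = ∑ₙ aₙ Dⁿ`, so that `P(e^ξ) = lsym P e^ξ`. -/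
def lsym : PDO K →+ LaurentSeries (TimeSeries K) where
  toFun P := HahnSeries.ofSuppBddBelow (fun n => P.coeff (-n)) (by
    obtain ⟨N, hN⟩ := P.exists_ordLE
    refine ⟨-N, fun n hn => ?_⟩
    by_contra h
    exact hn (hN (-n) (by omega)))
  map_zero' := rfl
  map_add' _ _ := rfl

@[simp] theorem lsym_coeff (P : PDO K) (n : ℤ) : (lsym P).coeff n = P.coeff (-n) := rfl

/-- The right symbol `∑ₙ bₙ λⁿ` of `P = ∑ₙ Dⁿ bₙ`, so that `P*(e^{-ξ}) = rsym P e^{-ξ}`. -/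
def rsym : PDO K →+ LaurentSeries (TimeSeries K) where
  toFun P := HahnSeries.ofSuppBddBelow (fun n => (D (n - 1) * P).coeff (-1)) (by
    obtain ⟨N, hN⟩ := P.exists_ordLE
    refine ⟨-N, fun n hn => ?_⟩
    by_contra h
    exact hn (((ordLE_D (n - 1)).mul hN) (-1) (by omega)))
  map_zero' := by
    ext n : 2
    exact congrArg (fun Q : PDO K => Q.coeff (-1)) (mul_zero _)
  map_add' P Q := by
    ext n : 2
    exact congrArg (fun Q : PDO K => Q.coeff (-1)) (mul_add _ P Q)

@[simp] theorem rsym_coeff (P : PDO K) (n : ℤ) :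
    (rsym P).coeff n = (D (n - 1) * P).coeff (-1) := rfl

theorem lsym_injective : Function.Injective (lsym (K := K)) := fun P Q h => by
  ext n : 1
  have := congrArg (fun g => HahnSeries.coeff g (-n)) h
  simpa using this

theorem lsym_const_mul (f : TimeSeries K) (P : PDO K) :
    lsym (const f * P) = HahnSeries.C f * lsym P := by
  ext n : 2
  rw [HahnSeries.C_mul_eq_smul, HahnSeries.coeff_smul, smul_eq_mul, lsym_coeff, lsym_coeff,
    const_mul_coeff]

theorem lsym_mul_D (P : PDO K) (j : ℤ) :
    lsym (P * D j) = HahnSeries.single (-j) 1 * lsym P := by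
  ext n : 2
  rw [HahnSeries.coeff_single_mul, lsym_coeff, lsym_coeff, mul_D_coeff, one_mul]
  congr 1
  ring

theorem lsym_D_one_mul (P : PDO K) : lsym (D 1 * P) = waveDx (lsym P) := by
  ext n : 2
  rw [waveDx, HahnSeries.coeff_add, HahnSeries.map_coeff, HahnSeries.coeff_single_mul, lsym_coeff,
    lsym_coeff, lsym_coeff, D_one_mul_coeff, one_mul]
  congr 2
  ring

theorem rsym_mul_const (P : PDO K) (f : TimeSeries K) :
    rsym (P * const f) = HahnSeries.C f * rsym P := by
  ext n : 2
  rw [HahnSeries.C_mul_eq_smul, HahnSeries.coeff_smul, smul_eq_mul, rsym_coeff, rsym_coeff,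
    ← mul_assoc, res_mul_const, mul_comm]

theorem rsym_D_mul (P : PDO K) (j : ℤ) :
    rsym (D j * P) = HahnSeries.single (-j) 1 * rsym P := by
  ext n : 2
  rw [HahnSeries.coeff_single_mul, rsym_coeff, rsym_coeff, ← mul_assoc, D_mul_D, one_mul]
  congr 3
  ring

/-- `-∂ₓ` acting on `g(t, λ) e^{-ξ(t, λ)}`. -/
def waveDxNeg (g : LaurentSeries (TimeSeries K)) : LaurentSeries (TimeSeries K) :=
  HahnSeries.single (-1) 1 * g - HahnSeries.map g (dx (K := K))

/-- Reflects (P D)* = -D P*, which is why the derivation of g e^{-ξ} enters with a minus sign. -/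
theorem rsym_mul_D_one (P : PDO K) : rsym (P * D 1) = waveDxNeg (rsym P) := by
  ext n : 2
  have e : (D (n - -1 - 1) : PDO K) = D 1 * D (n - 1) := by
    rw [D_mul_D]
    congr 1
    ring
  rw [waveDxNeg, HahnSeries.coeff_sub, HahnSeries.map_coeff, HahnSeries.coeff_single_mul,
    rsym_coeff, rsym_coeff, rsym_coeff, one_mul, ← mul_assoc, mul_D_coeff, e, mul_assoc,
    D_one_mul_coeff]
  simp

/-! ## Wave functions as symbols -/

theorem ofPowerSeries_coeff_of_neg {R : Type*} [Semiring R] (F : PowerSeries R) {n : ℤ}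
    (hn : n < 0) : (HahnSeries.ofPowerSeries ℤ R F).coeff n = 0 := by
  rw [HahnSeries.ofPowerSeries_apply, HahnSeries.embDomain_of_notMem_range]
  rintro ⟨k, hk⟩
  have hk' : (k : ℤ) = n := hk
  omega

theorem eq_ofPowerSeries {R : Type*} [Semiring R] {g : LaurentSeries R} {F : PowerSeries R}
    (h : ∀ n : ℕ, g.coeff n = PowerSeries.coeff n F) (h' : ∀ n < 0, g.coeff n = 0) :
    g = HahnSeries.ofPowerSeries ℤ R F := by
  ext n : 2
  rcases lt_or_ge n 0 with hn | hn
  · rw [h' n hn, ofPowerSeries_coeff_of_neg F hn]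
  · lift n to ℕ using hn
    rw [h, HahnSeries.ofPowerSeries_apply_coeff]

theorem lsym_eq_wave {W : PDO K} (hW : OrdLE W 0) : lsym W = wave W :=
  eq_ofPowerSeries (fun n => by rw [lsym_coeff, PowerSeries.coeff_mk])
    fun n hn => hW (-n) (by omega)

theorem rsym_eq_ofPowerSeries {U : PDO K} (hU : OrdLE U 0) :
    rsym U = HahnSeries.ofPowerSeries ℤ _
      (PowerSeries.mk fun i => (D ((i : ℤ) - 1) * U).coeff (-1)) :=
  eq_ofPowerSeries (fun n => by rw [rsym_coeff, PowerSeries.coeff_mk])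
    fun n hn => ((ordLE_D (n - 1)).mul hU) (-1) (by omega)

theorem rsym_dressInv (W : PDO K) : rsym W.dressInv = adjointWave W := by
  rw [rsym_eq_ofPowerSeries (ordLE_dressInv W), adjointWave]
  congr 2
  funext i
  have h : ((-(i : ℤ)).negOnePow : ℤ) = (-1) ^ i := by
    rw [Int.negOnePow_neg, Int.negOnePow_def, zpow_natCast]
    simp
  rw [adjoint_coeff, neg_neg, h, zsmul_eq_mul, ← mul_assoc]
  push_cast
  rw [← mul_pow]
  simp

/-- `∂ₓ` acting coefficientwise on power series. -/
def pdx (F : PowerSeries (TimeSeries K)) : PowerSeries (TimeSeries K) :=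
  PowerSeries.mk fun n => dx (PowerSeries.coeff n F)

@[simp] theorem coeff_pdx (n : ℕ) (F : PowerSeries (TimeSeries K)) :
    PowerSeries.coeff n (pdx F) = dx (PowerSeries.coeff n F) := PowerSeries.coeff_mk _ _

theorem pdx_mul (F G : PowerSeries (TimeSeries K)) : pdx (F * G) = F * pdx G + pdx F * G := by
  ext n : 1
  rw [coeff_pdx, map_add, PowerSeries.coeff_mul, PowerSeries.coeff_mul, PowerSeries.coeff_mul,
    map_sum, ← Finset.sum_add_distrib]
  refine Finset.sum_congr rfl fun p _ => ?_
  rw [Derivation.leibniz, smul_eq_mul, smul_eq_mul, coeff_pdx, coeff_pdx, mul_comm (dx _)]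

theorem map_dx_ofPowerSeries (F : PowerSeries (TimeSeries K)) :
    HahnSeries.map (HahnSeries.ofPowerSeries ℤ _ F) (dx (K := K)) =
      HahnSeries.ofPowerSeries ℤ _ (pdx F) :=
  eq_ofPowerSeries
    (fun n => by rw [HahnSeries.map_coeff, HahnSeries.ofPowerSeries_apply_coeff, coeff_pdx])
    fun n hn => by rw [HahnSeries.map_coeff, ofPowerSeries_coeff_of_neg F hn, map_zero]

theorem pdx_X_mul (F : PowerSeries (TimeSeries K)) :
    pdx (PowerSeries.X * F) = PowerSeries.X * pdx F := by
  ext n : 1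
  cases n with
  | zero => simp
  | succ n => rw [coeff_pdx, PowerSeries.coeff_succ_X_mul, PowerSeries.coeff_succ_X_mul, coeff_pdx]

theorem single_mul_ofPowerSeries_X_mul (F : PowerSeries (TimeSeries K)) :
    HahnSeries.single (-1) 1 * HahnSeries.ofPowerSeries ℤ _ (PowerSeries.X * F) =
      HahnSeries.ofPowerSeries ℤ _ F := by
  rw [map_mul, HahnSeries.ofPowerSeries_X, ← mul_assoc, HahnSeries.single_mul_single,
    neg_add_cancel, one_mul]
  exact one_mul _

theorem waveDx_ofPowerSeries_X_mul (F : PowerSeries (TimeSeries K)) :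
    waveDx (HahnSeries.ofPowerSeries ℤ _ (PowerSeries.X * F)) =
      HahnSeries.ofPowerSeries ℤ _ (F + PowerSeries.X * pdx F) := by
  rw [waveDx, map_dx_ofPowerSeries, single_mul_ofPowerSeries_X_mul, pdx_X_mul, map_add, add_comm]

theorem waveDxNeg_ofPowerSeries_X_mul (F : PowerSeries (TimeSeries K)) :
    waveDxNeg (HahnSeries.ofPowerSeries ℤ _ (PowerSeries.X * F)) =
      HahnSeries.ofPowerSeries ℤ _ (F - PowerSeries.X * pdx F) := by
  rw [waveDxNeg, map_dx_ofPowerSeries, single_mul_ofPowerSeries_X_mul, pdx_X_mul, map_sub]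

/-- Every Laurent series is a left symbol, so this is left cancellation of D. -/
theorem waveDx_injective : Function.Injective (waveDx (K := K)) := fun g h hgh => by
  have hz : ∀ g : LaurentSeries (TimeSeries K), ∃ P : PDO K, lsym P = g := fun g => by
    refine ⟨⟨fun n => g.coeff (-n), -g.order, fun n hn => ?_⟩, ?_⟩
    · exact HahnSeries.coeff_eq_zero_of_lt_order (by omega)
    · ext n : 2
      exact congrArg g.coeff (neg_neg n)
  obtain ⟨P, rfl⟩ := hz g
  obtain ⟨Q, rfl⟩ := hz h
  rw [← lsym_D_one_mul, ← lsym_D_one_mul] at hgh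
  rw [D_one_mul_cancel (lsym_injective hgh)]

theorem waveDxNeg_injective : Function.Injective (waveDxNeg (K := K)) := fun g h hgh => by
  by_contra hne
  set d := g - h with hd
  have hd0 : d ≠ 0 := sub_ne_zero.mpr hne
  have h1 : waveDxNeg d = waveDxNeg g - waveDxNeg h := by
    ext n : 2
    simp only [hd, waveDxNeg, mul_sub, HahnSeries.coeff_sub, HahnSeries.map_coeff, map_sub]
    ring
  rw [hgh, sub_self] at h1
  -- One degree below the order of d, only the factor λ contributes, and it contributes the leading
  -- coefficient of d.
  have h2 := congrArg (fun x => HahnSeries.coeff x (d.order - 1)) h1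
  simp only [waveDxNeg, HahnSeries.coeff_sub, HahnSeries.map_coeff, HahnSeries.coeff_single_mul,
    HahnSeries.coeff_zero] at h2
  rw [HahnSeries.coeff_eq_zero_of_lt_order (x := d) (i := d.order - 1) (by omega), map_zero,
    sub_zero, one_mul, sub_neg_eq_add, sub_add_cancel] at h2
  exact hd0 (HahnSeries.coeff_order_eq_zero.mp h2)

end PDO

end KP

end

noncomputable section

namespace KP

open MvPowerSeries (pderiv constantCoeff)
open Finset.HasAntidiagonal (antidiagonal)

variable {K : Type*} [Field K]

/-! ## Miwa shifts -/

/-- The weight `∑ l α_l` of the monomial `t^α`. -/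
def weight (α : ℕ+ →₀ ℕ) : ℕ := α.sum fun l a => (l : ℕ) * a

theorem weight_add (α β : ℕ+ →₀ ℕ) : weight (α + β) = weight α + weight β :=
  Finsupp.sum_add_index' (fun _ => mul_zero _) fun _ _ _ => mul_add _ _ _

@[simp] theorem weight_single (l : ℕ+) (a : ℕ) : weight (Finsupp.single l a) = l * a :=
  Finsupp.sum_single_index (mul_zero _)

theorem mul_le_weight (α : ℕ+ →₀ ℕ) (l : ℕ+) : (l : ℕ) * α l ≤ weight α := by
  by_cases h : α l = 0
  · simp [h]
  · exact Finset.single_le_sum (f := fun l : ℕ+ => (l : ℕ) * α l) (fun _ _ => Nat.zero_le _)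
      (Finsupp.mem_support_iff.mpr h)

theorem finite_weight_eq (k : ℕ) : {α : ℕ+ →₀ ℕ | weight α = k}.Finite := by
  refine Set.Finite.subset
    ((Finset.Icc (1 : ℕ+) k.succPNat).finsupp fun _ => Finset.range (k + 1)).finite_toSet ?_
  intro α hα
  rw [Set.mem_ofPred_eq] at hα
  rw [Finset.mem_coe, Finset.mem_finsupp_iff]
  refine ⟨fun l hl => ?_, fun l _ => ?_⟩
  · rw [Finset.mem_Icc]
    refine ⟨one_le, ?_⟩
    have h1 := mul_le_weight α l
    have h2 : 1 ≤ α l := Nat.one_le_iff_ne_zero.mpr (Finsupp.mem_support_iff.mp hl)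
    rw [← PNat.coe_le_coe, Nat.succPNat_coe]
    nlinarith
  · rw [Finset.mem_range]
    have h1 := mul_le_weight α l
    have h2 := l.pos
    nlinarith

/-- The exponents of weight `k`. -/
def weightFinset (k : ℕ) : Finset (ℕ+ →₀ ℕ) := (finite_weight_eq k).toFinset

theorem mem_weightFinset {k : ℕ} {α : ℕ+ →₀ ℕ} : α ∈ weightFinset k ↔ weight α = k := by
  simp [weightFinset]

/-- The coefficient of `t^(α + β)` in the expansion of a Miwa shift. -/
def shiftCoeff (ε : ℤ) (α β : ℕ+ →₀ ℕ) : K :=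
  α.prod fun l a => (((a + β l).choose a : ℕ) : K) * ((ε : K) / ((l : ℕ) : K)) ^ a

/-- The coefficient of `λ⁻ᵏ` in `f(t + ε [λ⁻¹])`. -/
def miwaCoeff (ε : ℤ) (k : ℕ) (f : TimeSeries K) : TimeSeries K := fun β : ℕ+ →₀ ℕ =>
    ∑ᶠ α : ℕ+ →₀ ℕ, if (α.sum fun l a => (l : ℕ) * a) = k then
      (α.prod fun l a => (((a + β l).choose a : ℕ) : K) * ((ε : K) / ((l : ℕ) : K)) ^ a)
        * MvPowerSeries.coeff (α + β) f
    else 0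

theorem coeff_miwaCoeff (ε : ℤ) (k : ℕ) (f : TimeSeries K) (β : ℕ+ →₀ ℕ) :
    MvPowerSeries.coeff β (miwaCoeff ε k f) =
      ∑ α ∈ weightFinset k, shiftCoeff ε α β * MvPowerSeries.coeff (α + β) f := by
  change (∑ᶠ α : ℕ+ →₀ ℕ, if weight α = k then
    shiftCoeff ε α β * MvPowerSeries.coeff (α + β) f else 0) = _
  rw [finsum_eq_sum_of_support_subset (s := weightFinset k)]
  · exact Finset.sum_congr rfl fun α hα => if_pos (mem_weightFinset.mp hα)
  · intro α hα
    rw [Finset.mem_coe, mem_weightFinset]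
    by_contra h
    exact hα (if_neg h)

theorem weight_eq_zero {α : ℕ+ →₀ ℕ} : weight α = 0 ↔ α = 0 := by
  refine ⟨fun h => Finsupp.ext fun l => ?_, fun h => by rw [h]; rfl⟩
  have h1 := mul_le_weight α l
  rw [h, Nat.le_zero, Nat.mul_eq_zero] at h1
  exact h1.resolve_left l.ne_zero

theorem miwaCoeff_zero (ε : ℤ) (f : TimeSeries K) : miwaCoeff ε 0 f = f := by
  refine MvPowerSeries.ext fun β => ?_
  rw [coeff_miwaCoeff, Finset.sum_eq_single 0]
  · rw [shiftCoeff, Finsupp.prod_zero_index, one_mul, zero_add]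
  · intro α hα h
    exact absurd (weight_eq_zero.mp (mem_weightFinset.mp hα)) h
  · intro h
    exact absurd (mem_weightFinset.mpr (weight_eq_zero.mpr rfl)) h

theorem miwaCoeff_map_zero (ε : ℤ) (k : ℕ) : miwaCoeff ε k (0 : TimeSeries K) = 0 := by
  refine MvPowerSeries.ext fun β => ?_
  rw [coeff_miwaCoeff, Finset.sum_eq_zero, map_zero]
  intro α _
  rw [map_zero, mul_zero]

/-- The absorption identity for binomials: moving one factor t_l from the shifted part to the
remaining monomial is differentiation in t_l, with the weight 1/l of the Miwa shift cancelling l. -/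
theorem shiftCoeff_add_single [CharZero K] (ε : ℤ) (α β : ℕ+ →₀ ℕ) (l : ℕ+) :
    (shiftCoeff ε (α + Finsupp.single l 1) β : K) * ((l : ℕ) * ((α l : K) + 1)) =
      ε * ((β l : K) + 1) * shiftCoeff ε α (β + Finsupp.single l 1) := by
  classical
  set s := insert l α.support
  have hl : l ∈ s := Finset.mem_insert_self _ _
  have hs : α.support ⊆ s := Finset.subset_insert _ _
  have hs' : (α + Finsupp.single l 1).support ⊆ s := by
    refine Finsupp.support_add.trans (Finset.union_subset hs ?_)
    exact Finsupp.support_single_subset.trans (Finset.singleton_subset_iff.mpr hl)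
  rw [shiftCoeff, shiftCoeff, Finsupp.prod_of_support_subset _ hs' _ (by simp),
    Finsupp.prod_of_support_subset _ hs _ (by simp), ← Finset.mul_prod_erase s _ hl,
    ← Finset.mul_prod_erase s (fun j => _ * (_ : K)) hl]
  have e : ∀ j ∈ s.erase l,
      ((((α + Finsupp.single l 1 : ℕ+ →₀ ℕ) j + β j).choose
        ((α + Finsupp.single l 1 : ℕ+ →₀ ℕ) j) : ℕ) : K) *
        ((ε : K) / ((j : ℕ) : K)) ^ ((α + Finsupp.single l 1 : ℕ+ →₀ ℕ) j) =
      (((α j + (β + Finsupp.single l 1 : ℕ+ →₀ ℕ) j).choose (α j) : ℕ) : K) *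
        ((ε : K) / ((j : ℕ) : K)) ^ (α j) := fun j hj => by
    have hne : j ≠ l := Finset.ne_of_mem_erase hj
    rw [Finsupp.add_apply, Finsupp.add_apply, Finsupp.single_eq_of_ne hne, add_zero, add_zero]
  rw [Finset.prod_congr rfl e]
  have hch : ((α l + 1 + β l).choose (α l + 1) : K) * ((α l : K) + 1) =
      (α l + (β l + 1)).choose (α l) * ((β l : K) + 1) := by
    have := Nat.choose_succ_right_eq (α l + (β l + 1)) (α l)
    rw [Nat.add_sub_cancel_left, add_assoc] at *
    rw [show 1 + β l = β l + 1 from add_comm _ _]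
    exact_mod_cast this
  have hl0 : ((l : ℕ) : K) ≠ 0 := Nat.cast_ne_zero.mpr l.ne_zero
  have h1 : ((ε : K) / ((l : ℕ) : K)) ^ (α l + 1) * (l : ℕ) =
      ε * ((ε : K) / ((l : ℕ) : K)) ^ (α l) := by
    rw [pow_succ]
    field_simp
  rw [Finsupp.add_apply, Finsupp.add_apply, Finsupp.single_eq_same]
  linear_combination
    (∏ j ∈ s.erase l, (((α j + (β + Finsupp.single l 1 : ℕ+ →₀ ℕ) j).choose (α j) : ℕ) : K) *
        ((ε : K) / ((j : ℕ) : K)) ^ (α j)) *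
      (((ε : K) / ((l : ℕ) : K)) ^ (α l + 1) * (l : ℕ) * hch +
        (α l + (β l + 1)).choose (α l) * ((β l : K) + 1) * h1)

/-- The coefficients of `f(t + ε [λ⁻¹])` satisfy
`-λ ∂/∂λ f(t + ε [λ⁻¹]) = ε ∑ₙ λ⁻ⁿ (∂f/∂tₙ)(t + ε [λ⁻¹])`. -/
theorem succ_nsmul_miwaCoeff [CharZero K] (ε : ℤ) (k : ℕ) (f : TimeSeries K) :
    (k + 1) • miwaCoeff ε (k + 1) f =
      ∑ p ∈ antidiagonal k, ε • dt p.1.succPNat (miwaCoeff ε p.2 f) := by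
  refine MvPowerSeries.ext fun β => ?_
  rw [map_nsmul, coeff_miwaCoeff, map_sum, Finset.smul_sum]
  have hL : ∀ α ∈ weightFinset (k + 1),
      (k + 1) • (shiftCoeff ε α β * MvPowerSeries.coeff (α + β) f) =
        ∑ l ∈ α.support, (shiftCoeff ε α β * (((l : ℕ) : K) * (α l : K))) *
          MvPowerSeries.coeff (α + β) f := fun α hα => by
    -- The factor k + 1 is the weight ∑ l α_l, so it is distributed over the times that occur in the
    -- monomial.
    have hw : (k + 1 : ℕ) = ∑ l ∈ α.support, (l : ℕ) * α l := (mem_weightFinset.mp hα).symm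
    rw [hw, nsmul_eq_mul]
    push_cast
    rw [Finset.sum_mul]
    exact Finset.sum_congr rfl fun l _ => by ring
  have hR : ∀ p ∈ antidiagonal k,
      MvPowerSeries.coeff β (ε • dt p.1.succPNat (miwaCoeff ε p.2 f)) =
        ∑ α ∈ weightFinset p.2, (ε * ((β p.1.succPNat : K) + 1) *
          shiftCoeff ε α (β + Finsupp.single p.1.succPNat 1)) *
            MvPowerSeries.coeff (α + (β + Finsupp.single p.1.succPNat 1)) f := fun p _ => by
    rw [map_zsmul]
    have := MvPowerSeries.coeff_pderiv (i := p.1.succPNat) (miwaCoeff ε p.2 f) β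
    rw [this, coeff_miwaCoeff, zsmul_eq_mul, Finset.sum_mul, Finset.mul_sum]
    exact Finset.sum_congr rfl fun α _ => by ring
  rw [Finset.sum_congr rfl hL, Finset.sum_congr rfl hR, Finset.sum_sigma', Finset.sum_sigma']
  -- Pairs (α, l) with l in the support of α correspond to α with one t_l removed; the antidiagonal
  -- index is l - 1, since flows are counted from t₁.
  refine Finset.sum_nbij' (fun x => ⟨((x.2 : ℕ) - 1, k + 1 - x.2), x.1 - Finsupp.single x.2 1⟩)
    (fun y => ⟨y.2 + Finsupp.single y.1.1.succPNat 1, y.1.1.succPNat⟩) ?_ ?_ ?_ ?_ ?_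
  · rintro ⟨α, l⟩ h
    simp only [Finset.mem_sigma, mem_weightFinset, Finset.HasAntidiagonal.mem_antidiagonal] at h ⊢
    have h1 : Finsupp.single l 1 ≤ α := by
      rw [Finsupp.single_le_iff]
      exact Nat.one_le_iff_ne_zero.mpr (Finsupp.mem_support_iff.mp h.2)
    have h2 := weight_add (α - Finsupp.single l 1) (Finsupp.single l 1)
    rw [tsub_add_cancel_of_le h1, h.1, weight_single, mul_one] at h2
    have := l.pos
    omega
  · rintro ⟨⟨i, j⟩, α⟩ h
    simp only [Finset.mem_sigma, mem_weightFinset, Finset.HasAntidiagonal.mem_antidiagonal] at h ⊢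
    refine ⟨?_, ?_⟩
    · rw [weight_add, weight_single, Nat.succPNat_coe]
      omega
    · simp
  · rintro ⟨α, l⟩ h
    simp only [Finset.mem_sigma] at h
    have h1 : Finsupp.single l 1 ≤ α := by
      rw [Finsupp.single_le_iff]
      exact Nat.one_le_iff_ne_zero.mpr (Finsupp.mem_support_iff.mp h.2)
    have h2 : ((l : ℕ) - 1).succPNat = l := by
      apply PNat.eq
      rw [Nat.succPNat_coe]
      have := l.pos
      omega
    simp only [h2, tsub_add_cancel_of_le h1]
  · rintro ⟨⟨i, j⟩, α⟩ h
    simp only [Finset.mem_sigma, mem_weightFinset, Finset.HasAntidiagonal.mem_antidiagonal] at h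
    simp only [Nat.succPNat_coe, Nat.succ_sub_one, add_tsub_cancel_right]
    have : k + 1 - i.succ = j := by omega
    rw [this]
  · rintro ⟨α, l⟩ h
    simp only [Finset.mem_sigma] at h
    have h1 : Finsupp.single l 1 ≤ α := by
      rw [Finsupp.single_le_iff]
      exact Nat.one_le_iff_ne_zero.mpr (Finsupp.mem_support_iff.mp h.2)
    have h2 : ((l : ℕ) - 1).succPNat = l := by
      apply PNat.eq
      rw [Nat.succPNat_coe]
      have := l.pos
      omega
    obtain ⟨α', rfl⟩ : ∃ α', α = α' + Finsupp.single l 1 := ⟨_, (tsub_add_cancel_of_le h1).symm⟩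
    have h3 := shiftCoeff_add_single (K := K) ε α' β l
    simp only [h2, add_tsub_cancel_right, ← h3, Finsupp.add_apply, Finsupp.single_eq_same,
      add_right_comm α', add_assoc, Nat.cast_add, Nat.cast_one]

end KP

end

noncomputable section

namespace KP

open MvPowerSeries (pderiv constantCoeff)
open Finset.HasAntidiagonal (antidiagonal)

/-! ## Series that obey a flow -/

theorem sum_antidiagonal_assoc {M : Type*} [AddCommMonoid M] (k : ℕ) (f : ℕ → ℕ → ℕ → M) :
    ∑ p ∈ antidiagonal k, ∑ q ∈ antidiagonal p.1, f q.1 q.2 p.2 =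
      ∑ p ∈ antidiagonal k, ∑ q ∈ antidiagonal p.2, f p.1 q.1 q.2 := by
  rw [Finset.sum_sigma', Finset.sum_sigma']
  refine Finset.sum_nbij' (fun x => ⟨(x.2.1, x.2.2 + x.1.2), (x.2.2, x.1.2)⟩)
    (fun y => ⟨(y.1.1 + y.2.1, y.2.2), (y.1.1, y.2.1)⟩) ?_ ?_ ?_ ?_ ?_
  · rintro ⟨⟨a, b⟩, ⟨c, d⟩⟩ h
    simp only [Finset.mem_sigma, Finset.HasAntidiagonal.mem_antidiagonal] at h ⊢
    exact ⟨by omega, trivial⟩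
  · rintro ⟨⟨a, b⟩, ⟨c, d⟩⟩ h
    simp only [Finset.mem_sigma, Finset.HasAntidiagonal.mem_antidiagonal] at h ⊢
    exact ⟨by omega, trivial⟩
  · rintro ⟨⟨a, b⟩, ⟨c, d⟩⟩ h
    simp only [Finset.mem_sigma, Finset.HasAntidiagonal.mem_antidiagonal] at h
    obtain ⟨-, rfl⟩ := h
    rfl
  · rintro ⟨⟨a, b⟩, ⟨c, d⟩⟩ h
    simp only [Finset.mem_sigma, Finset.HasAntidiagonal.mem_antidiagonal] at h
    obtain ⟨-, rfl⟩ := h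
    rfl
  · rintro ⟨⟨a, b⟩, ⟨c, d⟩⟩ _
    rfl

theorem sum_antidiagonal_left_comm {M : Type*} [AddCommMonoid M] (k : ℕ) (f : ℕ → ℕ → ℕ → M) :
    ∑ p ∈ antidiagonal k, ∑ q ∈ antidiagonal p.2, f p.1 q.1 q.2 =
      ∑ p ∈ antidiagonal k, ∑ q ∈ antidiagonal p.2, f q.1 p.1 q.2 := by
  rw [← sum_antidiagonal_assoc k f, ← sum_antidiagonal_assoc k fun a b c => f b a c]
  exact Finset.sum_congr rfl fun p _ =>
    (Finset.Nat.sum_antidiagonal_swap (f := fun q : ℕ × ℕ => f q.1 q.2 p.2)).symm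

/-- The series `F = ∑ₖ Fₖ zᵏ` satisfies `z ∂F/∂z = ∑ₙ zⁿ⁺¹ dₙ F`. -/
def IsFlowSeries {M : Type*} [AddCommMonoid M] (d : ℕ → M →+ M) (F : ℕ → M) : Prop :=
  ∀ k, (k + 1) • F (k + 1) = ∑ p ∈ antidiagonal k, d p.1 (F p.2)

namespace IsFlowSeries

theorem map {M N : Type*} [AddCommMonoid M] [AddCommMonoid N] {d : ℕ → M →+ M} {e : ℕ → N →+ N}
    {F : ℕ → M} (hF : IsFlowSeries d F) (φ : M →+ N) (h : ∀ n x, e n (φ x) = φ (d n x)) :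
    IsFlowSeries e fun k => φ (F k) := fun k => by
  rw [← map_nsmul, hF, map_sum]
  exact Finset.sum_congr rfl fun p _ => (h _ _).symm

/-- The product rule for z ∂/∂z, when `c` is related to `d` and `e` by a Leibniz rule. This allows
the flow of each factor to absorb a different one-sided multiplication. -/
theorem mul {R : Type*} [Ring R] {c d e : ℕ → R →+ R} {F G : PowerSeries R}
    (hF : IsFlowSeries d fun k => PowerSeries.coeff k F)
    (hG : IsFlowSeries e fun k => PowerSeries.coeff k G)
    (h : ∀ n x y, c n (x * y) = d n x * y + x * e n y) :
    IsFlowSeries c fun k => PowerSeries.coeff k (F * G) := by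
  intro k
  set f := fun k => PowerSeries.coeff k F with hf
  set g := fun k => PowerSeries.coeff k G with hg
  simp only [PowerSeries.coeff_mul]
  change (k + 1) • ∑ p ∈ antidiagonal (k + 1), f p.1 * g p.2 =
    ∑ p ∈ antidiagonal k, c p.1 (∑ q ∈ antidiagonal p.2, f q.1 * g q.2)
  have h1 : (k + 1) • ∑ p ∈ antidiagonal (k + 1), f p.1 * g p.2 =
      ∑ p ∈ antidiagonal (k + 1), (p.1 • f p.1) * g p.2 +
        ∑ p ∈ antidiagonal (k + 1), f p.1 * (p.2 • g p.2) := by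
    rw [Finset.smul_sum, ← Finset.sum_add_distrib]
    refine Finset.sum_congr rfl fun p hp => ?_
    rw [smul_mul_assoc, mul_smul_comm, ← add_smul,
      Finset.HasAntidiagonal.mem_antidiagonal.mp hp]
  rw [h1, Finset.Nat.sum_antidiagonal_succ, Finset.Nat.sum_antidiagonal_succ']
  simp only [zero_smul, zero_mul, mul_zero, zero_add]
  have h2 : ∀ j, (j + 1) • f (j + 1) = ∑ p ∈ antidiagonal j, d p.1 (f p.2) := hF
  have h3 : ∀ j, (j + 1) • g (j + 1) = ∑ p ∈ antidiagonal j, e p.1 (g p.2) := hG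
  simp only [h2, h3, map_sum, h, Finset.sum_add_distrib, Finset.sum_mul, Finset.mul_sum]
  rw [sum_antidiagonal_assoc k fun a b c => d a (f b) * g c,
    sum_antidiagonal_left_comm k fun a b c => f a * e b (g c)]

/-- Induction on the degree in z; saturation divides by k + 1. The initial term itself need not lie
in `H`, only its images under the flows. This matters for initial terms such as D⁻¹ Ψ, which are not
differential. -/
theorem mem_succ {M : Type*} [AddCommGroup M] {d : ℕ → M →+ M} {F : ℕ → M}
    (hF : IsFlowSeries d F) {H : AddSubgroup M} (hsat : ∀ (k : ℕ) (x : M), (k + 1) • x ∈ H → x ∈ H)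
    (h0 : ∀ n, d n (F 0) ∈ H) (hs : ∀ n, ∀ x ∈ H, d n x ∈ H) (k : ℕ) : F (k + 1) ∈ H := by
  induction k using Nat.strong_induction_on with
  | _ k ih =>
    refine hsat k _ ?_
    rw [hF]
    refine sum_mem fun p hp => ?_
    rw [Finset.HasAntidiagonal.mem_antidiagonal] at hp
    rcases Nat.eq_zero_or_pos p.2 with h | h
    · rw [h]
      exact h0 _
    · obtain ⟨j, hj⟩ := Nat.exists_eq_succ_of_ne_zero h.ne'
      rw [hj]
      exact hs _ _ (ih j (by omega))

theorem mem {M : Type*} [AddCommGroup M] {d : ℕ → M →+ M} {F : ℕ → M}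
    (hF : IsFlowSeries d F) {H : AddSubgroup M} (hsat : ∀ (k : ℕ) (x : M), (k + 1) • x ∈ H → x ∈ H)
    (h0 : F 0 ∈ H) (hs : ∀ n, ∀ x ∈ H, d n x ∈ H) (k : ℕ) : F k ∈ H := by
  cases k with
  | zero => exact h0
  | succ k => exact hF.mem_succ hsat (fun n => hs n _ h0) hs k

theorem sub {M : Type*} [AddCommGroup M] {d : ℕ → M →+ M} {F G : ℕ → M}
    (hF : IsFlowSeries d F) (hG : IsFlowSeries d G) : IsFlowSeries d fun k => F k - G k :=
  fun k => by
    simp only [smul_sub, hF k, hG k, map_sub, Finset.sum_sub_distrib]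

theorem unique {M : Type*} [AddCommGroup M] [IsAddTorsionFree M] {d : ℕ → M →+ M} {F G : ℕ → M}
    (hF : IsFlowSeries d F) (hG : IsFlowSeries d G) (h0 : F 0 = G 0) (k : ℕ) : F k = G k := by
  refine sub_eq_zero.mp ((hF.sub hG).mem (H := ⊥) (fun k x hx => ?_) ?_ ?_ k)
  · rw [AddSubgroup.mem_bot] at hx ⊢
    exact (nsmul_eq_zero_iff_right k.succ_ne_zero).mp hx
  · rw [AddSubgroup.mem_bot]
    exact sub_eq_zero.mpr h0
  · intro n x hx
    rw [AddSubgroup.mem_bot] at hx ⊢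
    rw [hx, map_zero]

end IsFlowSeries

variable {K : Type*} [Field K]

theorem nsmul_timeSeries_eq_zero [CharZero K] {k : ℕ} {f : TimeSeries K} (h : (k + 1) • f = 0) :
    f = 0 := by
  refine MvPowerSeries.ext fun β => ?_
  have h1 := congrArg (MvPowerSeries.coeff β) h
  rw [map_nsmul, map_zero, nsmul_eq_mul] at h1
  rw [map_zero]
  exact (mul_eq_zero.mp h1).resolve_left (Nat.cast_ne_zero.mpr k.succ_ne_zero)

instance [CharZero K] : IsAddTorsionFree (TimeSeries K) where
  nsmul_right_injective n hn f g hfg := by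
    obtain ⟨k, rfl⟩ := Nat.exists_eq_succ_of_ne_zero hn
    refine sub_eq_zero.mp (nsmul_timeSeries_eq_zero (k := k) ?_)
    rw [smul_sub]
    exact sub_eq_zero.mpr hfg

theorem isFlowSeries_miwaCoeff [CharZero K] (ε : ℤ) (f : TimeSeries K) :
    IsFlowSeries (fun n => ε • (dt n.succPNat).toLinearMap.toAddMonoidHom)
      fun k => miwaCoeff ε k f := fun k => succ_nsmul_miwaCoeff ε k f

/-! ### Flow series with operator coefficients -/

namespace PDO

/-- Differential operators. -/
def diffSubgroup (K : Type*) [Field K] : AddSubgroup (PDO K) where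
  carrier := {P | IsDiff P}
  zero_mem' := isDiff_zero
  add_mem' := IsDiff.add
  neg_mem' := IsDiff.neg

/-- Operators of order at most `N`. -/
def ordSubgroup (K : Type*) [Field K] (N : ℤ) : AddSubgroup (PDO K) where
  carrier := {P | OrdLE P N}
  zero_mem' := ordLE_zero N
  add_mem' := OrdLE.add
  neg_mem' := OrdLE.neg

theorem diffSubgroup_saturated [CharZero K] (k : ℕ) (P : PDO K)
    (h : (k + 1) • P ∈ diffSubgroup K) : P ∈ diffSubgroup K := fun n hn =>
  nsmul_timeSeries_eq_zero (k := k) (by rw [← nsmul_coeff]; exact h n hn)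

theorem ordSubgroup_saturated [CharZero K] (N : ℤ) (k : ℕ) (P : PDO K)
    (h : (k + 1) • P ∈ ordSubgroup K N) : P ∈ ordSubgroup K N := fun n hn =>
  nsmul_timeSeries_eq_zero (k := k) (by rw [← nsmul_coeff]; exact h n hn)

/-- The coefficient of `zᵏ` in `P(t + ε [z])`. -/
def miwaCoeffOp (ε : ℤ) (P : PDO K) (k : ℕ) : PDO K :=
  ⟨fun n => miwaCoeff ε k (P.coeff n), by
    obtain ⟨N, hN⟩ := P.exists_ordLE
    exact ⟨N, fun n hn => (congrArg _ (hN n hn)).trans (miwaCoeff_map_zero ε k)⟩⟩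

theorem miwaCoeffOp_coeff (ε : ℤ) (P : PDO K) (k : ℕ) (n : ℤ) :
    (miwaCoeffOp ε P k).coeff n = miwaCoeff ε k (P.coeff n) := rfl

theorem miwaCoeffOp_zero (ε : ℤ) (P : PDO K) : miwaCoeffOp ε P 0 = P :=
  ext fun _ => miwaCoeff_zero ε _

theorem zsmul_coeff (k : ℤ) (P : PDO K) (n : ℤ) : (k • P).coeff n = k • P.coeff n :=
  map_zsmul (coeffHom n) k P

theorem isFlowSeries_miwaCoeffOp [CharZero K] (ε : ℤ) (P : PDO K) :
    IsFlowSeries (fun n => ε • flowHom n.succPNat) (miwaCoeffOp ε P) := fun k => by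
  ext n : 1
  rw [nsmul_coeff, sum_coeff, miwaCoeffOp_coeff, succ_nsmul_miwaCoeff]
  refine Finset.sum_congr rfl fun p _ => ?_
  rw [AddMonoidHom.zsmul_apply, zsmul_coeff]
  rfl

/-- The leading coefficient 1 does not depend on t, so a shift changes only the lower terms. -/
theorem ordLE_miwaCoeffOp_succ [CharZero K] (ε : ℤ) {P : PDO K} (h : OrdLE P 0)
    (h0 : P.coeff 0 = 1) (k : ℕ) : OrdLE (miwaCoeffOp ε P (k + 1)) (-1) := by
  refine (isFlowSeries_miwaCoeffOp ε P).mem_succ (H := ordSubgroup K (-1))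
    (ordSubgroup_saturated (-1)) (fun n => ?_) (fun n Q hQ => ?_) k
  · rw [miwaCoeffOp_zero, AddMonoidHom.zsmul_apply]
    refine zsmul_mem (fun j hj => ?_) _
    change dt _ (P.coeff j) = 0
    rcases (show j = 0 ∨ 0 < j by omega) with rfl | hj
    · rw [h0, Derivation.map_one_eq_zero]
    · rw [h j hj, map_zero]
  · rw [AddMonoidHom.zsmul_apply]
    exact zsmul_mem (OrdLE.flow hQ _) _

theorem isFlowSeries_const_miwaCoeff [CharZero K] (ε : ℤ) (f : TimeSeries K) :
    IsFlowSeries (fun n => ε • flowHom n.succPNat) fun k => const (miwaCoeff ε k f) :=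
  (isFlowSeries_miwaCoeff ε f).map constHom.toAddMonoidHom fun n g => by
    simp only [AddMonoidHom.zsmul_apply, map_zsmul]
    exact congrArg (ε • ·) (flow_const _ _)

end PDO

end KP

end

noncomputable section

namespace KP

open MvPowerSeries (pderiv constantCoeff)
open Finset.HasAntidiagonal (antidiagonal)

variable {K : Type*} [Field K]

open PDO

/-! ## Dressing operators -/

namespace IsKPDressing

variable {W : PDO K}

theorem ordLE (hW : IsKPDressing W) : OrdLE W 0 := hW.coeff_pos

theorem ordLE_one_sub (hW : IsKPDressing W) : OrdLE (1 - W) (-1) := fun n hn => by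
  rw [sub_coeff, one_coeff]
  rcases (show n = 0 ∨ 0 < n by omega) with rfl | h
  · rw [hW.coeff_zero, if_pos rfl, sub_self]
  · rw [hW.coeff_pos n h, if_neg h.ne', sub_self]

theorem mul_dressInv (hW : IsKPDressing W) : W * W.dressInv = 1 := PDO.mul_dressInv hW.ordLE_one_sub

theorem dressInv_mul (hW : IsKPDressing W) : W.dressInv * W = 1 := PDO.dressInv_mul hW.ordLE_one_sub

theorem dressInv_coeff_zero (hW : IsKPDressing W) : W.dressInv.coeff 0 = 1 := by
  rw [PDO.dressInv_coeff W hW.ordLE_one_sub (n := 0) (N := 1) (by norm_num)]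
  simp [one_coeff]

theorem flow_eq (hW : IsKPDressing W) (n : ℕ+) : W.flow n = flowOp W n * W - W * D (n : ℕ) := by
  have h1 : laxPow W n * W = W * D (n : ℕ) := by
    rw [laxPow, mul_assoc, hW.dressInv_mul, mul_one]
  rw [hW.wilson_sato n, PDO.neg, sub_mul, neg_sub, h1]
  rfl

/-- Differentiate W W⁻¹ = 1. With `flow_eq` this is the rule by which conjugation by W exchanges Dⁿ
and Bₙ. -/
theorem flow_dressInv (hW : IsKPDressing W) (n : ℕ+) :
    W.dressInv.flow n = D (n : ℕ) * W.dressInv - W.dressInv * flowOp W n := by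
  have h1 : W.flow n * W.dressInv + W * W.dressInv.flow n = 0 := by
    rw [← flow_mul, hW.mul_dressInv, flow_one]
  have h2 : W.dressInv.flow n = -(W.dressInv * (W.flow n * W.dressInv)) := by
    rw [eq_neg_of_add_eq_zero_left h1, mul_neg, neg_neg, ← mul_assoc, hW.dressInv_mul, one_mul]
  rw [h2, hW.flow_eq, sub_mul, mul_assoc, hW.mul_dressInv, mul_one, mul_sub, mul_assoc W,
    ← mul_assoc W.dressInv W, hW.dressInv_mul, one_mul, neg_sub]

theorem flowOp_zero (hW : IsKPDressing W) : flowOp W 0 = 1 := by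
  have h : laxPow W 0 = 1 := by
    rw [laxPow, Nat.cast_zero, D_zero, mul_one, hW.mul_dressInv]
  rw [flowOp, h]
  ext n : 1
  rw [pos_coeff, one_coeff]
  split_ifs <;> first | rfl | omega

end IsKPDressing

theorem isDiff_flowOp (W : PDO K) (n : ℕ) : IsDiff (flowOp W n) := isDiff_pos _

/-! ### Criteria for being a differential operator -/

namespace PDO

theorem isDiff_of_D_one_mul {P : PDO K} (h : IsDiff (D 1 * P)) (h' : P.coeff (-1) = 0) :
    IsDiff P := by
  have key : ∀ k : ℕ, P.coeff (-1 - k) = 0 := fun k => by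
    induction k with
    | zero => simpa using h'
    | succ k ih =>
      have h1 := h (-1 - k) (by omega)
      rw [D_one_mul_coeff, ih, map_zero, zero_add] at h1
      rw [← h1]
      congr 1
      push_cast
      ring
  intro n hn
  have := key (-1 - n).toNat
  rwa [show -1 - ((-1 - n).toNat : ℤ) = n by omega] at this

theorem isDiff_of_mul_D_one {P : PDO K} (h : IsDiff (P * D 1)) (h' : P.coeff (-1) = 0) :
    IsDiff P := by
  intro n hn
  rcases (show n = -1 ∨ n < -1 by omega) with rfl | hn'
  · exact h'
  · have := h (n + 1) (by omega)
    rwa [mul_D_coeff, add_sub_cancel_right] at this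

theorem D_neg_one_mul_const_res (f : TimeSeries K) : (D (-1) * const f).coeff (-1) = f := by
  rw [D_mul_const_coeff (-1) (-1) f 0 (by simp)]
  simp

theorem const_mul_D_neg_one_res (f : TimeSeries K) : (const f * D (-1)).coeff (-1) = f := by
  rw [const_mul_coeff, D_coeff, if_pos rfl, mul_one]

/-- Multiplying by D on the left makes both terms differential, so only the residue can obstruct,
and the subtracted term is chosen to cancel it. -/
theorem isDiff_D_neg_one_mul_sub {B : PDO K} (hB : IsDiff B) (f : TimeSeries K) :
    IsDiff (D (-1) * const f * B - D (-1) * const ((D (-1) * const f * B).coeff (-1))) := by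
  refine isDiff_of_D_one_mul ?_ ?_
  · rw [mul_sub, ← mul_assoc, ← mul_assoc, ← mul_assoc, D_mul_D_neg, one_mul, one_mul]
    exact ((isDiff_const _).mul hB).sub (isDiff_const _)
  · rw [sub_coeff, D_neg_one_mul_const_res, sub_self]

theorem isDiff_mul_D_neg_one_sub {B : PDO K} (hB : IsDiff B) (f : TimeSeries K) :
    IsDiff (B * const f * D (-1) - const ((B * const f).coeff 0) * D (-1)) := by
  refine isDiff_of_mul_D_one ?_ ?_
  · rw [sub_mul, mul_assoc, mul_assoc _ _ (D 1), D_neg_mul_D, mul_one, mul_one]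
    exact (hB.mul (isDiff_const _)).sub (isDiff_const _)
  · rw [sub_coeff, mul_D_coeff, const_mul_D_neg_one_res]
    exact sub_self _

end PDO

theorem isEigenfunction_iff {W : PDO K} {Φ : TimeSeries K} :
    IsEigenfunction W Φ ↔ ∀ n : ℕ+, dt n Φ = (flowOp W n * const Φ).coeff 0 :=
  forall_congr' fun n => by rw [apply_eq]

theorem isAdjointEigenfunction_iff {W : PDO K} {Ψ : TimeSeries K} :
    IsAdjointEigenfunction W Ψ ↔
      ∀ n : ℕ+, dt n Ψ = -(D (-1) * const Ψ * flowOp W n).coeff (-1) :=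
  forall_congr' fun n => by rw [adjoint_apply_eq]

/-- The form in which the eigenfunction equation is used: Bₙ Φ D⁻¹ and (∂Φ/∂tₙ) D⁻¹ have the same
negative part. -/
theorem IsEigenfunction.isDiff {W : PDO K} {Φ : TimeSeries K} (h : IsEigenfunction W Φ) (n : ℕ+) :
    IsDiff (flowOp W n * const Φ * D (-1) - const (dt n Φ) * D (-1)) := by
  rw [isEigenfunction_iff.mp h n]
  exact isDiff_mul_D_neg_one_sub (isDiff_flowOp W n) Φ

theorem IsAdjointEigenfunction.isDiff {W : PDO K} {Ψ : TimeSeries K}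
    (h : IsAdjointEigenfunction W Ψ) (n : ℕ+) :
    IsDiff (D (-1) * const Ψ * flowOp W n + D (-1) * const (dt n Ψ)) := by
  rw [isAdjointEigenfunction_iff.mp h n, const_neg, mul_neg, ← sub_eq_add_neg]
  exact isDiff_D_neg_one_mul_sub (isDiff_flowOp W n) Ψ

/-! ## Series of operators -/

/-- Power series of functions as power series of multiplication operators. -/
def constSeries : PowerSeries (TimeSeries K) →+* PowerSeries (PDO K) := PowerSeries.map constHom

theorem coeff_constSeries (F : PowerSeries (TimeSeries K)) (n : ℕ) :
    PowerSeries.coeff n (constSeries F) = const (PowerSeries.coeff n F) :=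
  PowerSeries.coeff_map _ _ _

theorem constSeries_X : constSeries (K := K) PowerSeries.X = PowerSeries.X :=
  PowerSeries.map_X _

theorem constSeries_C (f : TimeSeries K) :
    constSeries (PowerSeries.C f) = PowerSeries.C (const f) :=
  PowerSeries.map_C _ _

theorem C_D_one_mul_constSeries (F : PowerSeries (TimeSeries K)) :
    PowerSeries.C (D 1) * constSeries F =
      constSeries F * PowerSeries.C (D 1) + constSeries (pdx F) := by
  ext n : 1
  rw [map_add, PowerSeries.coeff_C_mul, PowerSeries.coeff_mul_C, coeff_constSeries,
    coeff_constSeries, coeff_pdx, D_one_mul_const]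

theorem C_D_neg_mul_C_D (n : ℤ) :
    (PowerSeries.C (D (-n)) : PowerSeries (PDO K)) * PowerSeries.C (D n) = 1 := by
  rw [← map_mul, D_neg_mul_D, map_one]

theorem C_D_mul_C_D_neg (n : ℤ) :
    (PowerSeries.C (D n) : PowerSeries (PDO K)) * PowerSeries.C (D (-n)) = 1 := by
  rw [← map_mul, D_mul_D_neg, map_one]

/-- The coefficients of `f(t + ε [λ⁻¹])` as a power series in `λ⁻¹`. -/
def miwaSeries (ε : ℤ) (f : TimeSeries K) : PowerSeries (TimeSeries K) :=
  PowerSeries.mk fun k => miwaCoeff ε k f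

theorem miwaShift_eq_miwaSeries (ε : ℤ) (f : TimeSeries K) :
    miwaShift ε f = HahnSeries.ofPowerSeries ℤ _ (miwaSeries ε f) := rfl

/-- The coefficients of the wave function as a power series in `λ⁻¹`. -/
def waveSeries (W : PDO K) : PowerSeries (TimeSeries K) :=
  PowerSeries.mk fun i => W.coeff (-(i : ℤ))

theorem wave_eq (W : PDO K) : wave W = HahnSeries.ofPowerSeries ℤ _ (waveSeries W) := rfl

/-! ## The Miwa shift `t ↦ t - [λ⁻¹]` as a gauge transformation -/

/-- `W(t - [z]) (1 - z D) W⁻¹`. -/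
def minusSeries (W : PDO K) : PowerSeries (PDO K) :=
  PowerSeries.mk (miwaCoeffOp (-1) W) * (1 - PowerSeries.X * PowerSeries.C (D 1)) *
    PowerSeries.C W.dressInv

theorem coeff_zero_mul_one_sub (F : PowerSeries (PDO K)) :
    PowerSeries.coeff 0 (F * (1 - PowerSeries.X * PowerSeries.C (D 1))) =
      PowerSeries.coeff 0 F := by
  rw [mul_sub, mul_one, map_sub, ← mul_assoc, PowerSeries.coeff_mul_C,
    PowerSeries.coeff_zero_mul_X, zero_mul, sub_zero]

theorem coeff_succ_mul_one_sub (F : PowerSeries (PDO K)) (k : ℕ) :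
    PowerSeries.coeff (k + 1) (F * (1 - PowerSeries.X * PowerSeries.C (D 1))) =
      PowerSeries.coeff (k + 1) F - PowerSeries.coeff k F * D 1 := by
  rw [mul_sub, mul_one, map_sub, ← mul_assoc, PowerSeries.coeff_mul_C,
    PowerSeries.coeff_succ_mul_X]

/-- The action of `∂/∂tₙ₊₁` on operators `P` that stand for `P ψ`. -/
def waveFlow (K : Type*) [Field K] (n : ℕ) : PDO K →+ PDO K :=
  -(flowHom n.succPNat) - AddMonoidHom.mulRight (D (n + 1 : ℕ))

theorem waveFlow_apply (n : ℕ) (P : PDO K) :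
    waveFlow K n P = -P.flow n.succPNat - P * D (n + 1 : ℕ) := rfl

/-- Telescoping: (1 - zD) ∑_{n ≥ 1} zⁿ Dⁿ = zD, the negative of z ∂/∂z (1 - zD). It expresses
formally that 1 - zD annihilates e^ξ at z = λ⁻¹. -/
theorem isFlowSeries_one_sub :
    IsFlowSeries (waveFlow K)
      fun k => PowerSeries.coeff k
        (1 - PowerSeries.X * PowerSeries.C (D 1) : PowerSeries (PDO K)) := by
  set g := fun k => PowerSeries.coeff k
    (1 - PowerSeries.X * PowerSeries.C (D 1) : PowerSeries (PDO K)) with hg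
  have h0 : g 0 = 1 := by
    have := coeff_zero_mul_one_sub (1 : PowerSeries (PDO K))
    rw [one_mul] at this
    rw [hg]
    simp only [this]
    simp
  have hs : ∀ k, g (k + 1) = PowerSeries.coeff (k + 1) (1 : PowerSeries (PDO K)) -
      PowerSeries.coeff k (1 : PowerSeries (PDO K)) * D 1 := fun k => by
    have := coeff_succ_mul_one_sub (1 : PowerSeries (PDO K)) k
    rwa [one_mul] at this
  have h1 : g 1 = -D 1 := by
    rw [hs 0]
    simp [PowerSeries.coeff_one]
  have h2 : ∀ k, g (k + 2) = 0 := fun k => by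
    rw [hs (k + 1)]
    simp [PowerSeries.coeff_one]
  have hd : ∀ (n : ℕ) (j : ℤ), waveFlow K n (D j) = -D (j + (n + 1 : ℕ)) := fun n j => by
    rw [waveFlow_apply, flow_D, D_mul_D, neg_zero, zero_sub]
  intro k
  cases k with
  | zero =>
    rw [Finset.HasAntidiagonal.antidiagonal_zero, Finset.sum_singleton, h0, h1, ← D_zero, hd]
    simp
  | succ k =>
    rw [Finset.Nat.sum_antidiagonal_succ', Finset.sum_eq_single (k, 0)]
    · simp only [h0, h1, h2, smul_zero, map_neg, hd, zero_add]
      rw [← D_zero, hd]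
      have : (0 : ℤ) + (k + 1 + 1 : ℕ) = 1 + (k + 1 : ℕ) := by push_cast; ring
      rw [this]
      simp
    · rintro ⟨a, b⟩ hp hne
      rw [Finset.HasAntidiagonal.mem_antidiagonal] at hp
      cases b with
      | zero => exact absurd (by rw [← hp]; rfl) hne
      | succ b => simp only [h2, map_zero]
    · intro h
      exact absurd (Finset.HasAntidiagonal.mem_antidiagonal.mpr (add_zero k)) h

/-- `P ↦ -(∂P/∂tₙ₊₁ + P Bₙ₊₁)`. -/
def rightFlow (W : PDO K) (n : ℕ) : PDO K →+ PDO K :=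
  -(flowHom n.succPNat) - AddMonoidHom.mulRight (flowOp W (n + 1))

theorem rightFlow_apply (W : PDO K) (n : ℕ) (P : PDO K) :
    rightFlow W n P = -P.flow n.succPNat - P * flowOp W (n + 1) := rfl

theorem neg_flowHom_apply (n : ℕ+) (P : PDO K) : ((-1 : ℤ) • flowHom n) P = -P.flow n :=
  neg_one_zsmul (P.flow n)

/-- The factor W(t - [z]) flows by -∂/∂tₙ, the factor 1 - zD by right multiplication by -Dⁿ, and the
final W⁻¹ converts this Dⁿ into Bₙ. -/
theorem isFlowSeries_minusSeries [CharZero K] {W : PDO K} (hW : IsKPDressing W) :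
    IsFlowSeries (rightFlow W) fun k => PowerSeries.coeff k (minusSeries W) := by
  have h1 : IsFlowSeries (fun n => (-1 : ℤ) • flowHom n.succPNat)
      fun k => PowerSeries.coeff k (PowerSeries.mk (miwaCoeffOp (-1) W)) := by
    simpa only [PowerSeries.coeff_mk] using isFlowSeries_miwaCoeffOp (-1) W
  have h2 := h1.mul (c := waveFlow K) isFlowSeries_one_sub fun n x y => by
    change waveFlow K n (x * y) = _ * y + x * waveFlow K n y
    rw [waveFlow_apply, waveFlow_apply, neg_flowHom_apply, flow_mul, mul_sub, mul_neg, neg_mul,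
      mul_assoc]
    abel
  have h3 := h2.map (e := rightFlow W) (AddMonoidHom.mulRight W.dressInv) fun n x => by
    simp only [AddMonoidHom.mulRight_apply]
    rw [waveFlow_apply, rightFlow_apply, flow_mul, hW.flow_dressInv, Nat.succPNat_coe, sub_mul,
      mul_sub, neg_mul, mul_assoc, mul_assoc, Nat.succ_eq_add_one]
    abel
  simpa only [minusSeries, PowerSeries.coeff_mul_C, AddMonoidHom.mulRight_apply] using h3

theorem coeff_zero_minusSeries {W : PDO K} (hW : IsKPDressing W) :
    PowerSeries.coeff 0 (minusSeries W) = 1 := by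
  rw [minusSeries, PowerSeries.coeff_mul_C, coeff_zero_mul_one_sub, PowerSeries.coeff_mk,
    miwaCoeffOp_zero, hW.mul_dressInv]

theorem coeff_succ_minusSeries (W : PDO K) (k : ℕ) :
    PowerSeries.coeff (k + 1) (minusSeries W) =
      (miwaCoeffOp (-1) W (k + 1) - miwaCoeffOp (-1) W k * D 1) * W.dressInv := by
  rw [minusSeries, PowerSeries.coeff_mul_C, coeff_succ_mul_one_sub, PowerSeries.coeff_mk,
    PowerSeries.coeff_mk]

theorem rightFlow_isDiff (W : PDO K) (n : ℕ) {P : PDO K} (hP : IsDiff P) :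
    IsDiff (rightFlow W n P) := by
  rw [rightFlow_apply]
  exact (hP.flow _).neg.sub (hP.mul (isDiff_flowOp W _))

/-- The initial term is 1 and the flows preserve differential operators because Bₙ is one. This is
the place where the KP equations, rather than mere dressing, matter. -/
theorem isDiff_minusSeries [CharZero K] {W : PDO K} (hW : IsKPDressing W) (k : ℕ) :
    IsDiff (PowerSeries.coeff k (minusSeries W)) := by
  refine (isFlowSeries_minusSeries hW).mem (H := diffSubgroup K) diffSubgroup_saturated ?_
    (fun n P hP => rightFlow_isDiff W n hP) k
  rw [coeff_zero_minusSeries hW]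
  exact isDiff_one

/-- The coefficients `cₖ` in `W(t - [z]) (1 - z D) W⁻¹ = ∑ cₖ zᵏ - z D`. -/
def minusCoeff (W : PDO K) : PowerSeries (TimeSeries K) :=
  PowerSeries.mk fun k => (PowerSeries.coeff k (minusSeries W)).coeff 0

theorem ordLE_D_one_mul_sub {P : PDO K} {N : ℤ} (h : OrdLE P N) :
    OrdLE (D 1 * P - P * D 1) N := fun n hn => by
  rw [sub_coeff, D_one_mul_coeff, mul_D_coeff, h n hn, map_zero, zero_add, sub_self]

/-- A differential operator of order at most 0 is a function. From z² on, both summands have order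
at most 0; at z¹, adding D leaves a commutator [D, W], in which the leading terms cancel. -/
theorem minusSeries_eq [CharZero K] {W : PDO K} (hW : IsKPDressing W) :
    minusSeries W = constSeries (minusCoeff W) - PowerSeries.X * PowerSeries.C (D 1) := by
  have hU := ordLE_dressInv W
  have hsucc := ordLE_miwaCoeffOp_succ (-1) hW.ordLE hW.coeff_zero
  ext k : 1
  rw [map_sub, coeff_constSeries, minusCoeff, PowerSeries.coeff_mk, PowerSeries.coeff_mul_C]
  cases k with
  | zero =>
    rw [coeff_zero_minusSeries hW, PowerSeries.coeff_zero_X, zero_mul, sub_zero, one_coeff,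
      if_pos rfl, const_one]
  | succ k =>
    rw [PowerSeries.coeff_X]
    have hd := isDiff_minusSeries hW (k + 1)
    cases k with
    | zero =>
      rw [if_pos rfl, one_mul]
      have e : PowerSeries.coeff (0 + 1) (minusSeries W) + D 1 =
          miwaCoeffOp (-1) W (0 + 1) * W.dressInv + (D 1 * W - W * D 1) * W.dressInv := by
        rw [coeff_succ_minusSeries, miwaCoeffOp_zero, sub_mul, sub_mul, mul_assoc (D 1),
          hW.mul_dressInv, mul_one]
        abel
      have ho : OrdLE (PowerSeries.coeff (0 + 1) (minusSeries W) + D 1) 0 := by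
        rw [e]
        exact (((hsucc 0).mul hU).mono (by norm_num)).add
          (((ordLE_D_one_mul_sub hW.ordLE).mul hU).mono (by norm_num))
      have h1 := (hd.add (isDiff_D 1)).eq_const ho
      rw [Nat.cast_one, add_coeff, D_coeff, if_neg (by norm_num), add_zero] at h1
      rw [← h1, add_sub_cancel_right]
    | succ k =>
      rw [if_neg (by omega), zero_mul, sub_zero]
      refine hd.eq_const ?_
      rw [coeff_succ_minusSeries]
      have h1 : OrdLE (miwaCoeffOp (-1) W (k + 1 + 1)) 0 := (hsucc (k + 1)).mono (by norm_num)
      exact (h1.sub ((hsucc k).mul (ordLE_D 1))).mul hU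

theorem constSeries_mul_eq_succ [CharZero K] {W : PDO K} (hW : IsKPDressing W) (k : ℕ) :
    const (PowerSeries.coeff (k + 1) (minusCoeff W)) * W =
      miwaCoeffOp (-1) W (k + 1) - miwaCoeffOp (-1) W k * D 1 +
        if k = 0 then D 1 * W else 0 := by
  have h1 := congrArg (PowerSeries.coeff (k + 1)) (minusSeries_eq hW)
  rw [coeff_succ_minusSeries, map_sub, coeff_constSeries, PowerSeries.coeff_mul_C,
    PowerSeries.coeff_X] at h1
  have h2 := congrArg (· * W) h1
  simp only [mul_assoc, hW.dressInv_mul, mul_one] at h2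
  rw [h2, sub_mul]
  simp only [Nat.add_eq_right]
  split_ifs <;> simp

/-- The gauge operator annihilates the wave function. -/
theorem minusCoeff_mul_waveSeries [CharZero K] {W : PDO K} (hW : IsKPDressing W) :
    minusCoeff W * waveSeries W = waveSeries W + PowerSeries.X * pdx (waveSeries W) := by
  ext n : 1
  have hc0 : PowerSeries.coeff 0 (minusCoeff W) = 1 := by
    rw [minusCoeff, PowerSeries.coeff_mk, coeff_zero_minusSeries hW, one_coeff, if_pos rfl]
  have hX : PowerSeries.coeff n (waveSeries W + PowerSeries.X * pdx (waveSeries W)) =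
      W.coeff (-(n : ℤ)) + dx (W.coeff (1 - n)) := by
    rw [map_add, waveSeries, PowerSeries.coeff_mk]
    congr 1
    cases n with
    | zero => simp [hW.coeff_pos 1 one_pos]
    | succ n =>
      rw [PowerSeries.coeff_succ_X_mul, coeff_pdx, PowerSeries.coeff_mk]
      congr 2
      push_cast
      ring
  have hterm : ∀ k : ℕ, PowerSeries.coeff (k + 1) (minusCoeff W) * W.coeff ((k : ℤ) + 1 - n) =
      ((miwaCoeffOp (-1) W (k + 1)).coeff (((k + 1 : ℕ) : ℤ) - n) -
        (miwaCoeffOp (-1) W k).coeff ((k : ℤ) - n)) +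
        if k = 0 then dx (W.coeff (1 - n)) + W.coeff (-(n : ℤ)) else 0 := fun k => by
    have h1 := congrArg (fun P : PDO K => P.coeff ((k : ℤ) + 1 - n)) (constSeries_mul_eq_succ hW k)
    simp only [const_mul_coeff, add_coeff, sub_coeff, mul_D_coeff] at h1
    rw [h1, show (k : ℤ) + 1 - n - 1 = k - n by ring, Nat.cast_succ]
    congr 1
    split_ifs with hk
    · subst hk
      rw [D_one_mul_coeff]
      congr 3
      push_cast
      ring
    · rfl
  -- The additional term k = n + 1 is zero, as W has no D¹ coefficient; it is included so that the
  -- telescoping sum below ends at a vanishing term.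
  have hsum : PowerSeries.coeff n (minusCoeff W * waveSeries W) =
      ∑ k ∈ Finset.range (n + 2), PowerSeries.coeff k (minusCoeff W) * W.coeff ((k : ℤ) - n) := by
    rw [PowerSeries.coeff_mul, Finset.Nat.sum_antidiagonal_eq_sum_range_succ_mk,
      Finset.sum_range_succ _ (n + 1), hW.coeff_pos _ (by push_cast; omega), mul_zero, add_zero]
    refine Finset.sum_congr rfl fun k hk => ?_
    rw [Finset.mem_range] at hk
    rw [waveSeries, PowerSeries.coeff_mk]
    congr 2
    omega
  -- Reading the k-th equation at D^{k-n} amounts to setting z = λ⁻¹, where W(t - [z]) (1 - zD)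
  -- telescopes to zero.
  have hsub := Finset.sum_range_sub (fun k => (miwaCoeffOp (-1) W k).coeff ((k : ℤ) - n)) (n + 1)
  simp only [← Nat.cast_succ] at hterm
  rw [hsum, hX, Finset.sum_range_succ', hc0, one_mul, Finset.sum_congr rfl fun k _ => hterm k]
  rw [Finset.sum_add_distrib,
    hsub, miwaCoeffOp_coeff, hW.coeff_pos _ (by push_cast; omega), miwaCoeff_map_zero,
    Finset.sum_ite_eq' (Finset.range (n + 1)) 0, miwaCoeffOp_zero]
  simp
  ring

theorem isFlowSeries_constSeries_miwaSeries [CharZero K] (ε : ℤ) (f : TimeSeries K) :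
    IsFlowSeries (fun n => ε • flowHom n.succPNat)
      fun k => PowerSeries.coeff k (constSeries (miwaSeries ε f)) := by
  simpa only [coeff_constSeries, miwaSeries, PowerSeries.coeff_mk] using
    isFlowSeries_const_miwaCoeff ε f

theorem C_D_neg_one_mul_constSeries_mul_minusSeries [CharZero K] {W : PDO K}
    (hW : IsKPDressing W) (F : PowerSeries (TimeSeries K)) :
    PowerSeries.C (D (-1)) * constSeries F * minusSeries W =
      PowerSeries.C (D (-1)) * constSeries (F * minusCoeff W + PowerSeries.X * pdx F) -
        PowerSeries.X * constSeries F := by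
  have h1 : constSeries F * PowerSeries.C (D 1) =
      PowerSeries.C (D 1) * constSeries F - constSeries (pdx F) := by
    rw [C_D_one_mul_constSeries, add_sub_cancel_right]
  have h2 : constSeries F * (PowerSeries.X * PowerSeries.C (D 1)) =
      PowerSeries.X * (PowerSeries.C (D 1) * constSeries F - constSeries (pdx F)) := by
    rw [← h1, ← mul_assoc, ← mul_assoc, PowerSeries.X_mul]
  have h3 : PowerSeries.C (D (-1)) * (PowerSeries.X * (PowerSeries.C (D 1) * constSeries F)) =
      PowerSeries.X * constSeries F := by
    rw [← mul_assoc, ← PowerSeries.X_mul, mul_assoc, ← mul_assoc (PowerSeries.C _),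
      C_D_neg_mul_C_D, one_mul]
  rw [minusSeries_eq hW, mul_assoc, mul_sub, h2, mul_sub, mul_sub, mul_sub, h3, map_add, map_mul,
    map_mul, constSeries_X, mul_add]
  abel

/-- The action of the Miwa shift on adjoint eigenfunctions. -/
theorem IsAdjointEigenfunction.miwaSeries_mul [CharZero K] {W : PDO K} (hW : IsKPDressing W)
    {Ψ : TimeSeries K} (hΨ : IsAdjointEigenfunction W Ψ) :
    miwaSeries (-1) Ψ * minusCoeff W + PowerSeries.X * pdx (miwaSeries (-1) Ψ) =
      PowerSeries.C Ψ := by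
  set F := miwaSeries (-1) Ψ * minusCoeff W + PowerSeries.X * pdx (miwaSeries (-1) Ψ) with hF
  have hF0 : PowerSeries.coeff 0 F = Ψ := by
    rw [hF, map_add, PowerSeries.coeff_zero_X_mul, add_zero, PowerSeries.coeff_mul,
      Finset.HasAntidiagonal.antidiagonal_zero, Finset.sum_singleton, minusCoeff, miwaSeries,
      PowerSeries.coeff_mk, PowerSeries.coeff_mk, coeff_zero_minusSeries hW,
      miwaCoeff_zero, one_coeff, if_pos rfl, mul_one]
  have h1 := (isFlowSeries_constSeries_miwaSeries (-1) Ψ).map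
    (e := fun n => (-1 : ℤ) • flowHom n.succPNat) (AddMonoidHom.mulLeft (D (-1))) fun n x => by
      simp only [neg_flowHom_apply, AddMonoidHom.coe_mulLeft, flow_mul, flow_D, zero_mul,
        zero_add, mul_neg]
  simp only [AddMonoidHom.coe_mulLeft, ← PowerSeries.coeff_C_mul] at h1
  have h2 := h1.mul (c := rightFlow W) (isFlowSeries_minusSeries hW) fun n x y => by
    rw [rightFlow_apply, rightFlow_apply, neg_flowHom_apply, flow_mul, mul_sub, mul_neg, neg_mul,
      mul_assoc]
    abel
  -- The first flow of D⁻¹ Ψ is differential by the adjoint eigenfunction equation. Hence all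
  -- coefficients from z¹ on are differential, and the vanishing of their residues is the claim.
  have h3 := h2.mem_succ (H := diffSubgroup K) diffSubgroup_saturated ?_
    fun n P hP => rightFlow_isDiff W n hP
  · ext k : 1
    cases k with
    | zero => rw [hF0, PowerSeries.coeff_zero_C]
    | succ k =>
      rw [PowerSeries.coeff_C, if_neg k.succ_ne_zero]
      have h4 := h3 k (-1) (by norm_num)
      rwa [C_D_neg_one_mul_constSeries_mul_minusSeries hW, ← hF, map_sub, PowerSeries.coeff_C_mul,
        PowerSeries.coeff_succ_X_mul, coeff_constSeries, coeff_constSeries, sub_coeff,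
        D_neg_one_mul_const_res, const_coeff, if_neg (by norm_num), sub_zero] at h4
  · intro n
    have h5 : PowerSeries.coeff 0 (PowerSeries.C (D (-1)) * constSeries (miwaSeries (-1) Ψ) *
        minusSeries W) = D (-1) * const Ψ := by
      rw [C_D_neg_one_mul_constSeries_mul_minusSeries hW, ← hF, map_sub, PowerSeries.coeff_C_mul,
        PowerSeries.coeff_zero_X_mul, coeff_constSeries, hF0, sub_zero]
    have h6 := (hΨ.isDiff n.succPNat).neg
    rw [h5, rightFlow_apply, flow_mul, flow_D, zero_mul, zero_add, flow_const]
    rw [neg_add_rev, ← sub_eq_add_neg] at h6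
    exact h6

/-- `D⁻¹ Ψ` acts on the wave function as multiplication by `λ⁻¹ Ψ(t - [λ⁻¹])`. -/
theorem IsAdjointEigenfunction.lsym_eq [CharZero K] {W : PDO K} (hW : IsKPDressing W)
    {Ψ : TimeSeries K} (hΨ : IsAdjointEigenfunction W Ψ) :
    lsym (D (-1) * const Ψ * W) =
      HahnSeries.single 1 1 * miwaShift (-1) Ψ * wave W := by
  have h1 := hΨ.miwaSeries_mul hW
  have h2 := minusCoeff_mul_waveSeries hW
  set ψ := miwaSeries (-1) Ψ
  set w := waveSeries W with hw
  have h3 : HahnSeries.single 1 1 * miwaShift (-1) Ψ * wave W =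
      HahnSeries.ofPowerSeries ℤ _ (PowerSeries.X * (ψ * w)) := by
    rw [map_mul, map_mul, HahnSeries.ofPowerSeries_X, mul_assoc]
    rfl
  rw [h3]
  -- Applying D removes D⁻¹ on the left; what remains is Ψ w, which the two first-order equations in
  -- z identify.
  apply waveDx_injective
  rw [← lsym_D_one_mul, waveDx_ofPowerSeries_X_mul, ← mul_assoc, ← mul_assoc, D_mul_D_neg, one_mul,
    lsym_const_mul, lsym_eq_wave hW.ordLE, wave_eq, ← HahnSeries.ofPowerSeries_C, ← map_mul, ← h1,
    pdx_mul, ← hw]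
  congr 1
  linear_combination (ψ * h2)

/-! ## Miwa shifts of squared eigenfunction potentials -/

/-- `∑ₙ Bₙ zⁿ`. -/
def flowOpSeries (W : PDO K) : PowerSeries (PDO K) := PowerSeries.mk fun n => flowOp W n

theorem ordLE_flow_minusSeries [CharZero K] {W : PDO K} (hW : IsKPDressing W) (n : ℕ+) (k : ℕ) :
    OrdLE ((PowerSeries.coeff k (minusSeries W)).flow n) 0 := by
  have h : (PowerSeries.coeff k (PowerSeries.X : PowerSeries (PDO K)) * D 1).flow n = 0 := by
    rw [PowerSeries.coeff_X]
    split_ifs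
    · rw [one_mul, flow_D]
    · rw [zero_mul]
      exact map_zero (flowHom n)
  rw [minusSeries_eq hW, map_sub, coeff_constSeries, PowerSeries.coeff_mul_C, flow_sub, h, sub_zero]
  exact (ordLE_const _).flow n

theorem ordLE_minusSeries [CharZero K] {W : PDO K} (hW : IsKPDressing W) {k : ℕ} (hk : k ≠ 1) :
    OrdLE (PowerSeries.coeff k (minusSeries W)) 0 := by
  rw [minusSeries_eq hW, map_sub, coeff_constSeries, PowerSeries.coeff_mul_C, PowerSeries.coeff_X,
    if_neg hk, zero_mul, sub_zero]
  exact ordLE_const _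

/-- The recursion for G = `minusSeries W` rewrites each coefficient of G ∑ Bₙ zⁿ in terms of G
itself and its time derivatives. The only coefficient of G of positive order is that of z¹; there
the factor k is zero, and its derivative has order at most 0 since -D is constant. -/
theorem ordLE_minusSeries_mul_flowOpSeries [CharZero K] {W : PDO K} (hW : IsKPDressing W) (k : ℕ) :
    OrdLE (PowerSeries.coeff k (minusSeries W * flowOpSeries W)) 0 := by
  rw [PowerSeries.coeff_mul]
  cases k with
  | zero =>
    rw [Finset.HasAntidiagonal.antidiagonal_zero, Finset.sum_singleton, coeff_zero_minusSeries hW,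
      flowOpSeries, PowerSeries.coeff_mk, hW.flowOp_zero, one_mul]
    exact ordLE_one
  | succ k =>
    have h1 : (k + 1) • PowerSeries.coeff (k + 1) (minusSeries W) =
        ∑ p ∈ antidiagonal k, rightFlow W p.1 (PowerSeries.coeff p.2 (minusSeries W)) :=
      isFlowSeries_minusSeries hW k
    rw [← Finset.Nat.sum_antidiagonal_swap] at h1
    simp only [rightFlow_apply, Prod.fst_swap, Prod.snd_swap, Finset.sum_sub_distrib] at h1
    rw [Finset.Nat.sum_antidiagonal_succ']
    simp only [flowOpSeries, PowerSeries.coeff_mk, hW.flowOp_zero, mul_one]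
    have h2 : PowerSeries.coeff (k + 1) (minusSeries W) + ∑ p ∈ antidiagonal k,
        PowerSeries.coeff p.1 (minusSeries W) * flowOp W (p.2 + 1) =
        -(k • PowerSeries.coeff (k + 1) (minusSeries W)) +
          ∑ p ∈ antidiagonal k, -(PowerSeries.coeff p.1 (minusSeries W)).flow p.2.succPNat := by
      rw [← sub_eq_iff_eq_add.mpr (sub_eq_iff_eq_add'.mp h1.symm).symm.symm]
      rw [add_smul, one_smul]
      abel
    rw [h2]
    refine OrdLE.add (OrdLE.neg ?_) (ordLE_sum fun p _ => (ordLE_flow_minusSeries hW _ _).neg)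
    cases k with
    | zero =>
      rw [zero_smul]
      exact ordLE_zero 0
    | succ k => exact (ordSubgroup K 0).nsmul_mem (ordLE_minusSeries hW (by omega)) _

theorem res_mul_const_mul_D_neg_one (P : PDO K) (f : TimeSeries K) :
    (P * const f * D (-1)).coeff (-1) = (P * const f).coeff 0 := by
  rw [mul_D_coeff, sub_self]

/-- `∂S/∂tₙ₊₁ = ∑ Ψᵢ ∂Φ/∂tⱼ` over `i + j = n`, where `Ψᵢ` are the coefficients of `Ψ(t - [z])` and
`∂Φ/∂t₀ = Φ`. -/
theorem IsSEP.dt_succ_eq [CharZero K] {W : PDO K} (hW : IsKPDressing W) {Φ Ψ S : TimeSeries K}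
    (hΨ : IsAdjointEigenfunction W Ψ) (hS : IsSEP W Φ Ψ S) (k : ℕ) :
    dt k.succPNat S = ∑ p ∈ antidiagonal k,
      miwaCoeff (-1) p.1 Ψ * (flowOp W p.2 * const Φ).coeff 0 := by
  -- The identity D⁻¹ Ψ = D⁻¹ Ψ(t - [z]) G(z) + z Ψ(t - [z]). Multiplied by ∑ Bₙ zⁿ and by Φ D⁻¹,
  -- its first term has order at most -2, so only the second contributes to the residue.
  have h1 : PowerSeries.C (D (-1) * const Ψ) =
      PowerSeries.C (D (-1)) * constSeries (miwaSeries (-1) Ψ) * minusSeries W +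
        PowerSeries.X * constSeries (miwaSeries (-1) Ψ) := by
    rw [C_D_neg_one_mul_constSeries_mul_minusSeries hW, hΨ.miwaSeries_mul hW, sub_add_cancel,
      constSeries_C, map_mul]
  have h2 := congrArg (fun F => PowerSeries.coeff (k + 1)
    (F * flowOpSeries W * PowerSeries.C (const Φ * D (-1)))) h1
  simp only [add_mul, map_add, PowerSeries.coeff_mul_C, PowerSeries.coeff_C_mul] at h2
  have h3 := congrArg (fun P : PDO K => P.coeff (-1)) h2
  simp only [add_coeff] at h3
  rw [hS k.succPNat, PDO.res, Nat.succPNat_coe]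
  have h4 : (D (-1) * const Ψ * PowerSeries.coeff (k + 1) (flowOpSeries W) *
      (const Φ * D (-1))).coeff (-1) =
      (D (-1) * const Ψ * flowOp W (k + 1) * const Φ * D (-1)).coeff (-1) := by
    rw [flowOpSeries, PowerSeries.coeff_mk, ← mul_assoc]
  have h5 : (PowerSeries.coeff (k + 1) (PowerSeries.C (D (-1)) *
      constSeries (miwaSeries (-1) Ψ) * minusSeries W * flowOpSeries W) *
        (const Φ * D (-1))).coeff (-1) = 0 := by
    rw [mul_assoc _ (minusSeries W), mul_assoc, PowerSeries.coeff_C_mul]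
    have h6 : OrdLE (PowerSeries.coeff (k + 1)
        (constSeries (miwaSeries (-1) Ψ) * (minusSeries W * flowOpSeries W))) 0 := by
      rw [PowerSeries.coeff_mul]
      refine ordLE_sum fun p _ => ?_
      rw [coeff_constSeries]
      exact (ordLE_const _).mul (ordLE_minusSeries_mul_flowOpSeries hW _)
    exact (((ordLE_D (-1)).mul h6).mul ((ordLE_const Φ).mul (ordLE_D (-1)))) (-1) (by norm_num)
  rw [h4, h5, zero_add, mul_assoc PowerSeries.X, PowerSeries.coeff_succ_X_mul,
    PowerSeries.coeff_mul, Finset.sum_mul, sum_coeff] at h3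
  rw [Nat.succ_eq_add_one, h3]
  refine Finset.sum_congr rfl fun p _ => ?_
  rw [coeff_constSeries, miwaSeries, PowerSeries.coeff_mk, flowOpSeries, PowerSeries.coeff_mk,
    mul_assoc, const_mul_coeff, ← mul_assoc, res_mul_const_mul_D_neg_one]

/-- `S(t - [λ⁻¹]) - S(t) = -λ⁻¹ Φ(t) Ψ(t - [λ⁻¹])`. -/
theorem IsSEP.miwaCoeff_succ [CharZero K] {W : PDO K} (hW : IsKPDressing W) {Φ Ψ S : TimeSeries K}
    (hΦ : IsEigenfunction W Φ) (hΨ : IsAdjointEigenfunction W Ψ) (hS : IsSEP W Φ Ψ S) (k : ℕ) :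
    miwaCoeff (-1) (k + 1) S = -(Φ * miwaCoeff (-1) k Ψ) := by
  set ψ := fun k => miwaCoeff (-1) k Ψ with hψ
  have hflow := isFlowSeries_miwaCoeff (-1) Ψ
  have hd : ∀ (n : ℕ) (f : TimeSeries K),
      ((-1 : ℤ) • (dt n.succPNat).toLinearMap.toAddMonoidHom) f = -dt n.succPNat f := fun n f =>
    neg_one_zsmul (dt n.succPNat f)
  -- H is the candidate series S - z Φ(t) Ψ(t - [z]); it is shown to satisfy the recursion of S(t -
  -- [z]), and both start at S.
  obtain ⟨H, hH0, hHs⟩ : ∃ H : ℕ → TimeSeries K, H 0 = S ∧ ∀ k, H (k + 1) = -(Φ * ψ k) :=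
    ⟨fun k => Nat.casesOn k S fun j => -(Φ * ψ j), rfl, fun _ => rfl⟩
  have hH : IsFlowSeries
      (fun n => (-1 : ℤ) • (dt (K := K) n.succPNat).toLinearMap.toAddMonoidHom) H := fun k => by
    have hSk : dt k.succPNat S = ψ k * Φ + ∑ p ∈ antidiagonal k,
        if p.2 = 0 then 0 else ψ p.1 * (flowOp W p.2 * const Φ).coeff 0 := by
      rw [hS.dt_succ_eq hW hΨ]
      have h0 : ψ k * Φ = ∑ p ∈ antidiagonal k, if p.2 = 0 then ψ p.1 * Φ else 0 := by
        rw [Finset.sum_eq_single (k, 0)]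
        · rw [if_pos rfl]
        · rintro ⟨a, b⟩ hp hne
          rw [Finset.HasAntidiagonal.mem_antidiagonal] at hp
          refine if_neg fun h => hne ?_
          simp only at h hp
          rw [h, ← hp, h, add_zero]
        · intro h
          exact absurd (Finset.HasAntidiagonal.mem_antidiagonal.mpr (add_zero k)) h
      rw [h0, ← Finset.sum_add_distrib]
      refine Finset.sum_congr rfl fun p _ => ?_
      split_ifs with h
      · rw [h, hW.flowOp_zero, one_mul, const_coeff, if_pos rfl, add_zero]
      · rw [zero_add]
    simp only [hd, hHs]
    cases k with
    | zero =>
      simp only [hH0, Finset.HasAntidiagonal.antidiagonal_zero, Finset.sum_singleton] at hSk ⊢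
      rw [hSk]
      simp [mul_comm]
    | succ k =>
      rw [Finset.Nat.sum_antidiagonal_succ']
      rw [Finset.Nat.sum_antidiagonal_succ'] at hSk
      simp only [Nat.add_eq_zero_iff, one_ne_zero, and_false, if_false, if_true, zero_add] at hSk
      have hk : (k + 1) • ψ (k + 1) = ∑ p ∈ antidiagonal k, -dt p.1.succPNat (ψ p.2) := by
        simpa only [hd] using hflow k
      have hΦn : ∀ p : ℕ × ℕ, (flowOp W (p.2 + 1) * const Φ).coeff 0 = dt p.2.succPNat Φ :=
        fun p => (isEigenfunction_iff.mp hΦ p.2.succPNat).symm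
      have hswap : ∑ p ∈ antidiagonal k, ψ p.2 * dt p.1.succPNat Φ =
          ∑ p ∈ antidiagonal k, ψ p.1 * dt p.2.succPNat Φ :=
        Finset.Nat.sum_antidiagonal_swap (f := fun p : ℕ × ℕ => ψ p.1 * dt p.2.succPNat Φ)
      simp only [hΦn] at hSk
      simp only [hH0, hHs, hSk, map_neg, neg_neg, Derivation.leibniz, smul_eq_mul, Finset.sum_add_distrib,
        ← Finset.mul_sum]
      rw [hswap]
      rw [Finset.sum_neg_distrib] at hk
      -- The sum of derivatives of Ψ(t - [z]) is traded for k + 1 copies of its next coefficient;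
      -- the one remaining copy comes from the B₀ = 1 term of ∂S/∂tₙ.
      rw [neg_eq_iff_eq_neg.mp hk.symm, add_smul, one_smul, smul_neg, nsmul_eq_mul, nsmul_eq_mul]
      ring
  rw [← hHs]
  exact (isFlowSeries_miwaCoeff (-1) S).unique hH ((miwaCoeff_zero (-1) S).trans hH0.symm) (k + 1)

theorem IsSEP.shiftDiff_eq [CharZero K] {W : PDO K} (hW : IsKPDressing W) {Φ Ψ S : TimeSeries K}
    (hΦ : IsEigenfunction W Φ) (hΨ : IsAdjointEigenfunction W Ψ) (hS : IsSEP W Φ Ψ S) :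
    shiftDiff S = -(HahnSeries.C Φ * (HahnSeries.single 1 1 * miwaShift (-1) Ψ)) := by
  rw [shiftDiff, miwaShift_eq_miwaSeries, miwaShift_eq_miwaSeries, ← HahnSeries.ofPowerSeries_X,
    ← HahnSeries.ofPowerSeries_C, ← HahnSeries.ofPowerSeries_C, ← map_mul, ← map_mul, ← map_sub,
    ← map_neg]
  congr 1
  ext k : 1
  rw [map_sub, map_neg, PowerSeries.coeff_C_mul, miwaSeries, PowerSeries.coeff_mk]
  cases k with
  | zero =>
    rw [miwaCoeff_zero, PowerSeries.coeff_zero_C, sub_self, PowerSeries.coeff_zero_X_mul, mul_zero,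
      neg_zero]
  | succ k =>
    rw [PowerSeries.coeff_C, if_neg k.succ_ne_zero, sub_zero, PowerSeries.coeff_succ_X_mul,
      miwaSeries, PowerSeries.coeff_mk, hS.miwaCoeff_succ hW hΦ hΨ]

theorem IsSEP.shiftDiff_mul_wave [CharZero K] {W : PDO K} (hW : IsKPDressing W)
    {Φ Ψ S : TimeSeries K} (hΦ : IsEigenfunction W Φ) (hΨ : IsAdjointEigenfunction W Ψ)
    (hS : IsSEP W Φ Ψ S) :
    shiftDiff S * wave W =
      -(lsym (const Φ * D (-1) * const Ψ * W) : LaurentSeries (TimeSeries K)) := by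
  rw [hS.shiftDiff_eq hW hΦ hΨ, mul_assoc (const Φ * D (-1)), mul_assoc, lsym_const_mul,
    ← mul_assoc (D (-1)), hΨ.lsym_eq hW]
  ring

/-! ## The Miwa shift `t ↦ t + [λ⁻¹]` as a gauge transformation -/

/-- `W (1 - z D) W⁻¹(t + [z])`. -/
def plusSeries (W : PDO K) : PowerSeries (PDO K) :=
  PowerSeries.C W * ((1 - PowerSeries.X * PowerSeries.C (D 1)) *
    PowerSeries.mk (miwaCoeffOp 1 W.dressInv))

theorem one_sub_mul_eq (F : PowerSeries (PDO K)) :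
    (1 - PowerSeries.X * PowerSeries.C (D 1)) * F = F - PowerSeries.X * (PowerSeries.C (D 1) * F) := by
  rw [sub_mul, one_mul, mul_assoc]

/-- `P ↦ ∂P/∂tₙ₊₁ - Dⁿ⁺¹ P`. -/
def adjointWaveFlow (K : Type*) [Field K] (n : ℕ) : PDO K →+ PDO K :=
  flowHom n.succPNat - AddMonoidHom.mulLeft (D (n + 1 : ℕ))

/-- `P ↦ ∂P/∂tₙ₊₁ - Bₙ₊₁ P`. -/
def leftFlow (W : PDO K) (n : ℕ) : PDO K →+ PDO K :=
  flowHom n.succPNat - AddMonoidHom.mulLeft (flowOp W (n + 1))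

theorem adjointWaveFlow_apply (n : ℕ) (P : PDO K) :
    adjointWaveFlow K n P = P.flow n.succPNat - D (n + 1 : ℕ) * P := rfl

theorem leftFlow_apply (W : PDO K) (n : ℕ) (P : PDO K) :
    leftFlow W n P = P.flow n.succPNat - flowOp W (n + 1) * P := rfl

theorem one_zsmul_flowHom_apply (n : ℕ+) (P : PDO K) : ((1 : ℤ) • flowHom n) P = P.flow n :=
  one_zsmul (P.flow n)

/-- The coefficients of 1 - zD commute with powers of D and do not depend on t, so the right-handed
recursion is also the left-handed one. -/
theorem isFlowSeries_one_sub_left :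
    IsFlowSeries (adjointWaveFlow K) fun k => PowerSeries.coeff k
      (1 - PowerSeries.X * PowerSeries.C (D 1) : PowerSeries (PDO K)) := fun k => by
  rw [isFlowSeries_one_sub k]
  refine Finset.sum_congr rfl fun p _ => ?_
  rw [waveFlow_apply, adjointWaveFlow_apply]
  have h : ∃ a b : ℤ, PowerSeries.coeff p.2
      (1 - PowerSeries.X * PowerSeries.C (D 1) : PowerSeries (PDO K)) = a • 1 - b • D 1 := by
    rw [map_sub, PowerSeries.coeff_mul_C, PowerSeries.coeff_one, PowerSeries.coeff_X]
    refine ⟨if p.2 = 0 then 1 else 0, if p.2 = 1 then 1 else 0, ?_⟩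
    split_ifs <;> simp
  obtain ⟨a, b, hab⟩ := h
  have hf : (a • (1 : PDO K) - b • D 1).flow p.1.succPNat = 0 := by
    rw [flow_sub]
    change flowHom _ (a • 1) - flowHom _ (b • D 1) = 0
    rw [map_zsmul, map_zsmul]
    change a • flow _ 1 - b • flow _ (D 1) = 0
    rw [flow_one, flow_D, smul_zero, smul_zero, sub_zero]
  simp only [hab]
  rw [hf, neg_zero, sub_mul, mul_sub, smul_mul_assoc, smul_mul_assoc, mul_smul_comm,
    mul_smul_comm, one_mul, mul_one, D_mul_D, D_mul_D, add_comm (1 : ℤ)]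

theorem isFlowSeries_plusSeries [CharZero K] {W : PDO K} (hW : IsKPDressing W) :
    IsFlowSeries (leftFlow W) fun k => PowerSeries.coeff k (plusSeries W) := by
  have h1 : IsFlowSeries (fun n => (1 : ℤ) • flowHom n.succPNat)
      fun k => PowerSeries.coeff k (PowerSeries.mk (miwaCoeffOp 1 W.dressInv)) := by
    simpa only [PowerSeries.coeff_mk] using isFlowSeries_miwaCoeffOp 1 W.dressInv
  have h2 := isFlowSeries_one_sub_left.mul (c := adjointWaveFlow K) h1 fun n x y => by
    rw [adjointWaveFlow_apply, adjointWaveFlow_apply, one_zsmul_flowHom_apply, flow_mul, sub_mul,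
      mul_assoc]
    abel
  have h3 := h2.map (e := leftFlow W) (AddMonoidHom.mulLeft W) fun n x => by
    simp only [AddMonoidHom.coe_mulLeft]
    rw [adjointWaveFlow_apply, leftFlow_apply, flow_mul, hW.flow_eq, Nat.succPNat_coe, sub_mul,
      mul_sub, mul_assoc, mul_assoc, Nat.succ_eq_add_one]
    abel
  simpa only [plusSeries, PowerSeries.coeff_C_mul, AddMonoidHom.coe_mulLeft] using h3

theorem coeff_zero_plusSeries {W : PDO K} (hW : IsKPDressing W) :
    PowerSeries.coeff 0 (plusSeries W) = 1 := by
  rw [plusSeries, PowerSeries.coeff_C_mul, one_sub_mul_eq, map_sub, PowerSeries.coeff_zero_X_mul,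
    sub_zero, PowerSeries.coeff_mk, miwaCoeffOp_zero, hW.mul_dressInv]

theorem coeff_succ_plusSeries (W : PDO K) (k : ℕ) :
    PowerSeries.coeff (k + 1) (plusSeries W) =
      W * (miwaCoeffOp 1 W.dressInv (k + 1) - D 1 * miwaCoeffOp 1 W.dressInv k) := by
  rw [plusSeries, PowerSeries.coeff_C_mul, one_sub_mul_eq, map_sub, PowerSeries.coeff_succ_X_mul,
    PowerSeries.coeff_C_mul, PowerSeries.coeff_mk, PowerSeries.coeff_mk]

theorem leftFlow_isDiff (W : PDO K) (n : ℕ) {P : PDO K} (hP : IsDiff P) :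
    IsDiff (leftFlow W n P) := by
  rw [leftFlow_apply]
  exact (hP.flow _).sub ((isDiff_flowOp W _).mul hP)

theorem isDiff_plusSeries [CharZero K] {W : PDO K} (hW : IsKPDressing W) (k : ℕ) :
    IsDiff (PowerSeries.coeff k (plusSeries W)) := by
  refine (isFlowSeries_plusSeries hW).mem (H := diffSubgroup K) diffSubgroup_saturated ?_
    (fun n P hP => leftFlow_isDiff W n hP) k
  rw [coeff_zero_plusSeries hW]
  exact isDiff_one

/-- The coefficients `cₖ` in `W (1 - z D) W⁻¹(t + [z]) = ∑ cₖ zᵏ - z D`. -/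
def plusCoeff (W : PDO K) : PowerSeries (TimeSeries K) :=
  PowerSeries.mk fun k => (PowerSeries.coeff k (plusSeries W)).coeff 0

theorem plusSeries_eq [CharZero K] {W : PDO K} (hW : IsKPDressing W) :
    plusSeries W = constSeries (plusCoeff W) - PowerSeries.X * PowerSeries.C (D 1) := by
  have hsucc := ordLE_miwaCoeffOp_succ 1 (ordLE_dressInv W) hW.dressInv_coeff_zero
  ext k : 1
  rw [map_sub, coeff_constSeries, plusCoeff, PowerSeries.coeff_mk, PowerSeries.coeff_mul_C]
  cases k with
  | zero =>
    rw [coeff_zero_plusSeries hW, PowerSeries.coeff_zero_X, zero_mul, sub_zero, one_coeff,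
      if_pos rfl, const_one]
  | succ k =>
    rw [PowerSeries.coeff_X]
    have hd := isDiff_plusSeries hW (k + 1)
    cases k with
    | zero =>
      rw [if_pos rfl, one_mul]
      have e : PowerSeries.coeff (0 + 1) (plusSeries W) + D 1 =
          W * miwaCoeffOp 1 W.dressInv (0 + 1) + (D 1 * W - W * D 1) * W.dressInv := by
        rw [coeff_succ_plusSeries, miwaCoeffOp_zero, mul_sub, sub_mul, mul_assoc (D 1),
          hW.mul_dressInv, mul_one, mul_assoc]
        abel
      have ho : OrdLE (PowerSeries.coeff (0 + 1) (plusSeries W) + D 1) 0 := by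
        rw [e]
        exact ((hW.ordLE.mul (hsucc 0)).mono (by norm_num)).add
          (((ordLE_D_one_mul_sub hW.ordLE).mul (ordLE_dressInv W)).mono (by norm_num))
      have h1 := (hd.add (isDiff_D 1)).eq_const ho
      rw [Nat.cast_one, add_coeff, D_coeff, if_neg (by norm_num), add_zero] at h1
      rw [← h1, add_sub_cancel_right]
    | succ k =>
      rw [if_neg (by omega), zero_mul, sub_zero]
      refine hd.eq_const ?_
      rw [coeff_succ_plusSeries]
      have h1 : OrdLE (miwaCoeffOp 1 W.dressInv (k + 1 + 1)) 0 := (hsucc (k + 1)).mono (by norm_num)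
      exact hW.ordLE.mul (h1.sub ((ordLE_D 1).mul (hsucc k)))

theorem dressInv_mul_const_succ [CharZero K] {W : PDO K} (hW : IsKPDressing W) (k : ℕ) :
    W.dressInv * const (PowerSeries.coeff (k + 1) (plusCoeff W)) =
      miwaCoeffOp 1 W.dressInv (k + 1) - D 1 * miwaCoeffOp 1 W.dressInv k +
        if k = 0 then W.dressInv * D 1 else 0 := by
  have h1 := congrArg (PowerSeries.coeff (k + 1)) (plusSeries_eq hW)
  rw [coeff_succ_plusSeries, map_sub, coeff_constSeries, PowerSeries.coeff_mul_C,
    PowerSeries.coeff_X] at h1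
  have h2 := congrArg (W.dressInv * ·) h1
  simp only [← mul_assoc, hW.dressInv_mul, one_mul] at h2
  rw [h2, mul_sub]
  simp only [Nat.add_eq_right]
  split_ifs <;> simp

/-- The coefficients of the adjoint wave function as a power series in `λ⁻¹`. -/
def adjointWaveSeries (W : PDO K) : PowerSeries (TimeSeries K) :=
  PowerSeries.mk fun i => (rsym W.dressInv).coeff i

theorem adjointWave_eq (W : PDO K) :
    adjointWave W = HahnSeries.ofPowerSeries ℤ _ (adjointWaveSeries W) := by
  rw [← rsym_dressInv]
  exact rsym_eq_ofPowerSeries (ordLE_dressInv W)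

theorem rsym_coeff_of_neg {P : PDO K} (hP : OrdLE P 0) {n : ℤ} (hn : n < 0) :
    (rsym P).coeff n = 0 := ((ordLE_D (n - 1)).mul hP) (-1) (by omega)

theorem ordLE_miwaCoeffOp (ε : ℤ) {P : PDO K} {N : ℤ} (h : OrdLE P N) (k : ℕ) :
    OrdLE (miwaCoeffOp ε P k) N := fun n hn => by
  rw [miwaCoeffOp_coeff, h n hn, miwaCoeff_map_zero]

/-- The gauge operator annihilates the adjoint wave function. -/
theorem plusCoeff_mul_adjointWaveSeries [CharZero K] {W : PDO K} (hW : IsKPDressing W) :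
    plusCoeff W * adjointWaveSeries W =
      adjointWaveSeries W - PowerSeries.X * pdx (adjointWaveSeries W) := by
  ext n : 1
  set U := W.dressInv with hU
  have hc0 : PowerSeries.coeff 0 (plusCoeff W) = 1 := by
    rw [plusCoeff, PowerSeries.coeff_mk, coeff_zero_plusSeries hW, one_coeff, if_pos rfl]
  have hX : PowerSeries.coeff n (adjointWaveSeries W - PowerSeries.X * pdx (adjointWaveSeries W)) =
      (rsym U).coeff n - dx ((rsym U).coeff ((n : ℤ) - 1)) := by
    rw [map_sub, adjointWaveSeries, PowerSeries.coeff_mk]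
    congr 1
    cases n with
    | zero =>
      rw [PowerSeries.coeff_zero_X_mul, rsym_coeff_of_neg (ordLE_dressInv W) (by norm_num),
        map_zero]
    | succ n =>
      rw [PowerSeries.coeff_succ_X_mul, coeff_pdx, PowerSeries.coeff_mk, Nat.cast_succ,
        add_sub_cancel_right]
  -- The functions cₖ multiply W⁻¹ from the right, so right symbols are compared; setting z = λ⁻¹
  -- again produces a telescoping sum.
  have hterm : ∀ k : ℕ, PowerSeries.coeff (k + 1) (plusCoeff W) *
      (rsym U).coeff ((n : ℤ) - (k + 1 : ℕ)) =
      ((rsym (miwaCoeffOp 1 U (k + 1))).coeff ((n : ℤ) - (k + 1 : ℕ)) -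
        (rsym (miwaCoeffOp 1 U k)).coeff ((n : ℤ) - k)) +
        if k = 0 then (rsym U).coeff n - dx ((rsym U).coeff ((n : ℤ) - 1)) else 0 := fun k => by
    have h1 := congrArg (fun P : PDO K => (rsym P).coeff ((n : ℤ) - (k + 1 : ℕ)))
      (dressInv_mul_const_succ hW k)
    simp only [map_add, map_sub, rsym_mul_const, HahnSeries.C_mul_eq_smul, HahnSeries.coeff_smul,
      smul_eq_mul, HahnSeries.coeff_add, HahnSeries.coeff_sub, rsym_D_mul,
      HahnSeries.coeff_single_mul, one_mul] at h1
    rw [h1, show (n : ℤ) - (k + 1 : ℕ) - -1 = n - k by push_cast; ring]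
    congr 1
    split_ifs with hk
    · subst hk
      rw [rsym_mul_D_one, waveDxNeg, HahnSeries.coeff_sub, HahnSeries.map_coeff,
        HahnSeries.coeff_single_mul, one_mul]
      congr 2
      · push_cast
        ring
    · rw [map_zero, HahnSeries.coeff_zero]
  have hsum : PowerSeries.coeff n (plusCoeff W * adjointWaveSeries W) =
      ∑ k ∈ Finset.range (n + 2),
        PowerSeries.coeff k (plusCoeff W) * (rsym U).coeff ((n : ℤ) - k) := by
    rw [PowerSeries.coeff_mul, Finset.Nat.sum_antidiagonal_eq_sum_range_succ_mk,
      Finset.sum_range_succ _ (n + 1),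
      rsym_coeff_of_neg (ordLE_dressInv W) (by push_cast; omega), mul_zero, add_zero]
    refine Finset.sum_congr rfl fun k hk => ?_
    rw [Finset.mem_range] at hk
    rw [adjointWaveSeries, PowerSeries.coeff_mk]
    congr 2
    omega
  have hsub := Finset.sum_range_sub
    (fun k => (rsym (miwaCoeffOp 1 U k)).coeff ((n : ℤ) - k)) (n + 1)
  rw [hsum, hX, Finset.sum_range_succ', hc0, one_mul, Finset.sum_congr rfl fun k _ => hterm k,
    Finset.sum_add_distrib, hsub,
    rsym_coeff_of_neg (ordLE_miwaCoeffOp 1 (ordLE_dressInv W) _) (by push_cast; omega),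
    Finset.sum_ite_eq' (Finset.range (n + 1)) 0, miwaCoeffOp_zero,
    if_pos (Finset.mem_range.mpr n.succ_pos)]
  ring

theorem plusSeries_mul_constSeries_mul_C_D_neg_one [CharZero K] {W : PDO K}
    (hW : IsKPDressing W) (F : PowerSeries (TimeSeries K)) :
    plusSeries W * (constSeries F * PowerSeries.C (D (-1))) =
      constSeries (plusCoeff W * F - PowerSeries.X * pdx F) * PowerSeries.C (D (-1)) -
        PowerSeries.X * constSeries F := by
  have h1 : PowerSeries.X * PowerSeries.C (D 1) * (constSeries F * PowerSeries.C (D (-1))) =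
      PowerSeries.X * constSeries F +
        PowerSeries.X * constSeries (pdx F) * PowerSeries.C (D (-1)) := by
    rw [mul_assoc, ← mul_assoc (PowerSeries.C _), C_D_one_mul_constSeries, add_mul, mul_add,
      mul_assoc (constSeries F), C_D_mul_C_D_neg, mul_one, mul_assoc]
  rw [plusSeries_eq hW, sub_mul, h1, map_sub, map_mul, map_mul, constSeries_X, sub_mul,
    ← mul_assoc]
  abel

/-- The action of the Miwa shift on eigenfunctions. -/
theorem IsEigenfunction.miwaSeries_mul [CharZero K] {W : PDO K} (hW : IsKPDressing W)
    {Φ : TimeSeries K} (hΦ : IsEigenfunction W Φ) :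
    plusCoeff W * miwaSeries 1 Φ - PowerSeries.X * pdx (miwaSeries 1 Φ) = PowerSeries.C Φ := by
  set F := plusCoeff W * miwaSeries 1 Φ - PowerSeries.X * pdx (miwaSeries 1 Φ) with hF
  have hF0 : PowerSeries.coeff 0 F = Φ := by
    rw [hF, map_sub, PowerSeries.coeff_zero_X_mul, sub_zero, PowerSeries.coeff_mul,
      Finset.HasAntidiagonal.antidiagonal_zero, Finset.sum_singleton, plusCoeff, miwaSeries,
      PowerSeries.coeff_mk, PowerSeries.coeff_mk, coeff_zero_plusSeries hW,
      miwaCoeff_zero, one_coeff, if_pos rfl, one_mul]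
  have h1 := (isFlowSeries_constSeries_miwaSeries 1 Φ).map
    (e := fun n => (1 : ℤ) • flowHom n.succPNat) (AddMonoidHom.mulRight (D (-1))) fun n x => by
      simp only [one_zsmul_flowHom_apply, AddMonoidHom.mulRight_apply, flow_mul, flow_D, mul_zero,
        add_zero]
  simp only [AddMonoidHom.mulRight_apply, ← PowerSeries.coeff_mul_C] at h1
  have h2 := (isFlowSeries_plusSeries hW).mul (c := leftFlow W) h1 fun n x y => by
    rw [leftFlow_apply, leftFlow_apply, one_zsmul_flowHom_apply, flow_mul, sub_mul, mul_assoc]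
    abel
  have h3 := h2.mem_succ (H := diffSubgroup K) diffSubgroup_saturated ?_
    fun n P hP => leftFlow_isDiff W n hP
  · ext k : 1
    cases k with
    | zero => rw [hF0, PowerSeries.coeff_zero_C]
    | succ k =>
      rw [PowerSeries.coeff_C, if_neg k.succ_ne_zero]
      have h4 := h3 k (-1) (by norm_num)
      rwa [plusSeries_mul_constSeries_mul_C_D_neg_one hW, ← hF, map_sub, PowerSeries.coeff_mul_C,
        PowerSeries.coeff_succ_X_mul, coeff_constSeries, coeff_constSeries, sub_coeff,
        const_mul_D_neg_one_res, const_coeff, if_neg (by norm_num), sub_zero] at h4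
  · intro n
    have h5 : PowerSeries.coeff 0 (plusSeries W *
        (constSeries (miwaSeries 1 Φ) * PowerSeries.C (D (-1)))) = const Φ * D (-1) := by
      rw [plusSeries_mul_constSeries_mul_C_D_neg_one hW, ← hF, map_sub, PowerSeries.coeff_mul_C,
        PowerSeries.coeff_zero_X_mul, coeff_constSeries, hF0, sub_zero]
    have h6 := (hΦ.isDiff n.succPNat).neg
    rw [h5, leftFlow_apply, flow_mul, flow_D, mul_zero, add_zero, flow_const, ← mul_assoc]
    rw [neg_sub] at h6
    exact h6

/-- `Φ D⁻¹` acts from the right on the adjoint wave function as multiplication by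
`λ⁻¹ Φ(t + [λ⁻¹])`. -/
theorem IsEigenfunction.rsym_eq [CharZero K] {W : PDO K} (hW : IsKPDressing W)
    {Φ : TimeSeries K} (hΦ : IsEigenfunction W Φ) :
    rsym (W.dressInv * const Φ * D (-1)) =
      HahnSeries.single 1 1 * adjointWave W * miwaShift 1 Φ := by
  have h1 := hΦ.miwaSeries_mul hW
  have h2 := plusCoeff_mul_adjointWaveSeries hW
  set φ := miwaSeries 1 Φ
  set w := adjointWaveSeries W with hw
  have h3 : HahnSeries.single 1 1 * adjointWave W * miwaShift 1 Φ =
      HahnSeries.ofPowerSeries ℤ _ (PowerSeries.X * (w * φ)) := by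
    rw [map_mul, map_mul, HahnSeries.ofPowerSeries_X, mul_assoc, adjointWave_eq]
    rfl
  rw [h3]
  apply waveDxNeg_injective
  rw [← rsym_mul_D_one, waveDxNeg_ofPowerSeries_X_mul, mul_assoc, D_neg_mul_D, mul_one,
    rsym_mul_const, rsym_dressInv, adjointWave_eq, ← HahnSeries.ofPowerSeries_C, ← map_mul, ← h1,
    pdx_mul, ← hw]
  congr 1
  linear_combination (φ * h2)

/-! ## Uniqueness of solutions of evolution equations -/

/-- The degree of the monomial `t^β` in the times `t₂, t₃, …`. -/
def timeDegree (β : ℕ+ →₀ ℕ) : ℕ := β.sum fun n a => if n = 1 then 0 else a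

theorem timeDegree_add (α β : ℕ+ →₀ ℕ) : timeDegree (α + β) = timeDegree α + timeDegree β :=
  Finsupp.sum_add_index' (fun _ => ite_self _) fun n a b => by split_ifs <;> rfl

theorem timeDegree_single (n : ℕ+) (a : ℕ) :
    timeDegree (Finsupp.single n a) = if n = 1 then 0 else a :=
  Finsupp.sum_single_index (ite_self _)

/-- Functions all of whose monomials have degree at least `d` in the times `t₂, t₃, …`. -/
def timeIdeal (K : Type*) [Field K] (d : ℕ) : Ideal (TimeSeries K) where
  carrier := {f | ∀ β, timeDegree β < d → MvPowerSeries.coeff β f = 0}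
  zero_mem' := fun _ _ => map_zero _
  add_mem' := fun {f g} hf hg β hβ => by rw [map_add, hf β hβ, hg β hβ, add_zero]
  smul_mem' := fun f g hg β hβ => by
    rw [smul_eq_mul, MvPowerSeries.coeff_mul]
    refine Finset.sum_eq_zero fun p hp => ?_
    rw [Finset.HasAntidiagonal.mem_antidiagonal] at hp
    have := timeDegree_add p.1 p.2
    rw [hg p.2 (by rw [hp] at this; omega), mul_zero]

theorem dx_mem_timeIdeal {d : ℕ} {f : TimeSeries K} (hf : f ∈ timeIdeal K d) :
    dx f ∈ timeIdeal K d := fun β hβ => by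
  rw [coeff_dt, hf _ (by rwa [timeDegree_add, timeDegree_single, if_pos rfl, add_zero]), zero_mul]

theorem iterate_dx_mem_timeIdeal {d : ℕ} {f : TimeSeries K} (hf : f ∈ timeIdeal K d) (k : ℕ) :
    dx^[k] f ∈ timeIdeal K d := by
  induction k with
  | zero => exact hf
  | succ k ih =>
    rw [Function.iterate_succ_apply']
    exact dx_mem_timeIdeal ih

theorem exists_ne_one_of_timeDegree {β : ℕ+ →₀ ℕ} (h : timeDegree β ≠ 0) :
    ∃ n : ℕ+, n ≠ 1 ∧ β n ≠ 0 := by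
  by_contra! hc
  exact h (Finset.sum_eq_zero fun n _ => by
    dsimp only
    split_ifs with h1
    · rfl
    · exact hc n h1)

/-- If the flows preserve each level of the filtration by degree in t₂, t₃, …, then vanishing to
degree d forces vanishing to degree d + 1. The hypothesis concerns the whole family at once, because
the coefficients of an operator evolve jointly. -/
theorem eq_zero_of_evolution [CharZero K] {ι : Type*} {f : ι → TimeSeries K}
    (h1 : ∀ i, f i ∈ timeIdeal K 1)
    (hs : ∀ d, (∀ i, f i ∈ timeIdeal K d) → ∀ n i, dt n (f i) ∈ timeIdeal K d) (i : ι) :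
    f i = 0 := by
  have key : ∀ d, ∀ i, f i ∈ timeIdeal K (d + 1) := by
    intro d
    induction d with
    | zero => exact h1
    | succ d ih =>
      intro i β hβ
      rcases lt_or_ge (timeDegree β) (d + 1) with hlt | hge
      · exact ih i β hlt
      · obtain ⟨n, hn, hβn⟩ := exists_ne_one_of_timeDegree (β := β) (by omega)
        have hle : Finsupp.single n 1 ≤ β := by
          rw [Finsupp.single_le_iff]
          exact Nat.one_le_iff_ne_zero.mpr hβn
        obtain ⟨γ, rfl⟩ : ∃ γ, β = γ + Finsupp.single n 1 := ⟨_, (tsub_add_cancel_of_le hle).symm⟩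
        have h2 := hs (d + 1) ih n i γ (by
          rw [timeDegree_add, timeDegree_single, if_neg hn] at hβ
          omega)
        rw [coeff_dt] at h2
        exact (mul_eq_zero.mp h2).resolve_right (by exact_mod_cast (γ n).succ_ne_zero)
  exact MvPowerSeries.ext fun β => key (timeDegree β) i β (Nat.lt_succ_self _)

theorem coeff_iterate_dx [CharZero K] (k j : ℕ) (f : TimeSeries K) :
    ∃ c : K, c ≠ 0 ∧ MvPowerSeries.coeff (Finsupp.single 1 j) (dx^[k] f) =
      MvPowerSeries.coeff (Finsupp.single 1 (j + k)) f * c := by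
  induction k generalizing f with
  | zero => exact ⟨1, one_ne_zero, by simp⟩
  | succ k ih =>
    obtain ⟨c, hc, h⟩ := ih (dx f)
    refine ⟨((j + k : ℕ) + 1) * c, mul_ne_zero (by exact_mod_cast (j + k).succ_ne_zero) hc, ?_⟩
    rw [Function.iterate_succ_apply, h, coeff_dt, ← Finsupp.single_add, Finsupp.single_eq_same,
      add_assoc]
    ring

/-- Level 1 of the filtration means vanishing on the x-axis, and on the x-axis a power series is
determined by its x-jet in characteristic 0. -/
theorem mem_timeIdeal_one_of_jet [CharZero K] {f : TimeSeries K}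
    (h : ∀ k, constantCoeff (dx^[k] f) = 0) : f ∈ timeIdeal K 1 := fun β hβ => by
  have hβ' : β = Finsupp.single 1 (0 + β 1) := by
    rw [zero_add]
    refine Finsupp.ext fun n => ?_
    rcases eq_or_ne n 1 with rfl | hn
    · rw [Finsupp.single_eq_same]
    · rw [Finsupp.single_eq_of_ne hn]
      by_contra hc
      have h1 := Finset.single_le_sum (f := fun n => if n = 1 then 0 else β n)
        (fun _ _ => Nat.zero_le _) (Finsupp.mem_support_iff.mpr hc)
      simp only [if_neg hn] at h1
      change _ ≤ timeDegree β at h1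
      omega
  obtain ⟨c, hc, h1⟩ := coeff_iterate_dx (β 1) 0 f
  rw [Finsupp.single_zero, MvPowerSeries.coeff_zero_eq_constantCoeff_apply, h, ← hβ'] at h1
  exact (mul_eq_zero.mp h1.symm).resolve_right hc

/-! ### Operators with coefficients in the time filtration -/

namespace PDO

/-- All coefficients of `P` have degree at least `d` in the times `t₂, t₃, …`. -/
def InTimeIdeal (d : ℕ) (P : PDO K) : Prop := ∀ n, P.coeff n ∈ timeIdeal K d

theorem InTimeIdeal.mul_left {d : ℕ} {Q : PDO K} (hQ : InTimeIdeal d Q) (P : PDO K) :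
    InTimeIdeal d (P * Q) := fun n => by
  obtain ⟨M, hM⟩ := P.exists_ordLE
  obtain ⟨N, hN⟩ := Q.exists_ordLE
  have hκ : M + N - n < (M + N - n + 1).toNat := by omega
  rw [mul_coeff_eq_sum (a := n - N) hM hN (by omega) le_rfl hκ]
  exact sum_mem fun i _ => Ideal.mul_mem_left _ _ (sum_mem fun k _ =>
    zsmul_mem (iterate_dx_mem_timeIdeal (hQ _) k) _)

theorem InTimeIdeal.mul_right {d : ℕ} {P : PDO K} (hP : InTimeIdeal d P) (Q : PDO K) :
    InTimeIdeal d (P * Q) := fun n => by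
  obtain ⟨M, hM⟩ := P.exists_ordLE
  obtain ⟨N, hN⟩ := Q.exists_ordLE
  have hκ : M + N - n < (M + N - n + 1).toNat := by omega
  rw [mul_coeff_eq_sum (a := n - N) hM hN (by omega) le_rfl hκ]
  exact sum_mem fun i _ => Ideal.mul_mem_right _ _ (hP _)

theorem inTimeIdeal_const {d : ℕ} {f : TimeSeries K} (hf : f ∈ timeIdeal K d) :
    InTimeIdeal d (const f) := fun n => by
  rw [const_coeff]
  split_ifs
  · exact hf
  · exact zero_mem _

theorem InTimeIdeal.sub {d : ℕ} {P Q : PDO K} (hP : InTimeIdeal d P) (hQ : InTimeIdeal d Q) :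
    InTimeIdeal d (P - Q) := fun n => by
  rw [sub_coeff]
  exact sub_mem (hP n) (hQ n)

theorem inTimeIdeal_sum {ι : Type*} {s : Finset ι} {f : ι → PDO K} {d : ℕ}
    (h : ∀ i ∈ s, InTimeIdeal d (f i)) : InTimeIdeal d (∑ i ∈ s, f i) := fun n => by
  rw [sum_coeff]
  exact sum_mem fun i hi => h i hi n

end PDO

/-- The difference solves ∂f/∂tₙ = Bₙ(f), and Bₙ differentiates only in x, hence preserves the
filtration. -/
theorem IsEigenfunction.eq_of_jet [CharZero K] {W : PDO K} {f g : TimeSeries K}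
    (hf : IsEigenfunction W f) (hg : IsEigenfunction W g)
    (h : ∀ k, constantCoeff (dx^[k] f) = constantCoeff (dx^[k] g)) : f = g := by
  rw [isEigenfunction_iff] at hf hg
  refine sub_eq_zero.mp (eq_zero_of_evolution (f := fun _ : Unit => f - g) (fun _ => ?_) ?_ ())
  · refine mem_timeIdeal_one_of_jet fun k => ?_
    rw [iterate_map_sub, map_sub, h, sub_self]
  · intro d hd n _
    have e : dt n (f - g) = (flowOp W n * const (f - g)).coeff 0 := by
      rw [map_sub, hf, hg, const_sub, mul_sub, sub_coeff]
    rw [e]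
    exact (inTimeIdeal_const (hd ())).mul_left _ 0

theorem IsAdjointEigenfunction.eq_of_jet [CharZero K] {W : PDO K} {f g : TimeSeries K}
    (hf : IsAdjointEigenfunction W f) (hg : IsAdjointEigenfunction W g)
    (h : ∀ k, constantCoeff (dx^[k] f) = constantCoeff (dx^[k] g)) : f = g := by
  rw [isAdjointEigenfunction_iff] at hf hg
  refine sub_eq_zero.mp (eq_zero_of_evolution (f := fun _ : Unit => f - g) (fun _ => ?_) ?_ ())
  · refine mem_timeIdeal_one_of_jet fun k => ?_
    rw [iterate_map_sub, map_sub, h, sub_self]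
  · intro d hd n _
    have e : dt n (f - g) = -(D (-1) * const (f - g) * flowOp W n).coeff (-1) := by
      rw [map_sub, hf, hg, const_sub, mul_sub, sub_mul, sub_coeff]
      ring
    rw [e]
    exact neg_mem ((((inTimeIdeal_const (hd ())).mul_left _).mul_right _) (-1))

/-! ## Spectral integrals -/

theorem coeff_expCoeff (ε : ℤ) (k : ℕ) (α : ℕ+ →₀ ℕ) :
    MvPowerSeries.coeff α (expCoeff ε k : TimeSeries K) =
      if weight α = k then α.prod fun _ a => (ε : K) ^ a / (a.factorial : K) else 0 := rfl

/-- The Schur polynomials are homogeneous in weight, so each monomial of t meets only finitely many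
terms of a spectral integral. -/
theorem coeff_mul_expCoeff_eq_zero (ε : ℤ) {k : ℕ} {β : ℕ+ →₀ ℕ} (h : weight β < k)
    (f : TimeSeries K) : MvPowerSeries.coeff β (f * expCoeff ε k) = 0 := by
  rw [MvPowerSeries.coeff_mul]
  refine Finset.sum_eq_zero fun p hp => ?_
  rw [Finset.HasAntidiagonal.mem_antidiagonal] at hp
  have := weight_add p.1 p.2
  rw [coeff_expCoeff, if_neg (by rw [hp] at this; omega), mul_zero]

theorem coeff_spectralIntegral (ε : ℤ) (g : LaurentSeries (TimeSeries K)) {β : ℕ+ →₀ ℕ} {N : ℕ}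
    (hN : weight β < N) : MvPowerSeries.coeff β (spectralIntegral ε g) =
      ∑ k ∈ Finset.range N, MvPowerSeries.coeff β (g.coeff (1 + k) * expCoeff ε k) := by
  change ∑ᶠ k : ℕ, MvPowerSeries.coeff β (g.coeff (1 + k) * expCoeff ε k) = _
  refine finsum_eq_sum_of_support_subset _ fun k hk => ?_
  rw [Finset.coe_range, Set.mem_Iio]
  by_contra h
  exact hk (coeff_mul_expCoeff_eq_zero ε (by omega) _)

theorem spectralIntegral_add (ε : ℤ) (g h : LaurentSeries (TimeSeries K)) :
    spectralIntegral ε (g + h) = spectralIntegral ε g + spectralIntegral ε h := by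
  refine MvPowerSeries.ext fun β => ?_
  have hN := Nat.lt_succ_self (weight β)
  rw [map_add, coeff_spectralIntegral ε _ hN, coeff_spectralIntegral ε _ hN,
    coeff_spectralIntegral ε _ hN, ← Finset.sum_add_distrib]
  refine Finset.sum_congr rfl fun k _ => ?_
  rw [HahnSeries.coeff_add, add_mul, map_add]

/-- The spectral integral as an additive map. -/
def spectralIntegralHom (K : Type*) [Field K] (ε : ℤ) :
    LaurentSeries (TimeSeries K) →+ TimeSeries K :=
  AddMonoidHom.mk' (spectralIntegral ε) (spectralIntegral_add ε)

theorem spectralIntegral_neg (ε : ℤ) (g : LaurentSeries (TimeSeries K)) :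
    spectralIntegral ε (-g) = -spectralIntegral ε g := map_neg (spectralIntegralHom K ε) g

theorem spectralIntegral_C_mul (ε : ℤ) (f : TimeSeries K) (g : LaurentSeries (TimeSeries K)) :
    spectralIntegral ε (HahnSeries.C f * g) = f * spectralIntegral ε g := by
  refine MvPowerSeries.ext fun β => ?_
  have hN := Nat.lt_succ_self (weight β)
  rw [coeff_spectralIntegral ε _ hN, MvPowerSeries.coeff_mul]
  have h1 : ∀ p ∈ antidiagonal β, MvPowerSeries.coeff p.1 f *
      MvPowerSeries.coeff p.2 (spectralIntegral ε g) = ∑ k ∈ Finset.range (weight β).succ,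
        MvPowerSeries.coeff p.1 f *
          MvPowerSeries.coeff p.2 (g.coeff (1 + k) * expCoeff ε k) := fun p hp => by
    rw [Finset.HasAntidiagonal.mem_antidiagonal] at hp
    have := weight_add p.1 p.2
    rw [coeff_spectralIntegral ε g (N := (weight β).succ) (by rw [hp] at this; omega),
      Finset.mul_sum]
  rw [Finset.sum_congr rfl h1, Finset.sum_comm]
  refine Finset.sum_congr rfl fun k _ => ?_
  rw [HahnSeries.C_mul_eq_smul, HahnSeries.coeff_smul, smul_eq_mul, mul_assoc,
    MvPowerSeries.coeff_mul]

theorem constantCoeff_spectralIntegral (ε : ℤ) (g : LaurentSeries (TimeSeries K)) :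
    constantCoeff (spectralIntegral ε g) = constantCoeff (g.coeff 1) := by
  rw [← MvPowerSeries.coeff_zero_eq_constantCoeff_apply, coeff_spectralIntegral ε g (N := 1)
    (by rw [weight_eq_zero.mpr rfl]; norm_num), Finset.sum_range_one,
    MvPowerSeries.coeff_zero_eq_constantCoeff_apply, map_mul]
  have : constantCoeff (expCoeff ε 0 : TimeSeries K) = 1 := by
    rw [← MvPowerSeries.coeff_zero_eq_constantCoeff_apply, coeff_expCoeff,
      if_pos (weight_eq_zero.mpr rfl), Finsupp.prod_zero_index]
  rw [this, mul_one, Nat.cast_zero, add_zero]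

theorem dt_expCoeff [CharZero K] (ε : ℤ) (n : ℕ+) (k : ℕ) :
    dt n (expCoeff ε k : TimeSeries K) =
      if (n : ℕ) ≤ k then (ε : TimeSeries K) * expCoeff ε (k - n) else 0 := by
  refine MvPowerSeries.ext fun α => ?_
  have hε : ((ε : TimeSeries K)) = MvPowerSeries.C (ε : K) := by rw [map_intCast]
  rw [coeff_dt, coeff_expCoeff, weight_add, weight_single, mul_one]
  have hprod : ((α + Finsupp.single n 1).prod fun _ a => (ε : K) ^ a / (a.factorial : K)) *
      ((α n : K) + 1) = ε * α.prod fun _ a => (ε : K) ^ a / (a.factorial : K) := by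
    classical
    set s := insert n α.support
    have hl : n ∈ s := Finset.mem_insert_self _ _
    have hs : α.support ⊆ s := Finset.subset_insert _ _
    have hs' : (α + Finsupp.single n 1).support ⊆ s := by
      refine Finsupp.support_add.trans (Finset.union_subset hs ?_)
      exact Finsupp.support_single_subset.trans (Finset.singleton_subset_iff.mpr hl)
    rw [Finsupp.prod_of_support_subset _ hs' _ (by simp),
      Finsupp.prod_of_support_subset _ hs _ (by simp), ← Finset.mul_prod_erase s _ hl,
      ← Finset.mul_prod_erase s (fun j => (ε : K) ^ α j / ((α j).factorial : K)) hl]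
    have e : ∀ j ∈ s.erase n, (ε : K) ^ ((α + Finsupp.single n 1 : ℕ+ →₀ ℕ) j) /
        (((α + Finsupp.single n 1 : ℕ+ →₀ ℕ) j).factorial : K) =
          (ε : K) ^ α j / ((α j).factorial : K) := fun j hj => by
      rw [Finsupp.add_apply, Finsupp.single_eq_of_ne (Finset.ne_of_mem_erase hj), add_zero]
    rw [Finset.prod_congr rfl e, Finsupp.add_apply, Finsupp.single_eq_same, Nat.factorial_succ,
      pow_succ]
    have h1 : ((α n).factorial : K) ≠ 0 := Nat.cast_ne_zero.mpr (Nat.factorial_ne_zero _)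
    have h2 : (α n : K) + 1 ≠ 0 := by exact_mod_cast (α n).succ_ne_zero
    push_cast
    field_simp
  split_ifs with h1 h2 h2
  · rw [hprod, hε, MvPowerSeries.coeff_C_mul, coeff_expCoeff, if_pos (by omega)]
  · omega
  · rw [hε, MvPowerSeries.coeff_C_mul, coeff_expCoeff, if_neg (by omega), zero_mul, mul_zero]
  · rw [zero_mul, map_zero]

/-- Differentiation under the integral: ∂/∂tₙ of e^{εξ} brings down ελⁿ. -/
theorem dt_spectralIntegral [CharZero K] (ε : ℤ) (n : ℕ+) (g : LaurentSeries (TimeSeries K)) :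
    dt n (spectralIntegral ε g) = spectralIntegral ε
      (HahnSeries.map g (dt (K := K) n) + ε • (HahnSeries.single (-(n : ℤ)) 1 * g)) := by
  refine MvPowerSeries.ext fun β => ?_
  rw [coeff_dt, coeff_spectralIntegral ε g (N := n + (weight β).succ)
    (by rw [weight_add, weight_single]; omega), spectralIntegral_add, map_add,
    coeff_spectralIntegral ε _ (N := n + (weight β).succ) (by omega),
    coeff_spectralIntegral ε _ (N := (weight β).succ) (by omega), Finset.sum_mul]
  have h1 : ∀ k : ℕ, MvPowerSeries.coeff (β + Finsupp.single n 1)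
      (g.coeff (1 + k) * expCoeff ε k) * ((β n : K) + 1) =
      MvPowerSeries.coeff β (dt n (g.coeff (1 + k)) * expCoeff ε k) +
        MvPowerSeries.coeff β (g.coeff (1 + k) * dt n (expCoeff ε k)) := fun k => by
    rw [← coeff_dt, Derivation.leibniz, smul_eq_mul, smul_eq_mul, map_add, add_comm,
      mul_comm (expCoeff ε k)]
  rw [Finset.sum_congr rfl fun k _ => h1 k, Finset.sum_add_distrib]
  congr 1
  -- The Schur polynomials with k < n do not involve tₙ; the others shift k by n, which is
  -- multiplication by λⁿ.
  rw [Finset.sum_range_add, Finset.sum_eq_zero, zero_add]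
  · refine Finset.sum_congr rfl fun k _ => ?_
    rw [dt_expCoeff, if_pos (by omega), Nat.add_sub_cancel_left, HahnSeries.coeff_smul,
      HahnSeries.coeff_single_mul, one_mul, zsmul_eq_mul]
    have : (1 : ℤ) + ((n + k : ℕ) : ℤ) = 1 + k - -(n : ℤ) := by push_cast; ring
    rw [this]
    congr 1
    ring
  · intro k hk
    rw [Finset.mem_range] at hk
    rw [dt_expCoeff, if_neg (by omega), mul_zero, map_zero]

/-! ## Spectral representation of eigenfunctions -/

@[simp] theorem evalZero_coeff (g : LaurentSeries (TimeSeries K)) (n : ℤ) :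
    (evalZero g).coeff n = constantCoeff (g.coeff n) := rfl

theorem evalZero_mul (g h : LaurentSeries (TimeSeries K)) :
    evalZero (g * h) = evalZero g * evalZero h :=
  HahnSeries.map_mul (constantCoeff (σ := ℕ+) (R := K) : TimeSeries K →ₙ+* K)

theorem evalZero_single (n : ℤ) :
    evalZero (HahnSeries.single n 1 : LaurentSeries (TimeSeries K)) = HahnSeries.single n 1 := by
  ext m : 2
  rw [evalZero_coeff, HahnSeries.coeff_single, HahnSeries.coeff_single]
  split_ifs <;> simp

theorem evalZero_constInTime (φ : LaurentSeries K) : evalZero (constInTime φ) = φ := by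
  ext n : 2
  rw [evalZero_coeff, constInTime, HahnSeries.map_coeff, MvPowerSeries.constantCoeff_C]

theorem map_dt_constInTime_mul (n : ℕ+) (φ : LaurentSeries K) (g : LaurentSeries (TimeSeries K)) :
    HahnSeries.map (constInTime φ * g) (dt (K := K) n) =
      constInTime φ * HahnSeries.map g (dt (K := K) n) := by
  ext m : 2
  have hsub : (HahnSeries.map g (dt (K := K) n)).support ⊆ g.support := fun j hj => by
    rw [HahnSeries.mem_support, HahnSeries.map_coeff] at hj
    rw [HahnSeries.mem_support]
    intro h
    exact hj (by rw [h, map_zero])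
  rw [HahnSeries.map_coeff, HahnSeries.coeff_mul, HahnSeries.coeff_mul_right' g.isPWO_support hsub,
    map_sum]
  refine Finset.sum_congr rfl fun p _ => ?_
  rw [Derivation.leibniz, smul_eq_mul, smul_eq_mul, constInTime, HahnSeries.map_coeff,
    HahnSeries.map_coeff]
  have : dt n (MvPowerSeries.C (φ.coeff p.1)) = 0 := MvPowerSeries.pderiv_C
  rw [this, mul_zero, add_zero]

theorem constInTime_mul_waveDx (φ : LaurentSeries K) (g : LaurentSeries (TimeSeries K)) :
    waveDx (constInTime φ * g) = constInTime φ * waveDx g := by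
  rw [waveDx, waveDx, map_dt_constInTime_mul]
  ring

theorem constInTime_mul_waveDxNeg (φ : LaurentSeries K) (g : LaurentSeries (TimeSeries K)) :
    waveDxNeg (constInTime φ * g) = constInTime φ * waveDxNeg g := by
  rw [waveDxNeg, waveDxNeg, map_dt_constInTime_mul]
  ring

theorem dx_spectralIntegral_one [CharZero K] (g : LaurentSeries (TimeSeries K)) :
    dx (spectralIntegral 1 g) = spectralIntegral 1 (waveDx g) := by
  rw [dt_spectralIntegral, one_smul]
  rfl

theorem dx_spectralIntegral_neg_one [CharZero K] (g : LaurentSeries (TimeSeries K)) :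
    dx (spectralIntegral (-1) g) = -spectralIntegral (-1) (waveDxNeg g) := by
  rw [dt_spectralIntegral, neg_one_zsmul, ← spectralIntegral_neg, waveDxNeg, neg_sub,
    ← sub_eq_add_neg]
  rfl

theorem map_dt_lsym (n : ℕ+) (P : PDO K) :
    HahnSeries.map (lsym P) (dt (K := K) n) = lsym (P.flow n) := rfl

theorem map_dt_rsym (n : ℕ+) (P : PDO K) :
    HahnSeries.map (rsym P) (dt (K := K) n) = rsym (P.flow n) := by
  ext m : 2
  rw [HahnSeries.map_coeff, rsym_coeff, rsym_coeff, ← flow_coeff, flow_mul, flow_D, zero_mul,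
    zero_add]

/-- `∫ dλ φ(λ) (P ψ)(t, λ)`. -/
def waveFunctional (W : PDO K) (φ : LaurentSeries K) : PDO K →+ TimeSeries K :=
  (spectralIntegralHom K 1).comp ((AddMonoidHom.mulLeft (constInTime φ)).comp
    (lsym.comp (AddMonoidHom.mulRight W)))

/-- `∫ dλ φ(λ) (P* ψ*)(t, λ)`. -/
def adjointWaveFunctional (W : PDO K) (φ : LaurentSeries K) : PDO K →+ TimeSeries K :=
  (spectralIntegralHom K (-1)).comp ((AddMonoidHom.mulLeft (constInTime φ)).comp
    (rsym.comp (AddMonoidHom.mulLeft W.dressInv)))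

theorem waveFunctional_apply (W : PDO K) (φ : LaurentSeries K) (P : PDO K) :
    waveFunctional W φ P = spectralIntegral 1 (constInTime φ * lsym (P * W)) := rfl

theorem adjointWaveFunctional_apply (W : PDO K) (φ : LaurentSeries K) (P : PDO K) :
    adjointWaveFunctional W φ P =
      spectralIntegral (-1) (constInTime φ * rsym (W.dressInv * P)) := rfl

theorem waveFunctional_D_one_mul [CharZero K] (W : PDO K) (φ : LaurentSeries K) (P : PDO K) :
    waveFunctional W φ (D 1 * P) = dx (waveFunctional W φ P) := by
  rw [waveFunctional_apply, waveFunctional_apply, dx_spectralIntegral_one, constInTime_mul_waveDx,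
    mul_assoc, lsym_D_one_mul]

theorem adjointWaveFunctional_mul_D_one [CharZero K] (W : PDO K) (φ : LaurentSeries K)
    (P : PDO K) :
    adjointWaveFunctional W φ (P * D 1) = -dx (adjointWaveFunctional W φ P) := by
  rw [adjointWaveFunctional_apply, adjointWaveFunctional_apply, dx_spectralIntegral_neg_one,
    constInTime_mul_waveDxNeg, ← mul_assoc, rsym_mul_D_one, neg_neg]

/-- A differential operator can be taken out of the integral, since functions and ∂ₓ can. -/
theorem waveFunctional_eq [CharZero K] (W : PDO K) (φ : LaurentSeries K) {B : PDO K}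
    (hB : IsDiff B) :
    waveFunctional W φ B = (B * const (waveFunctional W φ 1)).coeff 0 := by
  set f := waveFunctional W φ 1 with hf
  refine hB.induction_left (p := fun B => waveFunctional W φ B = (B * const f).coeff 0)
    ?_ ?_ ?_ ?_ ?_
  · rw [map_zero, zero_mul, zero_coeff]
  · rw [one_mul, const_coeff, if_pos rfl]
  · intro P Q _ _ hP hQ
    rw [map_add, add_mul, add_coeff, hP, hQ]
  · intro g P _ hP
    rw [mul_assoc, const_mul_coeff, ← hP, waveFunctional_apply, waveFunctional_apply, mul_assoc,
      lsym_const_mul, mul_left_comm, spectralIntegral_C_mul]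
  · intro P hPd hP
    rw [waveFunctional_D_one_mul, hP, mul_assoc, D_one_mul_coeff,
      (hPd.mul (isDiff_const f)) (0 - 1) (by norm_num), add_zero]

theorem adjointWaveFunctional_eq [CharZero K] (W : PDO K) (φ : LaurentSeries K) {B : PDO K}
    (hB : IsDiff B) :
    adjointWaveFunctional W φ B =
      (D (-1) * const (adjointWaveFunctional W φ 1) * B).coeff (-1) := by
  set f := adjointWaveFunctional W φ 1 with hf
  refine hB.induction_right
    (p := fun B => adjointWaveFunctional W φ B = (D (-1) * const f * B).coeff (-1)) ?_ ?_ ?_ ?_ ?_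
  · rw [map_zero, mul_zero, zero_coeff]
  · rw [mul_one, D_neg_one_mul_const_res]
  · intro P Q _ _ hP hQ
    rw [map_add, mul_add, add_coeff, hP, hQ]
  · intro g P _ hP
    rw [← mul_assoc, res_mul_const, ← hP, adjointWaveFunctional_apply, adjointWaveFunctional_apply,
      ← mul_assoc, rsym_mul_const, mul_left_comm, spectralIntegral_C_mul, mul_comm]
  · intro P hPd hP
    have h1 : (D 1 * (D (-1) * const f * P)).coeff (-1) = 0 := by
      rw [← mul_assoc, ← mul_assoc, D_mul_D_neg, one_mul]
      exact ((isDiff_const f).mul hPd) (-1) (by norm_num)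
    rw [D_one_mul_coeff] at h1
    rw [adjointWaveFunctional_mul_D_one, hP, ← mul_assoc, mul_D_coeff, neg_eq_of_add_eq_zero_right h1]

/-- ψ itself satisfies ∂ψ/∂tₙ = Bₙψ, and Bₙ is differential; a superposition with t-independent
density inherits the equation. -/
theorem isEigenfunction_waveFunctional [CharZero K] {W : PDO K} (hW : IsKPDressing W)
    (φ : LaurentSeries K) : IsEigenfunction W (waveFunctional W φ 1) := by
  rw [isEigenfunction_iff]
  intro n
  rw [← waveFunctional_eq W φ (isDiff_flowOp W n), waveFunctional_apply, waveFunctional_apply,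
    dt_spectralIntegral, one_smul, map_dt_constInTime_mul, map_dt_lsym, one_mul, hW.flow_eq,
    mul_left_comm, ← mul_add, ← lsym_mul_D, ← map_add, sub_add_cancel]

theorem isAdjointEigenfunction_adjointWaveFunctional [CharZero K] {W : PDO K}
    (hW : IsKPDressing W) (φ : LaurentSeries K) :
    IsAdjointEigenfunction W (adjointWaveFunctional W φ 1) := by
  rw [isAdjointEigenfunction_iff]
  intro n
  rw [← adjointWaveFunctional_eq W φ (isDiff_flowOp W n), adjointWaveFunctional_apply,
    adjointWaveFunctional_apply, dt_spectralIntegral, neg_one_zsmul, ← sub_eq_add_neg,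
    map_dt_constInTime_mul, map_dt_rsym, mul_one, hW.flow_dressInv, mul_left_comm, ← mul_sub,
    ← rsym_D_mul, ← map_sub, sub_sub_cancel_left, ← mul_neg, ← adjointWaveFunctional_apply,
    ← adjointWaveFunctional_apply, map_neg]

theorem waveFunctional_D [CharZero K] (W : PDO K) (φ : LaurentSeries K) (k : ℕ) :
    waveFunctional W φ (D k) = dx^[k] (waveFunctional W φ 1) := by
  induction k with
  | zero => rfl
  | succ k ih => rw [D_succ, waveFunctional_D_one_mul, ih, Function.iterate_succ_apply']

theorem adjointWaveFunctional_D [CharZero K] (W : PDO K) (φ : LaurentSeries K) (k : ℕ) :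
    adjointWaveFunctional W φ (D k) = (-1) ^ k * dx^[k] (adjointWaveFunctional W φ 1) := by
  induction k with
  | zero =>
    rw [pow_zero, one_mul]
    rfl
  | succ k ih =>
    have h : dx ((-1 : TimeSeries K) ^ k) = 0 := by
      have h1 : (-1 : TimeSeries K) ^ k = MvPowerSeries.C ((-1) ^ k) := by simp
      rw [h1]
      exact MvPowerSeries.pderiv_C
    rw [D_succ', adjointWaveFunctional_mul_D_one, ih, Function.iterate_succ_apply',
      Derivation.leibniz, h, smul_zero, add_zero, smul_eq_mul, pow_succ]
    ring

/-- The residue of a product of operators in terms of symbols. -/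
theorem coeff_one_rsym_mul_lsym (P Q : PDO K) :
    (rsym Q * lsym P).coeff 1 = (P * Q).coeff (-1) := by
  obtain ⟨M, hM⟩ := P.exists_ordLE
  obtain ⟨N, hN⟩ := Q.exists_ordLE
  rw [mul_coeff_eq_sum_D (a := -1 - N) (b := M) hM hN (by omega) le_rfl, HahnSeries.coeff_mul]
  refine Finset.sum_bij_ne_zero (fun p _ _ => -p.2) ?_ ?_ ?_ ?_
  · rintro ⟨i, j⟩ hp _
    rw [Finset.mem_antidiagonal] at hp
    obtain ⟨h1, h2, h3⟩ := hp
    simp only at h1 h2 h3 ⊢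
    rw [Finset.mem_Icc]
    constructor
    · by_contra hc
      exact h1 (((ordLE_D (i - 1)).mul hN) (-1) (by omega))
    · by_contra hc
      exact h2 (hM (-j) (by omega))
  · rintro ⟨i, j⟩ hp _ ⟨i', j'⟩ hp' _ h
    rw [Finset.mem_antidiagonal] at hp hp'
    have h1 := hp.2.2
    have h2 := hp'.2.2
    simp only at h h1 h2
    exact Prod.ext (by simp only; omega) (by simp only; omega)
  · intro m _ hm
    have e : (rsym Q).coeff (m + 1) = (D m * Q).coeff (-1) := by
      rw [rsym_coeff, add_sub_cancel_right]
    refine ⟨(m + 1, -m), ?_, ?_, neg_neg m⟩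
    · rw [Finset.mem_antidiagonal]
      refine ⟨?_, ?_, by ring⟩
      · rw [HahnSeries.mem_support, e]
        exact right_ne_zero_of_mul hm
      · rw [HahnSeries.mem_support, lsym_coeff, neg_neg]
        exact left_ne_zero_of_mul hm
    · rw [e, lsym_coeff, neg_neg, mul_comm]
      exact hm
  · rintro ⟨i, j⟩ hp _
    rw [Finset.mem_antidiagonal] at hp
    have h1 := hp.2.2
    simp only at h1 ⊢
    rw [rsym_coeff, lsym_coeff, mul_comm, show i - 1 = -j by omega]

theorem D_mul_const_coeff_zero (k : ℕ) (f : TimeSeries K) :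
    (D k * const f).coeff 0 = dx^[k] f := by
  have : Ring.choose (k : ℤ) k = 1 := by
    have := Ring.choose_natCast (R := ℤ) k k
    simpa using this
  rw [D_mul_const_coeff k 0 f k (zero_add _), this, one_smul]

/-! ### Eigenfunctions with a prescribed x-jet -/

/-- The eigenfunction that has the same `x`-jet at `t = 0` as a given function. -/
def eigenLift (W : PDO K) (Φ : TimeSeries K) : TimeSeries K :=
  waveFunctional W (evalZero (rsym (W.dressInv * const Φ * D (-1)))) 1

/-- The adjoint eigenfunction that has the same `x`-jet at `t = 0` as a given function. -/
def adjointEigenLift (W : PDO K) (Ψ : TimeSeries K) : TimeSeries K :=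
  adjointWaveFunctional W (evalZero (lsym (D (-1) * const Ψ * W))) 1

/-- At t = 0 the integral is a residue in λ. By the residue pairing it is Res(Dᵏ W · W⁻¹ Φ D⁻¹) =
Res(Dᵏ Φ D⁻¹) = ∂ᵏΦ. No equation for Φ is needed, which part (2) exploits. -/
theorem jet_eigenLift [CharZero K] {W : PDO K} (hW : IsKPDressing W) (Φ : TimeSeries K) (k : ℕ) :
    constantCoeff (dx^[k] (eigenLift W Φ)) = constantCoeff (dx^[k] Φ) := by
  rw [eigenLift, ← waveFunctional_D, waveFunctional_apply, constantCoeff_spectralIntegral,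
    ← evalZero_coeff, evalZero_mul, evalZero_constInTime, ← evalZero_mul, evalZero_coeff,
    coeff_one_rsym_mul_lsym, mul_assoc, mul_assoc, ← mul_assoc W, hW.mul_dressInv, one_mul,
    ← mul_assoc, mul_D_coeff, sub_self, D_mul_const_coeff_zero]

theorem res_D_neg_one_mul_const_mul_D (k : ℕ) (f : TimeSeries K) :
    (D (-1) * const f * D k).coeff (-1) = (-1) ^ k * dx^[k] f := by
  have h2 : Ring.choose (-1 : ℤ) k = ((k : ℤ).negOnePow : ℤ) := by
    have h3 : Ring.choose (k : ℤ) k = 1 := by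
      have := Ring.choose_natCast (R := ℤ) k k
      simpa using this
    rw [Ring.choose_neg, add_sub_cancel_left, h3, Units.smul_def, smul_eq_mul, mul_one]
  rw [mul_D_coeff, D_mul_const_coeff (-1) (-1 - k) f k (by ring), h2, Int.negOnePow_def,
    zpow_natCast, zsmul_eq_mul]
  simp

theorem jet_adjointEigenLift [CharZero K] {W : PDO K} (hW : IsKPDressing W) (Ψ : TimeSeries K)
    (k : ℕ) :
    constantCoeff (dx^[k] (adjointEigenLift W Ψ)) = constantCoeff (dx^[k] Ψ) := by
  have h : constantCoeff ((-1) ^ k * dx^[k] (adjointEigenLift W Ψ)) =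
      constantCoeff ((-1) ^ k * dx^[k] Ψ) := by
    rw [adjointEigenLift, ← adjointWaveFunctional_D, adjointWaveFunctional_apply,
      constantCoeff_spectralIntegral, ← evalZero_coeff, evalZero_mul, evalZero_constInTime,
      ← evalZero_mul, evalZero_coeff, mul_comm, coeff_one_rsym_mul_lsym, mul_assoc _ W,
      ← mul_assoc W, hW.mul_dressInv, one_mul, res_D_neg_one_mul_const_mul_D]
  rw [map_mul, map_mul] at h
  refine mul_left_cancel₀ ?_ h
  rw [map_pow, map_neg, map_one]
  exact pow_ne_zero _ (neg_ne_zero.mpr one_ne_zero)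

theorem isEigenfunction_eigenLift [CharZero K] {W : PDO K} (hW : IsKPDressing W)
    (Φ : TimeSeries K) : IsEigenfunction W (eigenLift W Φ) :=
  isEigenfunction_waveFunctional hW _

theorem isAdjointEigenfunction_adjointEigenLift [CharZero K] {W : PDO K} (hW : IsKPDressing W)
    (Ψ : TimeSeries K) : IsAdjointEigenfunction W (adjointEigenLift W Ψ) :=
  isAdjointEigenfunction_adjointWaveFunctional hW _

theorem IsEigenfunction.eigenLift_eq [CharZero K] {W : PDO K} (hW : IsKPDressing W)
    {Φ : TimeSeries K} (hΦ : IsEigenfunction W Φ) : eigenLift W Φ = Φ :=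
  (isEigenfunction_eigenLift hW Φ).eq_of_jet hΦ (jet_eigenLift hW Φ)

theorem IsAdjointEigenfunction.adjointEigenLift_eq [CharZero K] {W : PDO K} (hW : IsKPDressing W)
    {Ψ : TimeSeries K} (hΨ : IsAdjointEigenfunction W Ψ) : adjointEigenLift W Ψ = Ψ :=
  (isAdjointEigenfunction_adjointEigenLift hW Ψ).eq_of_jet hΨ (jet_adjointEigenLift hW Ψ)

theorem density_eq [CharZero K] {W : PDO K} (hW : IsKPDressing W) {Φ : TimeSeries K}
    (hΦ : IsEigenfunction W Φ) :
    density W Φ = evalZero (rsym (W.dressInv * const Φ * D (-1))) := by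
  rw [hΦ.rsym_eq hW, evalZero_mul, evalZero_mul, evalZero_single, density]

theorem adjointDensity_eq [CharZero K] {W : PDO K} (hW : IsKPDressing W) {Ψ : TimeSeries K}
    (hΨ : IsAdjointEigenfunction W Ψ) :
    adjointDensity W Ψ = evalZero (lsym (D (-1) * const Ψ * W)) := by
  rw [hΨ.lsym_eq hW, evalZero_mul, evalZero_mul, evalZero_single, adjointDensity]
  ring

theorem spectralSEP_eq [CharZero K] {W : PDO K} (hW : IsKPDressing W) {Φ Ψ : TimeSeries K}
    (hΦ : IsEigenfunction W Φ) (hΨ : IsAdjointEigenfunction W Ψ) :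
    spectralSEP W Φ Ψ = -adjointWaveFunctional W (evalZero (lsym (D (-1) * const Ψ * W)))
      (const Φ * D (-1)) := by
  -- The inner integral over μ reproduces Φ, which is then shifted by [λ⁻¹].
  have h1 : spectralIntegral 1 (constInTime (density W Φ) * wave W) = Φ := by
    rw [density_eq hW hΦ, ← lsym_eq_wave hW.ordLE]
    have := hΦ.eigenLift_eq hW
    rwa [eigenLift, waveFunctional_apply, one_mul] at this
  rw [spectralSEP, h1, adjointDensity_eq hW hΨ, adjointWaveFunctional_apply, ← mul_assoc,
    hΦ.rsym_eq hW]
  simp only [mul_assoc]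

/-- The spectral formula defines a squared eigenfunction potential. -/
theorem isSEP_spectralSEP [CharZero K] {W : PDO K} (hW : IsKPDressing W) {Φ Ψ : TimeSeries K}
    (hΦ : IsEigenfunction W Φ) (hΨ : IsAdjointEigenfunction W Ψ) :
    IsSEP W Φ Ψ (spectralSEP W Φ Ψ) := by
  intro n
  set φ := evalZero (lsym (D (-1) * const Ψ * W)) with hφ
  set Q := flowOp W n * const Φ * D (-1) - const (dt n Φ) * D (-1) with hQ
  have hΨ1 : adjointWaveFunctional W φ 1 = Ψ := hΨ.adjointEigenLift_eq hW
  have h1 : dt n (spectralSEP W Φ Ψ) = adjointWaveFunctional W φ Q := by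
    -- After differentiation under the integral, W⁻¹ Φ D⁻¹ is replaced by -W⁻¹ Q: the Dⁿ from e^{-ξ}
    -- cancels that in ∂W⁻¹/∂tₙ.
    have e : (W.dressInv * (const Φ * D (-1))).flow n -
        D (n : ℕ) * (W.dressInv * (const Φ * D (-1))) = -(W.dressInv * Q) := by
      rw [flow_mul, flow_mul, flow_D, mul_zero, add_zero, flow_const, hW.flow_dressInv, hQ]
      noncomm_ring
    rw [spectralSEP_eq hW hΦ hΨ, map_neg, adjointWaveFunctional_apply, dt_spectralIntegral,
      neg_one_zsmul, ← sub_eq_add_neg, map_dt_constInTime_mul, map_dt_rsym, mul_left_comm,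
      ← mul_sub, ← rsym_D_mul, ← map_sub, e, ← mul_neg, ← adjointWaveFunctional_apply, map_neg,
      neg_neg]
  have h2 : D (-1) * const Ψ * flowOp W n * const Φ * D (-1) =
      D (-1) * const Ψ * Q + D (-1) * const Ψ * (const (dt n Φ) * D (-1)) := by
    rw [hQ]
    noncomm_ring
  -- Q is differential, so the functional of Q is Res(D⁻¹ Ψ Q); the part removed from Bₙ Φ D⁻¹ to
  -- form Q has no residue, as this product has order -2.
  have h3 : (D (-1) * const Ψ * (const (dt n Φ) * D (-1))).coeff (-1) = 0 :=
    (((ordLE_D (-1)).mul (ordLE_const Ψ)).mul ((ordLE_const _).mul (ordLE_D (-1)))) (-1)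
      (by norm_num)
  rw [h1, adjointWaveFunctional_eq W φ (hΦ.isDiff n), hΨ1, PDO.res, h2, add_coeff, h3, add_zero]

/-! ## The constrained form of the Lax operator -/

/-- `∑ₐ Φₐ D⁻¹ Ψₐ`. -/
def constraintTail {m : ℕ} (Φ Ψ : Fin m → TimeSeries K) : PDO K :=
  ∑ a, const (Φ a) * D (-1) * const (Ψ a)

theorem ordLE_constraintTail {m : ℕ} (Φ Ψ : Fin m → TimeSeries K) :
    OrdLE (constraintTail Φ Ψ) (-1) :=
  ordLE_sum fun _ _ => ((ordLE_const _).mul (ordLE_D (-1))).mul (ordLE_const _)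

theorem laxPow_mul {W : PDO K} (hW : IsKPDressing W) (n : ℕ) : laxPow W n * W = W * D n := by
  rw [laxPow, mul_assoc, hW.dressInv_mul, mul_one]

/-- The leading coefficient 1 commutes with D, so a commutator loses two orders. This is why L has
no D^{r-1} term. -/
theorem ordLE_D_mul_sub_mul_D {W : PDO K} (hW : IsKPDressing W) (k : ℕ) :
    OrdLE (D k * W - W * D k) (k - 2) := by
  have h1 : OrdLE (D 1 * W - W * D 1) (-1) := fun n hn => by
    rw [sub_coeff, D_one_mul_coeff, mul_D_coeff, add_sub_cancel_right]
    rcases (show n = 0 ∨ 0 < n by omega) with rfl | hn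
    · rw [hW.coeff_zero, Derivation.map_one_eq_zero]
    · rw [hW.coeff_pos n hn, map_zero]
  induction k with
  | zero =>
    rw [Nat.cast_zero, D_zero, one_mul, mul_one, sub_self]
    exact ordLE_zero _
  | succ k ih =>
    have e : D ((k + 1 : ℕ) : ℤ) * W - W * D ((k + 1 : ℕ) : ℤ) =
        D 1 * (D k * W - W * D k) + (D 1 * W - W * D 1) * D k := by
      rw [D_succ]
      noncomm_ring
    rw [e]
    exact (((ordLE_D 1).mul ih).mono (by push_cast; omega)).add
      ((h1.mul (ordLE_D k)).mono (by push_cast; omega))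

theorem ordLE_laxPow_sub {W : PDO K} (hW : IsKPDressing W) (k : ℕ) :
    OrdLE (laxPow W k - D k) (k - 2) := by
  have e : laxPow W k - D k = -((D k * W - W * D k) * W.dressInv) := by
    rw [sub_mul, mul_assoc (D _), hW.mul_dressInv, mul_one, neg_sub, laxPow]
  rw [e]
  exact (((ordLE_D_mul_sub_mul_D hW k).mul (ordLE_dressInv W)).mono (by omega)).neg

theorem hasCKPForm_iff {W : PDO K} (hW : IsKPDressing W) {r m : ℕ} (hr : 1 ≤ r)
    (Φ Ψ : Fin m → TimeSeries K) :
    HasCKPForm r (laxPow W r) Φ Ψ ↔ IsDiff (laxPow W r - constraintTail Φ Ψ) := by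
  constructor
  · rintro ⟨u, hu⟩
    rw [hu, constraintTail, add_sub_cancel_right]
    exact (isDiff_D r).add (isDiff_sum fun l _ n hn => if_neg (by omega))
  · intro h
    refine ⟨fun l => (laxPow W r).coeff l, ?_⟩
    ext n : 1
    change _ = (D r + _ + constraintTail Φ Ψ).coeff n
    rw [add_coeff, add_coeff, sum_coeff]
    simp only [monomial_coeff, D_coeff]
    rcases lt_or_ge n 0 with hn | hn
    · have h1 := h n hn
      rw [sub_coeff, sub_eq_zero] at h1
      rw [h1, if_neg (by omega), Finset.sum_eq_zero fun l _ => if_neg (by omega), zero_add,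
        zero_add]
    · rw [ordLE_constraintTail Φ Ψ n (by omega), add_zero]
      lift n to ℕ using hn
      by_cases hnr : n < r - 1
      · rw [if_neg (by omega), zero_add, Finset.sum_eq_single n, if_pos rfl]
        · exact fun l _ hl => if_neg (by omega)
        · exact fun hl => absurd (Finset.mem_range.mpr hnr) hl
      · have h1 := ordLE_laxPow_sub hW r n (by omega)
        rw [sub_coeff, sub_eq_zero] at h1
        rw [h1, D_coeff, Finset.sum_eq_zero, add_zero]
        intro l hl
        rw [Finset.mem_range] at hl
        exact if_neg (by omega)

theorem flow_laxPow {W : PDO K} (hW : IsKPDressing W) (r : ℕ) (n : ℕ+) :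
    (laxPow W r).flow n = flowOp W n * laxPow W r - laxPow W r * flowOp W n := by
  have hD : (D (n : ℕ) * D r : PDO K) = D r * D (n : ℕ) := by rw [D_mul_D, D_mul_D, add_comm]
  have h : W * D (n : ℕ) * D r * W.dressInv = W * D r * (D (n : ℕ) * W.dressInv) := by
    rw [mul_assoc W, hD]
    noncomm_ring
  rw [laxPow, flow_mul, flow_mul, flow_D, mul_zero, add_zero, hW.flow_eq, hW.flow_dressInv, mul_sub,
    sub_mul, sub_mul, h]
  noncomm_ring

/-- Modulo differential operators the tail obeys the Lax equation, term by term: Bₙ Φ D⁻¹ Ψ is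
(∂Φ/∂tₙ) D⁻¹ Ψ, and Φ D⁻¹ Ψ Bₙ is -Φ D⁻¹ (∂Ψ/∂tₙ). -/
theorem isDiff_flow_constraintTail {W : PDO K} {m : ℕ} {Φ Ψ : Fin m → TimeSeries K}
    (hΦ : ∀ a, IsEigenfunction W (Φ a)) (hΨ : ∀ a, IsAdjointEigenfunction W (Ψ a)) (n : ℕ+) :
    IsDiff (flowOp W n * constraintTail Φ Ψ - constraintTail Φ Ψ * flowOp W n -
      (constraintTail Φ Ψ).flow n) := by
  have e : flowOp W n * constraintTail Φ Ψ - constraintTail Φ Ψ * flowOp W n -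
      (constraintTail Φ Ψ).flow n =
      ∑ a, ((flowOp W n * const (Φ a) * D (-1) - const (dt n (Φ a)) * D (-1)) * const (Ψ a) -
        const (Φ a) * (D (-1) * const (Ψ a) * flowOp W n + D (-1) * const (dt n (Ψ a)))) := by
    rw [constraintTail, Finset.mul_sum, Finset.sum_mul, flow_sum, ← Finset.sum_sub_distrib,
      ← Finset.sum_sub_distrib]
    refine Finset.sum_congr rfl fun a _ => ?_
    rw [flow_mul, flow_mul, flow_const, flow_const, flow_D]
    noncomm_ring
  rw [e]
  exact isDiff_sum fun a _ => (((hΦ a).isDiff n).mul (isDiff_const _)).sub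
    ((isDiff_const _).mul ((hΨ a).isDiff n))

theorem isDiff_of_mem_timeIdeal [CharZero K] {W : PDO K} (hW : IsKPDressing W) (r : ℕ) {m : ℕ}
    {Φ Ψ : Fin m → TimeSeries K} (hΦ : ∀ a, IsEigenfunction W (Φ a))
    (hΨ : ∀ a, IsAdjointEigenfunction W (Ψ a))
    (h : ∀ n < 0, (laxPow W r - constraintTail Φ Ψ).coeff n ∈ timeIdeal K 1) :
    IsDiff (laxPow W r - constraintTail Φ Ψ) := by
  set X := laxPow W r - constraintTail Φ Ψ with hX
  refine fun n hn => eq_zero_of_evolution (f := fun i : {n : ℤ // n < 0} => X.coeff i)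
    (fun i => h i i.2) (fun d hd n i => ?_) ⟨n, hn⟩
  have hneg : InTimeIdeal d X.neg := fun j => by
    rw [neg_part_coeff]
    split_ifs with hj
    · exact zero_mem _
    · exact hd ⟨j, by omega⟩
  set Y := flowOp W n * constraintTail Φ Ψ - constraintTail Φ Ψ * flowOp W n -
    (constraintTail Φ Ψ).flow n with hY
  -- Everything involving X₊ is differential, so the negative coefficients evolve by [Bₙ, X₋] alone,
  -- linearly in X₋.
  have e : X.flow n = (flowOp W n * X.neg - X.neg * flowOp W n) +
      (flowOp W n * X.pos - X.pos * flowOp W n + Y) := by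
    have e1 : X.flow n = flowOp W n * (X.pos + X.neg) - (X.pos + X.neg) * flowOp W n + Y := by
      rw [pos_add_neg, hX, hY, flow_sub, flow_laxPow hW]
      noncomm_ring
    rw [e1]
    noncomm_ring
  have hB := isDiff_flowOp W n
  have hdiff : IsDiff (flowOp W n * X.pos - X.pos * flowOp W n + Y) :=
    ((hB.mul (isDiff_pos X)).sub ((isDiff_pos X).mul hB)).add (isDiff_flow_constraintTail hΦ hΨ n)
  change dt n (X.coeff i) ∈ _
  rw [← flow_coeff, e, add_coeff, hdiff i i.2, add_zero]
  exact ((hneg.mul_left _).sub (hneg.mul_right _)) i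

/-! ## The constraint on the point of the Grassmannian -/

theorem iterate_waveDx_lsym (k : ℕ) (P : PDO K) : waveDx^[k] (lsym P) = lsym (D k * P) := by
  induction k with
  | zero => rw [Nat.cast_zero, D_zero, one_mul, Function.iterate_zero_apply]
  | succ k ih => rw [Function.iterate_succ_apply', ih, ← lsym_D_one_mul, ← mul_assoc, ← D_succ]

theorem evalZero_lsym_const_mul (f : TimeSeries K) (P : PDO K) :
    evalZero (lsym (const f * P)) = constantCoeff f • evalZero (lsym P) := by
  ext n : 2
  rw [HahnSeries.coeff_smul, evalZero_coeff, evalZero_coeff, lsym_coeff, lsym_coeff,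
    const_mul_coeff, map_mul, smul_eq_mul]

theorem evalZero_lsym_add (P Q : PDO K) :
    evalZero (lsym (P + Q)) = evalZero (lsym P) + evalZero (lsym Q) := by
  ext n : 2
  rw [HahnSeries.coeff_add, evalZero_coeff, evalZero_coeff, evalZero_coeff, lsym_coeff, lsym_coeff,
    lsym_coeff, add_coeff, map_add]

theorem evalZero_lsym_zero : evalZero (lsym (0 : PDO K)) = 0 := by
  ext n : 2
  rw [evalZero_coeff, lsym_coeff, zero_coeff, map_zero, HahnSeries.coeff_zero]

/-- The point of the Grassmannian consists of the values at `t = 0` of the series `B ψ`, `B` a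
differential operator. -/
theorem mem_grassmannPoint_wave {W : PDO K} (hW : OrdLE W 0) {y : LaurentSeries K} :
    y ∈ grassmannPoint (wave W) ↔ ∃ B, IsDiff B ∧ y = evalZero (lsym (B * W)) := by
  rw [← lsym_eq_wave hW]
  constructor
  · intro hy
    refine Submodule.span_induction (p := fun y _ => ∃ B, IsDiff B ∧ y = evalZero (lsym (B * W)))
      ?_ ⟨0, isDiff_zero, by rw [zero_mul, evalZero_lsym_zero]⟩ ?_ ?_ hy
    · rintro _ ⟨k, rfl⟩
      exact ⟨D k, isDiff_D k, by rw [← iterate_waveDx_lsym]⟩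
    · rintro _ _ _ _ ⟨A, hA, rfl⟩ ⟨B, hB, rfl⟩
      exact ⟨A + B, hA.add hB, by rw [add_mul, evalZero_lsym_add]⟩
    · rintro c _ _ ⟨B, hB, rfl⟩
      refine ⟨const (MvPowerSeries.C c) * B, (isDiff_const _).mul hB, ?_⟩
      rw [mul_assoc, evalZero_lsym_const_mul, MvPowerSeries.constantCoeff_C]
  · rintro ⟨B, hB, rfl⟩
    obtain ⟨N, hN⟩ := B.exists_ordLE_nat
    rw [hB.eq_sum hN]
    refine Finset.sum_induction _
      (fun P => evalZero (lsym (P * W)) ∈ grassmannPoint (lsym W)) ?_ ?_ ?_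
    · intro P Q hP hQ
      rw [add_mul, evalZero_lsym_add]
      exact add_mem hP hQ
    · rw [zero_mul, evalZero_lsym_zero]
      exact zero_mem _
    · intro j _
      rw [mul_assoc, evalZero_lsym_const_mul, ← iterate_waveDx_lsym]
      exact Submodule.smul_mem _ _ (Submodule.subset_span ⟨j, rfl⟩)

theorem constantCoeff_mul_coeff {P : PDO K} (hP : ∀ n, constantCoeff (P.coeff n) = 0) (Q : PDO K)
    (n : ℤ) : constantCoeff ((P * Q).coeff n) = 0 := by
  obtain ⟨M, hM⟩ := P.exists_ordLE
  obtain ⟨N, hN⟩ := Q.exists_ordLE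
  have hκ : M + N - n < (M + N - n + 1).toNat := by omega
  rw [mul_coeff_eq_sum (a := n - N) hM hN (by omega) le_rfl hκ, map_sum]
  exact Finset.sum_eq_zero fun i _ => by rw [map_mul, hP, zero_mul]

/-- The product formula never differentiates the left factor, so W can be cancelled on the right
after restriction to t = 0. -/
theorem constantCoeff_coeff_eq {W : PDO K} (hW : IsKPDressing W) {P Q : PDO K}
    (h : evalZero (lsym (P * W)) = evalZero (lsym (Q * W))) (n : ℤ) :
    constantCoeff (P.coeff n) = constantCoeff (Q.coeff n) := by
  have h1 : ∀ n, constantCoeff (((P - Q) * W).coeff n) = 0 := fun n => by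
    have h2 := congrArg (fun g => HahnSeries.coeff g (-n)) h
    simp only [evalZero_coeff, lsym_coeff, neg_neg] at h2
    rw [sub_mul, sub_coeff, map_sub, h2, sub_self]
  have h3 := constantCoeff_mul_coeff h1 W.dressInv n
  rwa [mul_assoc, hW.mul_dressInv, mul_one, sub_coeff, map_sub, sub_eq_zero] at h3

/-- ∂ₓ of a coefficient of Y is a coefficient of D Y minus the next lower coefficient of Y. Both
have negative index if the original one does, so jets are traded for powers of D. -/
theorem jet_eq_zero_of_D_mul {X : PDO K}
    (h : ∀ k : ℕ, ∀ n < 0, constantCoeff ((D k * X).coeff n) = 0) (j : ℕ) :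
    ∀ k : ℕ, ∀ n < 0, constantCoeff (dx^[j] ((D k * X).coeff n)) = 0 := by
  induction j with
  | zero => exact h
  | succ j ih =>
    intro k n hn
    have e : dx ((D k * X).coeff n) =
        (D ((k + 1 : ℕ) : ℤ) * X).coeff n - (D k * X).coeff (n - 1) := by
      rw [D_succ, mul_assoc, D_one_mul_coeff, add_sub_cancel_right]
    rw [Function.iterate_succ_apply, e, iterate_map_sub, map_sub, ih (k + 1) n hn,
      ih k (n - 1) (by omega), sub_self]

theorem multiplier_mul_wave [CharZero K] {W : PDO K} (hW : IsKPDressing W) (r : ℕ) {m : ℕ}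
    {Φ Ψ S : Fin m → TimeSeries K} (hΦ : ∀ a, IsEigenfunction W (Φ a))
    (hΨ : ∀ a, IsAdjointEigenfunction W (Ψ a)) (hS : ∀ a, IsSEP W (Φ a) (Ψ a) (S a)) :
    (HahnSeries.single (-(r : ℤ)) 1 + ∑ a, shiftDiff (S a)) * wave W =
      lsym ((laxPow W r - constraintTail Φ Ψ) * W) := by
  have h : (∑ a, shiftDiff (S a)) * wave W = lsym (-(constraintTail Φ Ψ * W)) := by
    rw [constraintTail, Finset.sum_mul, Finset.sum_mul, ← Finset.sum_neg_distrib, map_sum]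
    exact Finset.sum_congr rfl fun a _ => by
      rw [(hS a).shiftDiff_mul_wave hW (hΦ a) (hΨ a), map_neg]
  rw [sub_mul, laxPow_mul hW, sub_eq_add_neg, map_add, ← h, lsym_mul_D, lsym_eq_wave hW.ordLE,
    add_mul]

theorem grassmannConstraint_iff [CharZero K] {W : PDO K} (hW : IsKPDressing W) (r : ℕ) {m : ℕ}
    {Φ Ψ S : Fin m → TimeSeries K} (hΦ : ∀ a, IsEigenfunction W (Φ a))
    (hΨ : ∀ a, IsAdjointEigenfunction W (Ψ a)) (hS : ∀ a, IsSEP W (Φ a) (Ψ a) (S a)) :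
    GrassmannConstraint r W S ↔ IsDiff (laxPow W r - constraintTail Φ Ψ) := by
  rw [GrassmannConstraint, multiplier_mul_wave hW r hΦ hΨ hS, grassmannPoint, Submodule.span_le,
    Set.range_subset_iff]
  simp only [SetLike.mem_coe, mem_grassmannPoint_wave hW.ordLE, iterate_waveDx_lsym]
  constructor
  · intro h
    refine isDiff_of_mem_timeIdeal hW r hΦ hΨ fun n hn => mem_timeIdeal_one_of_jet fun j => ?_
    -- The power 0 of D gives X itself; the hypothesis for all k is supplied by the generators ∂ₓᵏ
    -- F' of the span.
    have := jet_eq_zero_of_D_mul (X := laxPow W r - constraintTail Φ Ψ) (fun k n hn => ?_) j 0 n hn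
    · rwa [Nat.cast_zero, D_zero, one_mul] at this
    · obtain ⟨B, hB, e⟩ := h k
      rw [← mul_assoc] at e
      rw [constantCoeff_coeff_eq hW e, hB n hn, map_zero]
  · exact fun h k => ⟨D k * _, (isDiff_D k).mul h, by rw [mul_assoc]⟩

theorem sub_mem_timeIdeal_of_jet [CharZero K] {f g : TimeSeries K}
    (h : ∀ k, constantCoeff (dx^[k] f) = constantCoeff (dx^[k] g)) : f - g ∈ timeIdeal K 1 :=
  mem_timeIdeal_one_of_jet fun k => by rw [iterate_map_sub, map_sub, h k, sub_self]

/-- The functions in the constrained form may be replaced by (adjoint) eigenfunctions. -/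
theorem isDiff_sub_constraintTail_eigenLift [CharZero K] {W : PDO K} (hW : IsKPDressing W) (r : ℕ)
    {m : ℕ} {Φ Ψ : Fin m → TimeSeries K} (h : IsDiff (laxPow W r - constraintTail Φ Ψ)) :
    IsDiff (laxPow W r -
      constraintTail (fun a => eigenLift W (Φ a)) fun a => adjointEigenLift W (Ψ a)) := by
  refine isDiff_of_mem_timeIdeal hW r (fun a => isEigenfunction_eigenLift hW _)
    (fun a => isAdjointEigenfunction_adjointEigenLift hW _) fun n hn => ?_
  -- The old and new functions agree on t₂ = t₃ = ⋯ = 0, hence so do the tails; there the negative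
  -- part of the new X vanishes with that of the old one.
  have hT : InTimeIdeal 1 (constraintTail (fun a => eigenLift W (Φ a))
      (fun a => adjointEigenLift W (Ψ a)) - constraintTail Φ Ψ) := by
    rw [constraintTail, constraintTail, ← Finset.sum_sub_distrib]
    refine inTimeIdeal_sum fun a _ => ?_
    have e : const (eigenLift W (Φ a)) * D (-1) * const (adjointEigenLift W (Ψ a)) -
        const (Φ a) * D (-1) * const (Ψ a) =
        const (eigenLift W (Φ a)) * D (-1) * const (adjointEigenLift W (Ψ a) - Ψ a) -
          const (Φ a - eigenLift W (Φ a)) * (D (-1) * const (Ψ a)) := by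
      rw [const_sub, const_sub]
      noncomm_ring
    rw [e]
    exact ((inTimeIdeal_const (sub_mem_timeIdeal_of_jet (jet_adjointEigenLift hW _))).mul_left _).sub
      ((inTimeIdeal_const (sub_mem_timeIdeal_of_jet
        fun k => (jet_eigenLift hW _ k).symm)).mul_right _)
  rw [← sub_sub_sub_cancel_right _ _ (constraintTail Φ Ψ), sub_coeff, h n hn]
  exact sub_mem (zero_mem _) (hT n)

end KP

end

/-! ### The main theorem -/

theorem mainTheorem7 {K : Type*} [Field K] [CharZero K] (r m : ℕ) (hr : 1 ≤ r)
    (W : KP.PDO K) (hW : KP.IsKPDressing W) :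
    (∀ Φ Ψ : Fin m → KP.TimeSeries K,
      (∀ a, KP.IsEigenfunction W (Φ a)) → (∀ a, KP.IsAdjointEigenfunction W (Ψ a)) →
        (∀ a, KP.IsSEP W (Φ a) (Ψ a) (KP.spectralSEP W (Φ a) (Ψ a))) ∧
        ∀ S : Fin m → KP.TimeSeries K, (∀ a, KP.IsSEP W (Φ a) (Ψ a) (S a)) →
          (KP.HasCKPForm r (KP.laxPow W r) Φ Ψ ↔ KP.GrassmannConstraint r W S)) ∧
    ((∃ Φ Ψ : Fin m → KP.TimeSeries K, KP.HasCKPForm r (KP.laxPow W r) Φ Ψ) ↔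
      ∃ Φ Ψ : Fin m → KP.TimeSeries K,
        (∀ a, KP.IsEigenfunction W (Φ a)) ∧ (∀ a, KP.IsAdjointEigenfunction W (Ψ a)) ∧
        KP.GrassmannConstraint r W fun a => KP.spectralSEP W (Φ a) (Ψ a)) := by
  have key : ∀ Φ Ψ S : Fin m → KP.TimeSeries K, (∀ a, KP.IsEigenfunction W (Φ a)) →
      (∀ a, KP.IsAdjointEigenfunction W (Ψ a)) → (∀ a, KP.IsSEP W (Φ a) (Ψ a) (S a)) →
      (KP.HasCKPForm r (KP.laxPow W r) Φ Ψ ↔ KP.GrassmannConstraint r W S) :=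
    fun Φ Ψ S hΦ hΨ hS => (KP.hasCKPForm_iff hW hr Φ Ψ).trans
      (KP.grassmannConstraint_iff hW r hΦ hΨ hS).symm
  refine ⟨fun Φ Ψ hΦ hΨ => ⟨fun a => KP.isSEP_spectralSEP hW (hΦ a) (hΨ a),
    fun S hS => key Φ Ψ S hΦ hΨ hS⟩, ?_, ?_⟩
  · rintro ⟨Φ, Ψ, h⟩
    have hΦ := fun a => KP.isEigenfunction_eigenLift hW (Φ a)
    have hΨ := fun a => KP.isAdjointEigenfunction_adjointEigenLift hW (Ψ a)
    refine ⟨_, _, hΦ, hΨ, ?_⟩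
    rw [KP.grassmannConstraint_iff hW r hΦ hΨ
      fun a => KP.isSEP_spectralSEP hW (hΦ a) (hΨ a)]
    exact KP.isDiff_sub_constraintTail_eigenLift hW r ((KP.hasCKPForm_iff hW hr Φ Ψ).mp h)
  · rintro ⟨Φ, Ψ, hΦ, hΨ, h⟩
    exact ⟨Φ, Ψ, (key Φ Ψ _ hΦ hΨ fun a => KP.isSEP_spectralSEP hW (hΦ a) (hΨ a)).mpr h⟩
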